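/- Let $m$ be a number of modes. On $L^2(\mathbb R^m)$ let $\mathbf x_j$ be multiplication by the $j$-th coordinate, $\mathbf p_j=-i\partial_j$, $\mathbf R=(\mathbf x_1,\mathbf p_1,\dots,\mathbf x_m,\mathbf p_m)^\top$, $\mathbf a_j=(\mathbf x_j+i\mathbf p_j)/\sqrt2$, $N_m=\sum_{j}\mathbf a_j^\dagger\mathbf a_j$, and for $z\in\mathbb C^m$ let $D_z=\bigotimes_{j}\exp(z_j\mathbf a_j^\dagger-\bar z_j\mathbf a_j)$. A state is a positive trace-class operator of trace $1$. The characteristic function of a trace-class operator $T$ is $\chi_T(z)=\operatorname{tr}(TD_z)$; the first moments of a state $\rho$ are $\mathbf d(\rho)=\operatorname{tr}(\rho\mathbf R)$, its covariance matrix is $\boldsymbol\gamma(\rho)=\operatorname{tr}\big(\rho\{\mathbf R-\mathbf d(\rho),(\mathbf R-\mathbf d(\rho))^\top\}\big)$ with $\{A,B\}=AB+BA$, and $\rho$ has finite moments of order $\kappa$ if $\operatorname{tr}\big(\rho(N_m+m)^{\kappa/2}\big)<\infty$. A state $\sigma$ is Gaussian if $$\chi_\sigma(z)=\exp\Big(-\tfrac14\hat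 z^\dagger\Lambda_m^\dagger\boldsymbol\gamma(\sigma)\Lambda_m\hat z+i\,\mathbf d(\sigma)^\top\Lambda_m\hat z\Big),\qquad \hat z=(z_1,\bar z_1,\dots,z_m,\bar z_m)^\top,\quad \Lambda_m=\bigoplus_{j=1}^m\frac1{\sqrt2}\begin{pmatrix}-i&i\\-1&-1\end{pmatrix},$$ and it is centered if $\mathbf d(\sigma)=0$. Let $\Omega_m=\bigoplus_{j=1}^m\begin{pmatrix}0&1\\-1&0\end{pmatrix}$, let $D(\rho\|\sigma)=\operatorname{tr}\big(\rho(\ln\rho-\ln\sigma)\big)\in[0,\infty]$ be the quantum relative entropy, and let $\|\cdot\|_2$ be the Hilbert--Schmidt norm (with value $+\infty$ for operators that are not Hilbert--Schmidt). Theorem. Let $\tau$ be either a thermal state $\prod_{j=1}^m(1-e^{-\beta_j})e^{-\beta_j\mathbf a_j^\dagger\mathbf a_j}$ with $0<\beta_j<\infty$ for all $j$, or any centered Gaussian $m$-mode state for which $\boldsymbol\gamma(\tau)+i\Omega_m$ has full rank $2m$. Let $E(z)=E(z,\bar z)$ be a polynomial with complex coefficients in $z_1,\dots,z_m,\bar z_1,\dots,\bar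 z_m$ such that $E(-z)=-E(z)=\overline{E(z)}$ for all $z\in\mathbb C^m$. Then there is a constant $C_{\tau,E}>0$, depending only on $\tau$ and $E$, such that for every $\alpha\in\mathbb R$ there is exactly one trace-class operator $\tau_\alpha$ on $L^2(\mathbb R^m)$ with $\chi_{\tau_\alpha}(z)=\chi_\tau(z)\,(1+\alpha E(z))$ for all $z\in\mathbb C^m$, and for every $m$-mode state $\rho$ with finite moments of order $m+3$, $$D(\rho\|\tau)\le C_{\tau,E}\Big(\alpha^2+\big\|(\rho-\tau_\alpha)(N_m+m)^{(m+3)/2}\big\|_2\Big).$$ -/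

import Mathlib

open MeasureTheory
open scoped ENNReal ComplexConjugate

noncomputable section

namespace Bosonic

/-! ### Operators on a Hilbert space -/

section Operators

variable {H : Type*} [NormedAddCommGroup H] [InnerProductSpace ℂ H] [CompleteSpace H]

/-- An index set of an orthonormal basis of `H`. -/
def basisIndex (H : Type*) [NormedAddCommGroup H] [InnerProductSpace ℂ H] [CompleteSpace H] :
    Set H :=
  Classical.choose (exists_hilbertBasis ℂ H)

/-- Some orthonormal basis of `H`; nothing below depends on which one it is. -/
def someBasis (H : Type*) [NormedAddCommGroup H] [InnerProductSpace ℂ H] [CompleteSpace H] :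
    HilbertBasis (basisIndex H) ℂ H :=
  Classical.choose (Classical.choose_spec (exists_hilbertBasis ℂ H))

/-- The trace norm `‖T‖₁ = tr |T|`, with `|T| = √(T† T)`. -/
def traceNorm (T : H →L[ℂ] H) : ℝ≥0∞ :=
  ∑' i, ENNReal.ofReal (inner ℂ (someBasis H i) (CFC.abs T (someBasis H i))).re

/-- `T` is trace class: `‖T‖₁ < ∞`. -/
def IsTraceClass (T : H →L[ℂ] H) : Prop := traceNorm T < ⊤

/-- The trace of a trace-class operator. -/
def trace (T : H →L[ℂ] H) : ℂ := ∑' i, inner ℂ (someBasis H i) (T (someBasis H i))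

/-- The square `tr (T† T)` of the Hilbert--Schmidt norm of a bounded operator. -/
def hsNormSq (T : H →L[ℂ] H) : ℝ≥0∞ := ∑' i, ‖T (someBasis H i)‖ₑ ^ 2

/-- Quantum states (density operators): positive trace-class operators of trace one. -/
structure IsState (ρ : H →L[ℂ] H) : Prop where
  positive : ρ.IsPositive
  traceClass : IsTraceClass ρ
  trace_one : trace ρ = 1

/-- The orthogonal projection onto the eigenspace `ker (A - p)`. -/
def eigenProj (A : H →L[ℂ] H) (p : ℝ) : H →L[ℂ] H :=
  (A - (p : ℂ) • ContinuousLinearMap.id ℂ H).ker.starProjection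

/-- `p (ln p - ln q) - p + q ∈ [0, ∞]` for `p, q ≥ 0`, with `0 ln 0 = 0`, and `ln 0 = -∞`
in the second logarithm. -/
def relEntropyTerm (p q : ℝ) : ℝ≥0∞ :=
  if q = 0 then (if p = 0 then 0 else ⊤)
  else ENNReal.ofReal (p * (Real.log p - Real.log q) - p + q)

/-- The quantum relative entropy `D(ρ‖σ) = tr (ρ (ln ρ - ln σ)) ∈ [0, ∞]` of two states.

With the spectral decompositions `ρ = ∑ p P_p` and `σ = ∑ q Q_q`, it is the sum of
`p (ln p - ln q) tr (P_p Q_q)`. As `ρ` and `σ` have the same trace, adding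
`(q - p) tr (P_p Q_q)` to each term does not change the sum, but makes all its terms
nonnegative, so that the sum has a meaning in `[0, ∞]` for all pairs of states. Note that
`tr (P_p Q_q)` is the squared Hilbert--Schmidt norm of `P_p Q_q`. -/
def relEntropy (ρ σ : H →L[ℂ] H) : ℝ≥0∞ :=
  ∑' p : ℝ, ∑' q : ℝ, relEntropyTerm p q * hsNormSq (eigenProj ρ p ∘L eigenProj σ q)

end Operators

/-! ### The Hilbert space of `m` modes, displacement operators, Fock states -/

/-- The Hilbert space `L²(ℝᵐ)` of an `m`-mode system. -/
abbrev Modes (m : ℕ) : Type := Lp ℂ 2 (volume : Measure (Fin m → ℝ))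

/-- The function `x ↦ exp (i ∑ⱼ (√2 Im zⱼ xⱼ - Re zⱼ Im zⱼ)) f (x - √2 Re z)`. -/
def displaceFun {m : ℕ} (z : Fin m → ℂ) (f : (Fin m → ℝ) → ℂ) (x : Fin m → ℝ) : ℂ :=
  Complex.exp (((∑ j, (√2 * (z j).im * x j - (z j).re * (z j).im) : ℝ) : ℂ) * Complex.I) *
    f (x - fun j => √2 * (z j).re)

lemma norm_displaceFun {m : ℕ} (z : Fin m → ℂ) (f : (Fin m → ℝ) → ℂ) (x : Fin m → ℝ) :
    ‖displaceFun z f x‖ = ‖f (x - fun j => √2 * (z j).re)‖ := by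
  rw [displaceFun, norm_mul, Complex.norm_exp_ofReal_mul_I, one_mul]

lemma memLp_displaceFun {m : ℕ} (z : Fin m → ℂ) {f : (Fin m → ℝ) → ℂ} (hf : MemLp f 2 volume) :
    MemLp (displaceFun z f) 2 volume := by
  have h := hf.comp_measurePreserving
    (measurePreserving_sub_right (volume : Measure (Fin m → ℝ)) (fun j => √2 * (z j).re))
  refine h.of_le ?_ (Filter.Eventually.of_forall fun x => (norm_displaceFun z f x).le)
  refine AEStronglyMeasurable.mul ?_ h.aestronglyMeasurable
  exact Continuous.aestronglyMeasurable (by fun_prop)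

lemma displaceFun_congr {m : ℕ} (z : Fin m → ℂ) {f g : (Fin m → ℝ) → ℂ} (h : f =ᵐ[volume] g) :
    displaceFun z f =ᵐ[volume] displaceFun z g := by
  have h' := (measurePreserving_sub_right (volume : Measure (Fin m → ℝ))
    (fun j => √2 * (z j).re)).quasiMeasurePreserving.ae_eq h
  filter_upwards [h'] with x hx
  simp only [Function.comp_apply] at hx
  simp only [displaceFun, hx]

/-- The action of `displaceFun z` on classes of functions. -/
def displaceLinear {m : ℕ} (z : Fin m → ℂ) : Modes m →ₗ[ℂ] Modes m where
  toFun f := (memLp_displaceFun z (Lp.memLp f)).toLp (displaceFun z f)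
  map_add' f g := by
    rw [← MemLp.toLp_add]
    refine (MemLp.toLp_eq_toLp_iff _ _).2 ?_
    refine (displaceFun_congr z (Lp.coeFn_add f g)).trans (Filter.Eventually.of_forall ?_)
    intro x
    simp only [displaceFun, Pi.add_apply, mul_add]
  map_smul' c f := by
    rw [RingHom.id_apply, ← MemLp.toLp_const_smul]
    refine (MemLp.toLp_eq_toLp_iff _ _).2 ?_
    refine (displaceFun_congr z (Lp.coeFn_smul c f)).trans (Filter.Eventually.of_forall ?_)
    intro x
    simp only [displaceFun, Pi.smul_apply, smul_eq_mul]
    ring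

lemma norm_displaceLinear {m : ℕ} (z : Fin m → ℂ) (f : Modes m) :
    ‖displaceLinear z f‖ = ‖f‖ := by
  have h := eLpNorm_comp_measurePreserving (Lp.aestronglyMeasurable f) (p := 2)
    (measurePreserving_sub_right (volume : Measure (Fin m → ℝ)) (fun j => √2 * (z j).re))
  have h1 : displaceLinear z f = (memLp_displaceFun z (Lp.memLp f)).toLp (displaceFun z f) := rfl
  rw [h1, Lp.norm_toLp, Lp.norm_def, ← h]
  exact congrArg ENNReal.toReal (eLpNorm_congr_norm_ae
    (Filter.Eventually.of_forall fun x => norm_displaceFun z f x))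

/-- The displacement (Weyl) operator
`D_z = ⨂ⱼ exp (zⱼ aⱼ† - z̄ⱼ aⱼ) = exp (i ∑ⱼ (√2 Im zⱼ xⱼ - √2 Re zⱼ pⱼ))` on `L²(ℝᵐ)`, where
`xⱼ` is multiplication by the `j`-th coordinate, `pⱼ = -i ∂ⱼ` and `aⱼ = (xⱼ + i pⱼ) / √2`. -/
def displacement {m : ℕ} (z : Fin m → ℂ) : Modes m →L[ℂ] Modes m :=
  (displaceLinear z).mkContinuous 1 fun f => by rw [norm_displaceLinear, one_mul]

/-- The quantum characteristic function `χ_T(z) = tr (T D_z)`. -/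
def charFun {m : ℕ} (T : Modes m →L[ℂ] Modes m) (z : Fin m → ℂ) : ℂ :=
  trace (T ∘L displacement z)

/-- The `n`-th Hermite function `(n! √π)^(-1/2) Heₙ(√2 x) exp (-x²/2)`, where `Heₙ` is the
monic Hermite polynomial with weight `exp (-x²/2)`. -/
def hermiteFun (n : ℕ) (x : ℝ) : ℝ :=
  (√(n.factorial * √Real.pi))⁻¹ * Polynomial.aeval (√2 * x) (Polynomial.hermite n) *
    Real.exp (-(x ^ 2) / 2)

/-- The wave function `x ↦ ∏ⱼ h_{kⱼ}(xⱼ)` of the Fock state `|k₁, …, kₘ⟩`. -/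
def fockFun {m : ℕ} (k : Fin m → ℕ) (x : Fin m → ℝ) : ℂ :=
  ((∏ j, hermiteFun (k j) (x j) : ℝ) : ℂ)

lemma continuous_hermiteFun (n : ℕ) : Continuous (hermiteFun n) := by
  have h : Continuous fun y : ℝ => Polynomial.aeval y (Polynomial.hermite n) :=
    Polynomial.continuous_aeval _
  unfold hermiteFun
  exact (continuous_const.mul (h.comp (continuous_const.mul continuous_id))).mul (by fun_prop)

lemma integrable_poly_mul_gaussian (p : Polynomial ℝ) :
    Integrable (fun x : ℝ => p.eval x * Real.exp (-1 * x ^ 2)) := by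
  induction p using Polynomial.induction_on' with
  | add p q hp hq =>
    refine (hp.add hq).congr (Filter.Eventually.of_forall fun x => ?_)
    simp only [Pi.add_apply, Polynomial.eval_add, add_mul]
  | monomial n a =>
    have h := (integrable_rpow_mul_exp_neg_mul_sq one_pos
      (s := (n : ℝ)) (by have := n.cast_nonneg (α := ℝ); linarith)).const_mul a
    refine h.congr (Filter.Eventually.of_forall fun x => ?_)
    simp only [Polynomial.eval_monomial, Real.rpow_natCast, mul_assoc]

lemma integrable_hermiteFun_sq (n : ℕ) : Integrable (fun x : ℝ => hermiteFun n x ^ 2) := by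
  set P : Polynomial ℝ := (Polynomial.hermite n).map (Int.castRingHom ℝ) with hP
  have h := (integrable_poly_mul_gaussian ((P.comp (Polynomial.C (√2) * Polynomial.X)) ^ 2)).const_mul
    (((√(n.factorial * √Real.pi))⁻¹) ^ 2)
  refine h.congr (Filter.Eventually.of_forall fun x => ?_)
  have h1 : Polynomial.aeval (√2 * x) (Polynomial.hermite n) = P.eval (√2 * x) := by
    rw [hP, Polynomial.eval_map, Polynomial.aeval_def]; rfl
  have h2 : Real.exp (-1 * x ^ 2) = Real.exp (-(x ^ 2) / 2) ^ 2 := by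
    rw [← Real.exp_nat_mul]; congr 1; push_cast; ring
  simp only [hermiteFun, h1, h2, Polynomial.eval_pow, Polynomial.eval_comp, Polynomial.eval_mul,
    Polynomial.eval_C, Polynomial.eval_X]
  ring

lemma memLp_fockFun {m : ℕ} (k : Fin m → ℕ) : MemLp (fockFun k) 2 volume := by
  have hc : Continuous (fockFun k) := by
    unfold fockFun
    exact Complex.continuous_ofReal.comp (continuous_finsetProd _ fun j _ =>
      (continuous_hermiteFun (k j)).comp (continuous_apply j))
  refine (memLp_two_iff_integrable_sq_norm hc.aestronglyMeasurable).2 ?_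
  have h := Integrable.fintype_prod (𝕜 := ℝ) (fun j : Fin m => integrable_hermiteFun_sq (k j))
  refine h.congr (Filter.Eventually.of_forall fun x => ?_)
  simp only [fockFun, Complex.norm_real, Real.norm_eq_abs, sq_abs, Finset.prod_pow]

/-- The Fock state `|k₁, …, kₘ⟩`. -/
def fock {m : ℕ} (k : Fin m → ℕ) : Modes m := (memLp_fockFun k).toLp (fockFun k)

/-! ### Moments -/

/-- The vector `(N_m + m)^s |k⟩ = (k₁ + ⋯ + kₘ + m)^s |k⟩`; the number operator `N_m` is diagonal
in the Fock basis. -/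
def numberPow {m : ℕ} (s : ℝ) (k : Fin m → ℕ) : Modes m :=
  (((((∑ j, k j : ℕ) : ℝ) + m) ^ s : ℝ) : ℂ) • fock k

/-- The moment `M_κ(ρ) = tr (ρ (N_m + m)^(κ/2)) ∈ [0, ∞]` of a state. -/
def moment {m : ℕ} (κ : ℝ) (ρ : Modes m →L[ℂ] Modes m) : ℝ≥0∞ :=
  ∑' k : Fin m → ℕ, ENNReal.ofReal (inner ℂ (fock k) (ρ (numberPow (κ / 2) k))).re

/-- The Hilbert--Schmidt norm `‖T (N_m + m)^s‖₂ ∈ [0, ∞]`, computed in the Fock basis. -/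
def weightedHSNorm {m : ℕ} (s : ℝ) (T : Modes m →L[ℂ] Modes m) : ℝ≥0∞ :=
  (∑' k : Fin m → ℕ, ‖T (numberPow s k)‖ₑ ^ 2) ^ (1 / 2 : ℝ)

/-- Finite formal linear combinations of Fock states. -/
abbrev FockSpan (m : ℕ) : Type := (Fin m → ℕ) →₀ ℂ

/-- The annihilation operator `aⱼ |k⟩ = √kⱼ |k - eⱼ⟩`. -/
def annihilation {m : ℕ} (j : Fin m) : FockSpan m →ₗ[ℂ] FockSpan m :=
  Finsupp.linearCombination ℂ fun k => Finsupp.single (k - Pi.single j 1) ((√(k j : ℝ) : ℝ) : ℂ)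

/-- The creation operator `aⱼ† |k⟩ = √(kⱼ + 1) |k + eⱼ⟩`. -/
def creation {m : ℕ} (j : Fin m) : FockSpan m →ₗ[ℂ] FockSpan m :=
  Finsupp.linearCombination ℂ fun k =>
    Finsupp.single (k + Pi.single j 1) ((√((k j : ℝ) + 1) : ℝ) : ℂ)

/-- The quadratures: `R (0, j) = xⱼ = (aⱼ + aⱼ†) / √2` and `R (1, j) = pⱼ = (aⱼ - aⱼ†) / (√2 i)`. -/
def quadrature {m : ℕ} (r : Fin 2 × Fin m) : FockSpan m →ₗ[ℂ] FockSpan m :=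
  if r.1 = 0 then ((√2 : ℝ) : ℂ)⁻¹ • (annihilation r.2 + creation r.2)
  else (((√2 : ℝ) : ℂ) * Complex.I)⁻¹ • (annihilation r.2 - creation r.2)

/-- The expectation `tr (ρ A) = ∑ₖ ⟨k| ρ A |k⟩` of a polynomial `A` in the quadratures. -/
def expectation {m : ℕ} (ρ : Modes m →L[ℂ] Modes m) (A : FockSpan m →ₗ[ℂ] FockSpan m) : ℂ :=
  ∑' k : Fin m → ℕ,
    inner ℂ (fock k) (ρ (Finsupp.linearCombination ℂ fock (A (Finsupp.single k 1))))

/-- The vector `d(ρ) = tr (ρ R)` of first-order moments. -/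
def meanVector {m : ℕ} (ρ : Modes m →L[ℂ] Modes m) (r : Fin 2 × Fin m) : ℝ :=
  (expectation ρ (quadrature r)).re

/-- The centered quadrature `R_r - d_r(ρ)`. -/
def centeredQuadrature {m : ℕ} (ρ : Modes m →L[ℂ] Modes m) (r : Fin 2 × Fin m) :
    FockSpan m →ₗ[ℂ] FockSpan m :=
  quadrature r - ((meanVector ρ r : ℝ) : ℂ) • LinearMap.id

/-- The covariance matrix `γ(ρ) = tr (ρ {R - d(ρ), (R - d(ρ))ᵀ})`, with the anticommutator. -/
def covMatrix {m : ℕ} (ρ : Modes m →L[ℂ] Modes m) : Matrix (Fin 2 × Fin m) (Fin 2 × Fin m) ℝ :=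
  Matrix.of fun r s =>
    (expectation ρ (centeredQuadrature ρ r ∘ₗ centeredQuadrature ρ s +
      centeredQuadrature ρ s ∘ₗ centeredQuadrature ρ r)).re

/-- The symplectic form `Ω_m`, the direct sum of `m` blocks `(0, 1; -1, 0)`. -/
def symplecticForm (m : ℕ) : Matrix (Fin 2 × Fin m) (Fin 2 × Fin m) ℂ :=
  Matrix.blockDiagonal fun _ => !![0, 1; -1, 0]

/-! ### Gaussian and thermal states -/

/-- `Λ_m`, the direct sum of `m` blocks `(-i, i; -1, -1) / √2`. -/
def lambdaMatrix (m : ℕ) : Matrix (Fin 2 × Fin m) (Fin 2 × Fin m) ℂ :=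
  Matrix.blockDiagonal fun _ =>
    ((√2 : ℝ) : ℂ)⁻¹ • !![-Complex.I, Complex.I; -1, -1]

/-- The vector `ẑ = (z₁, z̄₁, …, zₘ, z̄ₘ)`. -/
def hatVector {m : ℕ} (z : Fin m → ℂ) (r : Fin 2 × Fin m) : ℂ :=
  if r.1 = 0 then z r.2 else conj (z r.2)

open Matrix in
/-- Gaussian states: the characteristic function is the Gaussian function
`exp (- ¼ ẑ† Λ† γ Λ ẑ + i dᵀ Λ ẑ)` given by the first moments `d` and the covariance matrix `γ`
of the state. -/
structure IsGaussianState {m : ℕ} (σ : Modes m →L[ℂ] Modes m) : Prop where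
  isState : IsState σ
  charFun_eq : ∀ z : Fin m → ℂ, charFun σ z =
    Complex.exp (-(1 / 4) * (star (hatVector z) ⬝ᵥ
        (((lambdaMatrix m)ᴴ * (covMatrix σ).map Complex.ofReal * lambdaMatrix m) *ᵥ hatVector z)) +
      Complex.I * ((fun r => (meanVector σ r : ℂ)) ⬝ᵥ (lambdaMatrix m *ᵥ hatVector z)))

/-- The eigenvalue `∏ⱼ (1 - exp (-βⱼ)) exp (-βⱼ kⱼ)` of the thermal state at `|k⟩`. -/
def thermalWeight {m : ℕ} (β : Fin m → ℝ) (k : Fin m → ℕ) : ℝ :=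
  ∏ j, (1 - Real.exp (-β j)) * Real.exp (-β j * k j)

/-- The thermal state `∏ⱼ (1 - exp (-βⱼ)) exp (-βⱼ aⱼ† aⱼ)`, a norm-convergent sum of multiples of
the projections `|k⟩⟨k|`. -/
def thermalState {m : ℕ} (β : Fin m → ℝ) : Modes m →L[ℂ] Modes m :=
  ∑' k : Fin m → ℕ, ((thermalWeight β k : ℝ) : ℂ) • InnerProductSpace.rankOne ℂ (fock k) (fock k)

/-- The value at `z` of a polynomial in the `2m` variables `z₁, …, zₘ` and `z̄₁, …, z̄ₘ`. -/
def evalPoly {m : ℕ} (E : MvPolynomial (Fin m ⊕ Fin m) ℂ) (z : Fin m → ℂ) : ℂ :=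
  MvPolynomial.eval (Sum.elim z fun j => conj (z j)) E

/-- `T` is a trace-class operator with characteristic function `χ_τ(z) (1 + α E(z))`. -/
def IsPerturbation {m : ℕ} (τ : Modes m →L[ℂ] Modes m) (E : MvPolynomial (Fin m ⊕ Fin m) ℂ)
    (α : ℝ) (T : Modes m →L[ℂ] Modes m) : Prop :=
  IsTraceClass T ∧ ∀ z : Fin m → ℂ, charFun T z = charFun τ z * (1 + α * evalPoly E z)

end Bosonic

end

/-! Three facts combine: up to a unitary change of frame `τ` is thermal, polynomial factors in its
characteristic function become ladder operators acting on it, and the relative entropy can be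
estimated in its eigenbasis.

Frame. For a centered Gaussian `τ` with `γ + iΩ` of full rank, Bochner positivity of the
characteristic function gives `γ + iΩ ≥ 0` (`quadratic_add_symp_nonneg`), hence positive
definiteness. Williamson's theorem (`exists_symplectic_eigenvectors`) then supplies a symplectic `S`
in which `χ_τ ∘ S` is a thermal characteristic function. Von Neumann's argument builds a vacuum
vector for the Weyl system `z ↦ D_{Sz}` from a Gaussian average of displacements, and so a unitary
`U` with `U D_z = D_{Sz} U` (`IsSymplectic.exists_unitary`). The same averaging for `S = id`
represents the projection onto the Fock vacuum and inverts the characteristic function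
(`inner_coherent_eq_integral_charFun`). This gives uniqueness of `τ_α` and identifies `τ` with the
conjugate by `U` of a thermal state. The vectors `ψ_k = U|k⟩` are thus an eigenbasis of `τ`, with
eigenvalues `c_k` the thermal weights.

Perturbation. For a thermal state, `a_j τ = e^{-β_j} τ a_j` and `a_j D_z = D_z (a_j + z_j)` together
express `z_j tr(τ D_z A)` as `tr(τ D_z A')` with `A'` again a polynomial in ladder operators; `z̄_j`
is similar. Multiplying `χ_τ` by `1 + αE` therefore gives a trace-class operator `T` with `T ψ_k =
c_k (ψ_k + α v_k)`. Here `v_k` does not depend on `α`, and `∑ c_k ‖v_k‖² < ∞` because the weights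
decay exponentially while `‖v_k‖` grows polynomially.

Entropy. If `P_p` are the spectral projections of `ρ` and `δ_k = (ρ - T) ψ_k`, then `(p - c_k) P_p
ψ_k = α c_k P_p v_k + P_p δ_k`. Where the first term dominates, the entropy term is bounded by `(p -
c_k)²/c_k`; where the second dominates, by `|p - c_k| (1 - ln c_k)`. Summing over `p` by Bessel and
Cauchy–Schwarz yields `D(ρ‖τ) ≤ ∑_k (4α² c_k ‖v_k‖² + 2 (1 - ln c_k) ‖δ_k‖)` (`relEntropy_le_tsum`).
The first part is a constant times `α²`. In the second, `1 - ln c_k` is at most linear in the degree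
of `k`, and Cauchy–Schwarz against the convergent sum of `(deg + 1)^{-(m+1)}` leaves the weight
`(deg + 1)^{m+3}` on `‖δ_k‖²`. Finally the moments in the basis `U|k⟩` are bounded by those in the
Fock basis (`exists_basisMoment_unitary_le`), because the annihilation operators of the new frame
are linear in the old ladder operators. -/

noncomputable section

namespace Bosonic

set_option linter.unusedSectionVars false

/-! ### Hilbert–Schmidt operators, trace-class operators and the trace. -/

section HilbertSchmidt

open ContinuousLinearMap

variable {H : Type*} [NormedAddCommGroup H] [InnerProductSpace ℂ H] [CompleteSpace H]
variable {ι κ : Type*}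

/-- Parseval with values in `[0, ∞]`, so that later double sums can be exchanged without summability
conditions. -/
lemma enorm_sq_eq_tsum (b : HilbertBasis ι ℂ H) (x : H) :
    ‖x‖ₑ ^ 2 = ∑' i, ‖inner ℂ (b i) x‖ₑ ^ 2 := by
  have h := b.hasSum_inner_mul_inner x x
  have h2 : HasSum (fun i => ‖inner ℂ (b i) x‖ ^ 2) (‖x‖ ^ 2) := by
    have h3 := Complex.hasSum_re h
    convert! h3 using 1
    · ext i
      rw [← inner_conj_symm x (b i), Complex.conj_mul']
      norm_cast
    · rw [inner_self_eq_norm_sq_to_K]; norm_cast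
  have h4 : ∀ y : H, ‖y‖ₑ ^ 2 = ENNReal.ofReal (‖y‖ ^ 2) := fun y => by
    rw [← ofReal_norm, ENNReal.ofReal_pow (norm_nonneg _)]
  have h5 : ∀ y : ℂ, ‖y‖ₑ ^ 2 = ENNReal.ofReal (‖y‖ ^ 2) := fun y => by
    rw [← ofReal_norm, ENNReal.ofReal_pow (norm_nonneg _)]
  simp only [h4, h5]
  rw [← h2.tsum_eq, ENNReal.ofReal_tsum_of_nonneg (fun _ => by positivity) h2.summable]

lemma enorm_inner_symm (x y : H) : ‖inner ℂ x y‖ₑ = ‖inner ℂ y x‖ₑ := by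
  rw [← ofReal_norm, ← ofReal_norm, norm_inner_symm]

/-- Both sides are the sum of all squared matrix entries between the two bases, by Parseval and
Tonelli. Using it twice makes the Hilbert–Schmidt norm independent of the basis. -/
lemma tsum_enorm_sq_adjoint (b : HilbertBasis ι ℂ H) (b' : HilbertBasis κ ℂ H) (T : H →L[ℂ] H) :
    ∑' i, ‖T (b i)‖ₑ ^ 2 = ∑' j, ‖adjoint T (b' j)‖ₑ ^ 2 := by
  simp_rw [enorm_sq_eq_tsum b' (T _), enorm_sq_eq_tsum b (adjoint T _)]
  rw [ENNReal.tsum_comm]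
  simp_rw [adjoint_inner_right, enorm_inner_symm (T _)]

lemma hsNormSq_eq (b : HilbertBasis ι ℂ H) (T : H →L[ℂ] H) :
    hsNormSq T = ∑' i, ‖T (b i)‖ₑ ^ 2 := by
  rw [hsNormSq, tsum_enorm_sq_adjoint _ b, tsum_enorm_sq_adjoint b b, adjoint_adjoint]

lemma hsNormSq_adjoint (T : H →L[ℂ] H) : hsNormSq (adjoint T) = hsNormSq T :=
  (tsum_enorm_sq_adjoint _ _ T).symm

lemma hsNormSq_comp_le (W T : H →L[ℂ] H) : hsNormSq (W ∘L T) ≤ ‖W‖ₑ ^ 2 * hsNormSq T := by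
  rw [hsNormSq, hsNormSq, ← ENNReal.tsum_mul_left]
  refine ENNReal.tsum_le_tsum fun i => ?_
  rw [← mul_pow]
  gcongr
  exact W.le_opENorm _

lemma hsNormSq_comp_lt_top (W : H →L[ℂ] H) {T : H →L[ℂ] H} (hT : hsNormSq T < ⊤) :
    hsNormSq (W ∘L T) < ⊤ :=
  (hsNormSq_comp_le W T).trans_lt (ENNReal.mul_lt_top (by simp) hT)

lemma hsNormSq_comp_right_lt_top (W : H →L[ℂ] H) {T : H →L[ℂ] H} (hT : hsNormSq T < ⊤) :
    hsNormSq (T ∘L W) < ⊤ := by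
  rw [← hsNormSq_adjoint, adjoint_comp]
  exact hsNormSq_comp_lt_top _ (by rwa [hsNormSq_adjoint])

lemma ENNReal_add_sq_le (a b : ℝ≥0∞) : (a + b) ^ 2 ≤ 2 * (a ^ 2 + b ^ 2) := by
  have h := ENNReal.rpow_add_le_mul_rpow_add_rpow a b (p := 2) (by norm_num)
  norm_num at h
  exact h

lemma summable_sq_of_hsNormSq_lt_top (b : HilbertBasis ι ℂ H) {T : H →L[ℂ] H}
    (hT : hsNormSq T < ⊤) : Summable fun i => ‖T (b i)‖ ^ 2 := by
  rw [hsNormSq_eq b] at hT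
  have := ENNReal.summable_toReal hT.ne
  refine this.congr fun i => ?_
  rw [ENNReal.toReal_pow, toReal_enorm]

/-- If `‖S x‖ ≤ ‖T x‖` for all `x`, then `S` factors through `T`. -/
lemma exists_factor_of_norm_le (S T : H →L[ℂ] H) (h : ∀ x, ‖S x‖ ≤ ‖T x‖) :
    ∃ W : H →L[ℂ] H, S = W ∘L T := by
  let K : Submodule ℂ H := (LinearMap.range (T : H →ₗ[ℂ] H)).topologicalClosure
  let e : H →ₗ[ℂ] K := (T : H →ₗ[ℂ] H).codRestrict K
    fun x => Submodule.le_topologicalClosure _ (LinearMap.mem_range_self _ x)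
  have he : DenseRange e := by
    intro y
    rw [Metric.mem_closure_iff]
    intro ε hε
    obtain ⟨_, ⟨x, rfl⟩, hx⟩ := Metric.mem_closure_iff.1 y.2 ε hε
    exact ⟨e x, ⟨x, rfl⟩, hx⟩
  have : CompleteSpace K := (Submodule.isClosed_topologicalClosure _).completeSpace_coe
  refine ⟨((S : H →ₗ[ℂ] H).extendOfNorm e) ∘L K.orthogonalProjectionOnto, ?_⟩
  ext x
  have h1 : K.orthogonalProjectionOnto (T x) = e x :=
    Submodule.orthogonalProjectionOnto_mem_subspace_eq_self (e x)
  rw [comp_apply, comp_apply, h1, LinearMap.extendOfNorm_eq he ⟨1, fun y => by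
    rw [one_mul]; exact h y⟩]
  rfl

/-- Follows from `|T|² = T†T`. With `exists_factor_of_norm_le` it replaces the polar decomposition:
`T = W |T|`, and also `|T| = W' T`. -/
lemma norm_abs_apply (T : H →L[ℂ] H) (x : H) : ‖CFC.abs T x‖ = ‖T x‖ := by
  have hsa : IsSelfAdjoint (CFC.abs T) := (CFC.abs_nonneg T).isSelfAdjoint
  have h := CFC.abs_mul_abs T
  have h1 : ∀ S : H →L[ℂ] H, ‖S x‖ ^ 2 = (inner ℂ x ((star S * S) x)).re := fun S => by
    rw [star_eq_adjoint, ContinuousLinearMap.mul_def, comp_apply, adjoint_inner_right, inner_self_eq_norm_sq_to_K]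
    norm_cast
  have h2 : ‖CFC.abs T x‖ ^ 2 = ‖T x‖ ^ 2 := by
    rw [h1, h1, hsa.star_eq, h]
  exact (sq_eq_sq₀ (norm_nonneg _) (norm_nonneg _)).1 h2

lemma exists_sqrt (T : H →L[ℂ] H) (hT : 0 ≤ T) :
    ∃ B : H →L[ℂ] H, IsSelfAdjoint B ∧ B ∘L B = T :=
  ⟨CFC.sqrt T, (CFC.sqrt_nonneg T).isSelfAdjoint, CFC.sqrt_mul_sqrt_self T hT⟩

lemma traceNorm_eq_hsNormSq {T B : H →L[ℂ] H} (hB : IsSelfAdjoint B) (h : B ∘L B = CFC.abs T) :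
    traceNorm T = hsNormSq B := by
  rw [traceNorm, hsNormSq]
  congr 1
  ext i
  rw [← h, comp_apply, ← adjoint_inner_left, ← star_eq_adjoint, hB.star_eq,
    inner_self_eq_norm_sq_to_K, ← ofReal_norm, ← ENNReal.ofReal_pow (norm_nonneg _)]
  norm_cast

/-- `T = W |T| = (W √|T|) √|T|`, and `√|T|` is Hilbert–Schmidt because its squared norm is the trace
norm of `T`. Together with the converse `isTraceClass_comp`, this is the form in which trace class
is used below. -/
lemma IsTraceClass.exists_factor {T : H →L[ℂ] H} (hT : IsTraceClass T) :
    ∃ A B : H →L[ℂ] H, T = A ∘L B ∧ hsNormSq A < ⊤ ∧ hsNormSq B < ⊤ := by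
  obtain ⟨B, hB, h⟩ := exists_sqrt (CFC.abs T) (CFC.abs_nonneg T)
  have hBf : hsNormSq B < ⊤ := by rw [← traceNorm_eq_hsNormSq hB h]; exact hT
  obtain ⟨W, hW⟩ := exists_factor_of_norm_le T (CFC.abs T) fun x => (norm_abs_apply T x).ge
  exact ⟨W ∘L B, B, by rw [comp_assoc, h, ← hW], hsNormSq_comp_lt_top _ hBf, hBf⟩

lemma IsTraceClass.exists_sqrt_of_nonneg {T : H →L[ℂ] H} (hT : IsTraceClass T) (h0 : 0 ≤ T) :
    ∃ B : H →L[ℂ] H, IsSelfAdjoint B ∧ T = B ∘L B ∧ hsNormSq B < ⊤ := by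
  obtain ⟨B, hB, h⟩ := exists_sqrt T h0
  refine ⟨B, hB, h.symm, ?_⟩
  rw [← traceNorm_eq_hsNormSq (T := T) hB (by rw [h, CFC.abs_of_nonneg T h0])]
  exact hT

lemma summable_inner_of_sq {f g : ι → H} (hf : Summable fun i => ‖f i‖ ^ 2)
    (hg : Summable fun i => ‖g i‖ ^ 2) : Summable fun i => inner ℂ (f i) (g i) := by
  refine Summable.of_norm_bounded (hf.add hg) fun i => ?_
  refine (norm_inner_le_norm _ _).trans ?_
  nlinarith [sq_nonneg (‖f i‖ - ‖g i‖), sq_nonneg (‖f i‖), sq_nonneg ‖g i‖]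

lemma summable_mul_of_sq {f g : ι → ℂ} (hf : Summable fun i => ‖f i‖ ^ 2)
    (hg : Summable fun i => ‖g i‖ ^ 2) : Summable fun i => f i * g i := by
  refine Summable.of_norm_bounded (hf.add hg) fun i => ?_
  rw [norm_mul]
  nlinarith [sq_nonneg (‖f i‖ - ‖g i‖), sq_nonneg (‖f i‖), sq_nonneg ‖g i‖]

lemma summable_sq_matrix (b : HilbertBasis ι ℂ H) (b' : HilbertBasis κ ℂ H) {S : H →L[ℂ] H}
    (hS : hsNormSq S < ⊤) : Summable fun p : ι × κ => ‖inner ℂ (b' p.2) (S (b p.1))‖ ^ 2 := by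
  have : ∑' p : ι × κ, ‖inner ℂ (b' p.2) (S (b p.1))‖ₑ ^ 2 < ⊤ := by
    rw [ENNReal.tsum_prod']
    simp_rw [← enorm_sq_eq_tsum b', ← hsNormSq_eq b]
    exact hS
  refine (ENNReal.summable_toReal this.ne).congr fun i => ?_
  rw [ENNReal.toReal_pow, toReal_enorm]

/-- The double series of products of matrix entries converges absolutely, so the two sums can be
exchanged. This contains both the cyclicity of the trace and its independence of the basis. -/
lemma tsum_inner_comm (b : HilbertBasis ι ℂ H) (b' : HilbertBasis κ ℂ H)
    {A C : H →L[ℂ] H} (hA : hsNormSq A < ⊤) (hC : hsNormSq C < ⊤) :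
    ∑' i, inner ℂ (A (b i)) (C (b i)) =
      ∑' k, inner ℂ (adjoint C (b' k)) (adjoint A (b' k)) := by
  have hsum : Summable fun p : ι × κ =>
      inner ℂ (A (b p.1)) (b' p.2) * inner ℂ (b' p.2) (C (b p.1)) := by
    refine summable_mul_of_sq ?_ (summable_sq_matrix b b' hC)
    exact (summable_sq_matrix b b' hA).congr fun p => by rw [norm_inner_symm]
  have h1 : ∀ i, ∑' k, inner ℂ (A (b i)) (b' k) * inner ℂ (b' k) (C (b i)) =
      inner ℂ (A (b i)) (C (b i)) := fun i => b'.tsum_inner_mul_inner _ _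
  have h2 : ∀ k, ∑' i, inner ℂ (A (b i)) (b' k) * inner ℂ (b' k) (C (b i)) =
      inner ℂ (adjoint C (b' k)) (adjoint A (b' k)) := fun k => by
    rw [← b.tsum_inner_mul_inner]
    congr 1; ext i
    rw [adjoint_inner_left, adjoint_inner_right, mul_comm]
  simp_rw [← h1, ← h2]
  exact Summable.tsum_comm (f := fun i k => _) hsum.prod_symm

/-- Cyclicity isolates `Y` between the vectors `B† b_k` and `A b_k`. For a displacement `Y`, the
characteristic function becomes a series of matrix elements dominated uniformly in `z`. -/
lemma trace_comp_comp (b : HilbertBasis ι ℂ H) {A B : H →L[ℂ] H} (hA : hsNormSq A < ⊤)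
    (hB : hsNormSq B < ⊤) (Y : H →L[ℂ] H) :
    trace ((A ∘L B) ∘L Y) = ∑' k, inner ℂ (adjoint B (b k)) (Y (A (b k))) := by
  have h := tsum_inner_comm (someBasis H) b (A := adjoint A) (by rwa [hsNormSq_adjoint])
    (hsNormSq_comp_right_lt_top Y hB)
  rw [adjoint_comp, adjoint_adjoint] at h
  have h1 : ∀ k, inner ℂ (adjoint B (b k)) (Y (A (b k))) =
      inner ℂ ((adjoint Y ∘L adjoint B) (b k)) (A (b k)) := fun k => by
    rw [comp_apply, adjoint_inner_left Y]
  simp_rw [h1]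
  rw [← h, trace]
  congr 1; ext i
  rw [adjoint_inner_left]; rfl

lemma summable_trace_comp_comp (b : HilbertBasis ι ℂ H) {A B : H →L[ℂ] H} (hA : hsNormSq A < ⊤)
    (hB : hsNormSq B < ⊤) (Y : H →L[ℂ] H) :
    Summable fun k => inner ℂ (adjoint B (b k)) (Y (A (b k))) :=
  summable_inner_of_sq (f := fun k => adjoint B (b k)) (g := fun k => (Y ∘L A) (b k))
    (summable_sq_of_hsNormSq_lt_top b (by rwa [hsNormSq_adjoint]))
    (summable_sq_of_hsNormSq_lt_top b (hsNormSq_comp_lt_top Y hA))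

lemma summable_trace_terms (b : HilbertBasis ι ℂ H) {A B : H →L[ℂ] H} (hA : hsNormSq A < ⊤)
    (hB : hsNormSq B < ⊤) : Summable fun i => inner ℂ (b i) (A (B (b i))) := by
  refine (summable_inner_of_sq (f := fun i => adjoint A (b i)) (g := fun i => B (b i))
    (summable_sq_of_hsNormSq_lt_top _ (by rwa [hsNormSq_adjoint]))
    (summable_sq_of_hsNormSq_lt_top _ hB)).congr fun i => ?_
  rw [adjoint_inner_left]

/-- Since `|AB| = (W A) B`, the trace norm of `AB` is a sum of diagonal entries of a product of two
Hilbert–Schmidt operators, which converges absolutely. -/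
lemma isTraceClass_comp {A B : H →L[ℂ] H} (hA : hsNormSq A < ⊤) (hB : hsNormSq B < ⊤) :
    IsTraceClass (A ∘L B) := by
  obtain ⟨W, hW⟩ := exists_factor_of_norm_le (CFC.abs (A ∘L B)) (A ∘L B)
    fun x => (norm_abs_apply _ x).le
  have hs := summable_trace_terms (someBasis H) (hsNormSq_comp_lt_top W hA) hB
  rw [IsTraceClass, traceNorm, hW]
  exact (Complex.hasSum_re hs.hasSum).summable.tsum_ofReal_lt_top

/-- A square-summable family is the image of an orthonormal basis under a bounded operator. -/
lemma exists_clm_of_summable_sq (b : HilbertBasis ι ℂ H) (v : ι → H)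
    (hv : Summable fun i => ‖v i‖ ^ 2) : ∃ Y : H →L[ℂ] H, ∀ i, Y (b i) = v i := by
  classical
  have hb : ∀ x, Summable fun i => ‖inner ℂ (b i) x‖ ^ 2 := fun x => by
    have h := enorm_sq_eq_tsum b x
    refine (ENNReal.summable_toReal (f := fun i => ‖inner ℂ (b i) x‖ₑ ^ 2) ?_).congr fun i => ?_
    · rw [← h]; simp
    · rw [ENNReal.toReal_pow, toReal_enorm]
  have hbt : ∀ x, ∑' i, ‖inner ℂ (b i) x‖ ^ 2 = ‖x‖ ^ 2 := fun x => by
    have h := congrArg ENNReal.toReal (enorm_sq_eq_tsum b x)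
    rw [ENNReal.tsum_toReal_eq (fun i => by simp)] at h
    simpa [ENNReal.toReal_pow, toReal_enorm] using h.symm
  have hs : ∀ x, Summable fun i => ‖inner ℂ (b i) x • v i‖ := fun x => by
    refine Summable.of_nonneg_of_le (fun _ => norm_nonneg _) (fun i => ?_) ((hb x).add hv)
    rw [norm_smul]
    nlinarith [sq_nonneg (‖inner ℂ (b i) x‖ - ‖v i‖), sq_nonneg (‖v i‖),
      sq_nonneg ‖inner ℂ (b i) x‖]
  have hs' : ∀ x, Summable fun i => inner ℂ (b i) x • v i := fun x => (hs x).of_norm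
  let Y0 : H →ₗ[ℂ] H :=
    { toFun := fun x => ∑' i, inner ℂ (b i) x • v i
      map_add' := fun x y => by
        rw [← (hs' x).tsum_add (hs' y)]
        congr 1; ext i; rw [inner_add_right, add_smul]
      map_smul' := fun c x => by
        rw [RingHom.id_apply, ← (hs' x).tsum_const_smul c]
        congr 1; ext i; rw [inner_smul_right, smul_smul] }
  refine ⟨Y0.mkContinuous (√(∑' i, ‖v i‖ ^ 2)) fun x => ?_, fun i => ?_⟩
  · refine (norm_tsum_le_tsum_norm (hs x)).trans ?_
    -- Cauchy–Schwarz and Parseval bound the operator by the `ℓ²` norm of the prescribed images.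
    have := (Real.inner_le_Lp_mul_Lq_tsum_of_nonneg Real.HolderConjugate.two_two
      (f := fun i => ‖inner ℂ (b i) x‖) (g := fun i => ‖v i‖) (fun _ => norm_nonneg _)
      (fun _ => norm_nonneg _) (by simpa using hb x) (by simpa using hv))
    simp only [Real.rpow_two, hbt, ← norm_smul, ← Real.sqrt_eq_rpow] at this
    rw [Real.sqrt_sq (norm_nonneg _)] at this
    linarith
  · change ∑' j, inner ℂ (b j) (b i) • v j = v i
    rw [tsum_eq_single i]
    · rw [inner_self_eq_norm_sq_to_K, b.orthonormal.1 i]; simp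
    · intro j hj
      rw [b.orthonormal.2 hj, zero_smul]

end HilbertSchmidt

end Bosonic
end

noncomputable section

namespace Bosonic

/-! ### Hermite functions -/

lemma derivative_hermite_succ (n : ℕ) :
    Polynomial.derivative (Polynomial.hermite (n + 1)) = (n + 1 : ℤ) • Polynomial.hermite n := by
  induction n with
  | zero => simp
  | succ n ih =>
    rw [Polynomial.hermite_succ (n + 1), map_sub, Polynomial.derivative_mul, ih,
      Polynomial.derivative_X, map_zsmul, Polynomial.hermite_succ n]
    push_cast
    simp only [zsmul_eq_mul]
    push_cast
    ring

lemma hermite_recurrence (n : ℕ) (y : ℝ) :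
    y * Polynomial.aeval y (Polynomial.hermite n) =
      Polynomial.aeval y (Polynomial.hermite (n + 1)) +
        n * Polynomial.aeval y (Polynomial.hermite (n - 1)) := by
  rw [Polynomial.hermite_succ]
  cases n with
  | zero => simp
  | succ n =>
    rw [derivative_hermite_succ]
    simp

def hermiteConst (n : ℕ) : ℝ := (√(n.factorial * √Real.pi))⁻¹

lemma hermiteConst_succ (n : ℕ) : √((n : ℝ) + 1) * hermiteConst (n + 1) = hermiteConst n := by
  have h1 : (0 : ℝ) < n.factorial := by exact_mod_cast n.factorial_pos
  have h2 : 0 < √Real.pi := Real.sqrt_pos.2 Real.pi_pos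
  have h3 : (0 : ℝ) < n + 1 := by positivity
  rw [hermiteConst, hermiteConst, Nat.factorial_succ]
  push_cast
  rw [mul_assoc, Real.sqrt_mul h3.le, mul_inv, ← mul_assoc, mul_inv_cancel₀ (Real.sqrt_pos.2 h3).ne',
    one_mul]

lemma hermiteConst_mul_nat (n : ℕ) :
    hermiteConst n * n = √(n : ℝ) * hermiteConst (n - 1) := by
  cases n with
  | zero => simp
  | succ n =>
    have h := hermiteConst_succ n
    have h3 : (0 : ℝ) ≤ n + 1 := by positivity
    simp only [Nat.add_sub_cancel, ← h]
    push_cast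
    rw [← mul_assoc, Real.mul_self_sqrt h3, mul_comm]

/-- The relation `√2 x = a + a†`. At `n = 0` the index `n - 1` truncates to `0`, harmlessly, since
its coefficient is `√0`. -/
lemma hermiteFun_recurrence (n : ℕ) (x : ℝ) :
    √2 * x * hermiteFun n x = √((n : ℝ) + 1) * hermiteFun (n + 1) x +
      √(n : ℝ) * hermiteFun (n - 1) x := by
  have h := hermite_recurrence n (√2 * x)
  have h1 := hermiteConst_succ n
  have h2 := hermiteConst_mul_nat n
  simp only [hermiteFun]
  simp only [hermiteConst] at h1 h2
  linear_combination (√(n.factorial * √Real.pi))⁻¹ * Real.exp (-(x ^ 2) / 2) * h -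
    Polynomial.aeval (√2 * x) (Polynomial.hermite (n + 1)) * Real.exp (-(x ^ 2) / 2) * h1 +
    Polynomial.aeval (√2 * x) (Polynomial.hermite (n - 1)) * Real.exp (-(x ^ 2) / 2) * h2

lemma hasDerivAt_hermiteFun (n : ℕ) (x : ℝ) :
    HasDerivAt (hermiteFun n) (√2 * √(n : ℝ) * hermiteFun (n - 1) x - x * hermiteFun n x) x := by
  have h1 : HasDerivAt (fun x : ℝ => Polynomial.aeval (√2 * x) (Polynomial.hermite n))
      (n * Polynomial.aeval (√2 * x) (Polynomial.hermite (n - 1)) * √2) x := by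
    have ha := (Polynomial.hermite n).hasDerivAt_aeval (√2 * x)
    have hb : HasDerivAt (fun x : ℝ => √2 * x) √2 x := by
      simpa using (hasDerivAt_id x).const_mul √2
    convert! ha.comp x hb using 1
    cases n with
    | zero => simp
    | succ n => rw [derivative_hermite_succ]; simp
  have h2 : HasDerivAt (fun x : ℝ => Real.exp (-(x ^ 2) / 2)) (Real.exp (-(x ^ 2) / 2) * (-x)) x := by
    have : HasDerivAt (fun x : ℝ => -(x ^ 2) / 2) (-x) x := by
      have := ((hasDerivAt_pow 2 x).neg).div_const 2
      convert! this using 1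
      push_cast
      ring
    exact this.exp
  have h3 := (h1.const_mul (√(n.factorial * √Real.pi))⁻¹).mul h2
  have h4 := hermiteConst_mul_nat n
  simp only [hermiteConst] at h4
  convert! h3 using 1
  simp only [hermiteFun]
  linear_combination -(√2 * Polynomial.aeval (√2 * x) (Polynomial.hermite (n - 1)) *
    Real.exp (-(x ^ 2) / 2)) * h4

lemma memLp_hermiteFun (n : ℕ) : MemLp (fun x => (hermiteFun n x : ℂ)) 2 volume := by
  refine (memLp_two_iff_integrable_sq_norm
    (Complex.continuous_ofReal.comp (continuous_hermiteFun n)).aestronglyMeasurable).2 ?_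
  simpa using integrable_hermiteFun_sq n

/-! ### Matrix elements of one-mode displacement operators -/

/-- The displaced Hermite function of one mode. -/
def displacedHermite (z : ℂ) (l : ℕ) (x : ℝ) : ℂ :=
  Complex.exp (((√2 * z.im * x - z.re * z.im : ℝ) : ℂ) * Complex.I) *
    hermiteFun l (x - √2 * z.re)

lemma memLp_displacedHermite (z : ℂ) (l : ℕ) : MemLp (displacedHermite z l) 2 volume := by
  have h := (memLp_hermiteFun l).comp_measurePreserving
    (measurePreserving_sub_right (volume : Measure ℝ) (√2 * z.re))
  refine h.of_le ?_ (Filter.Eventually.of_forall fun x => ?_)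
  · refine Continuous.aestronglyMeasurable ?_
    have := continuous_hermiteFun l
    unfold displacedHermite
    fun_prop
  · rw [displacedHermite, norm_mul, Complex.norm_exp_ofReal_mul_I, one_mul]
    rfl

lemma integrable_hermite_mul_displaced (z : ℂ) (k l : ℕ) :
    Integrable fun x => (hermiteFun k x : ℂ) * displacedHermite z l x :=
  (memLp_hermiteFun k).integrable_mul (memLp_displacedHermite z l)

/-- The matrix element `⟨k| D_z |l⟩` for one mode. -/
def matrixElement (z : ℂ) (k l : ℕ) : ℂ := ∫ x, (hermiteFun k x : ℂ) * displacedHermite z l x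

lemma sqrt_two_mul_sqrt_two : ((√2 : ℝ) : ℂ) * ((√2 : ℝ) : ℂ) = 2 := by
  rw [← Complex.ofReal_mul, Real.mul_self_sqrt (by norm_num)]; simp

lemma displacedHermite_mul (z : ℂ) (l : ℕ) (x : ℝ) :
    (√2 : ℂ) * x * displacedHermite z l x = √((l : ℝ) + 1) * displacedHermite z (l + 1) x +
      √(l : ℝ) * displacedHermite z (l - 1) x + 2 * z.re * displacedHermite z l x := by
  have h := hermiteFun_recurrence l (x - √2 * z.re)
  have h' := congrArg (fun t : ℝ => (t : ℂ)) h
  push_cast at h'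
  simp only [displacedHermite]
  push_cast
  have h2 := sqrt_two_mul_sqrt_two
  linear_combination Complex.exp ((√2 * z.im * x - z.re * z.im) * Complex.I) * h' +
    Complex.exp ((√2 * z.im * x - z.re * z.im) * Complex.I) *
      (hermiteFun l (x - √2 * z.re)) * z.re * h2

lemma hasDerivAt_displacedHermite (z : ℂ) (l : ℕ) (x : ℝ) :
    HasDerivAt (displacedHermite z l) (√2 * √(l : ℝ) * displacedHermite z (l - 1) x
      + √2 * z * displacedHermite z l x - x * displacedHermite z l x) x := by
  have h1 : HasDerivAt (fun x : ℝ => ((√2 * z.im * x - z.re * z.im : ℝ) : ℂ) * Complex.I)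
      ((√2 * z.im : ℝ) * Complex.I) x := by
    have : HasDerivAt (fun x : ℝ => √2 * z.im * x - z.re * z.im) (√2 * z.im) x := by
      simpa using ((hasDerivAt_id x).const_mul (√2 * z.im)).sub_const (z.re * z.im)
    exact this.ofReal_comp.mul_const _
  have h2 : HasDerivAt (fun x : ℝ => x - √2 * z.re) 1 x := (hasDerivAt_id x).sub_const _
  have h3 := ((hasDerivAt_hermiteFun l (x - √2 * z.re)).comp x h2).ofReal_comp
  have h4 := h1.cexp.mul h3
  convert! h4 using 1
  simp only [displacedHermite, Function.comp]
  push_cast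
  have hz : z = z.re + z.im * Complex.I := (Complex.re_add_im z).symm
  linear_combination (√2 * Complex.exp ((√2 * z.im * x - z.re * z.im) * Complex.I) *
      (hermiteFun l (x - √2 * z.re))) * hz

lemma integrable_hermite_mul_displaced_mul (z : ℂ) (k l : ℕ) :
    Integrable fun x : ℝ => (hermiteFun k x : ℂ) * (x * displacedHermite z l x) := by
  have h1 := (((integrable_hermite_mul_displaced z k (l + 1)).const_mul (√((l : ℝ) + 1) : ℂ)).add
    ((integrable_hermite_mul_displaced z k (l - 1)).const_mul (√(l : ℝ) : ℂ))).add
    ((integrable_hermite_mul_displaced z k l).const_mul (2 * z.re : ℂ))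
  refine (h1.const_mul ((√2 : ℂ) / 2)).congr (Filter.Eventually.of_forall fun x => ?_)
  have := displacedHermite_mul z l x
  have h2 := sqrt_two_mul_sqrt_two
  simp only [Pi.add_apply]
  linear_combination -(√2 : ℂ) / 2 * hermiteFun k x * this +
    x / 2 * hermiteFun k x * displacedHermite z l x * h2

/-- Two ways of writing `√2 ∫ x h_k(x) (D_z h_l)(x) dx`. -/
lemma integral_hermite_mul_displaced_left (z : ℂ) (k l : ℕ) :
    √2 * ∫ x : ℝ, (hermiteFun k x : ℂ) * (x * displacedHermite z l x) =
      √((k : ℝ) + 1) * matrixElement z (k + 1) l + √(k : ℝ) * matrixElement z (k - 1) l := by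
  simp only [matrixElement, ← integral_const_mul]
  rw [← integral_add ((integrable_hermite_mul_displaced z _ l).const_mul _)
    ((integrable_hermite_mul_displaced z _ l).const_mul _)]
  congr 1; ext x
  have h := congrArg (fun t : ℝ => (t : ℂ)) (hermiteFun_recurrence k x)
  push_cast at h
  linear_combination displacedHermite z l x * h

lemma integral_hermite_mul_displaced_right (z : ℂ) (k l : ℕ) :
    √2 * ∫ x : ℝ, (hermiteFun k x : ℂ) * (x * displacedHermite z l x) =
      √((l : ℝ) + 1) * matrixElement z k (l + 1) + √(l : ℝ) * matrixElement z k (l - 1) +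
        2 * z.re * matrixElement z k l := by
  have hi := integrable_hermite_mul_displaced z
  simp only [matrixElement, ← integral_const_mul]
  rw [← integral_add ((hi _ _).const_mul _) ((hi _ _).const_mul _)]
  have e := integral_add (((hi k (l + 1)).const_mul (√((l : ℝ) + 1) : ℂ)).add
    ((hi k (l - 1)).const_mul (√(l : ℝ) : ℂ))) ((hi k l).const_mul (2 * z.re : ℂ))
  simp only [Pi.add_apply] at e
  rw [← e]
  congr 1; ext x
  linear_combination (hermiteFun k x : ℂ) * displacedHermite_mul z l x

/-- Integration by parts of `∫ h_k (D_z h_l)'`. Writing both derivatives in lowering form leaves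
`-x` times each function, and these two terms add up to the integral on the right. -/
lemma integral_hermite_parts (z : ℂ) (k l : ℕ) :
    √2 * (√(l : ℝ) * matrixElement z k (l - 1) + z * matrixElement z k l +
      √(k : ℝ) * matrixElement z (k - 1) l) =
      2 * ∫ x : ℝ, (hermiteFun k x : ℂ) * (x * displacedHermite z l x) := by
  have hi := integrable_hermite_mul_displaced z
  have hx := integrable_hermite_mul_displaced_mul z k l
  have hl := ((hi k (l - 1)).const_mul (√2 * √(l : ℝ) : ℂ)).add ((hi k l).const_mul (√2 * z : ℂ))
  have hl' := hl.sub hx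
  have hr := ((hi (k - 1) l).const_mul (√2 * √(k : ℝ) : ℂ)).sub hx
  have hp := integral_mul_deriv_eq_deriv_mul_of_integrable (u := fun x => (hermiteFun k x : ℂ))
    (fun x _ => (hasDerivAt_hermiteFun k x).ofReal_comp)
    (fun x _ => hasDerivAt_displacedHermite z l x)
    (hl'.congr (Filter.Eventually.of_forall fun x => by
      simp only [Pi.add_apply, Pi.sub_apply, Pi.mul_apply]; ring))
    (hr.congr (Filter.Eventually.of_forall fun x => by
      simp only [Pi.sub_apply, Pi.mul_apply]; push_cast; ring)) (hi k l)
  have e1 := integral_sub hl hx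
  have e2 := integral_add ((hi k (l - 1)).const_mul (√2 * √(l : ℝ) : ℂ))
    ((hi k l).const_mul (√2 * z : ℂ))
  have e3 := integral_sub ((hi (k - 1) l).const_mul (√2 * √(k : ℝ) : ℂ)) hx
  simp only [integral_const_mul] at e2 e3
  have hp1 : ∫ x, (hermiteFun k x : ℂ) * (√2 * √(l : ℝ) * displacedHermite z (l - 1) x
      + √2 * z * displacedHermite z l x - x * displacedHermite z l x) =
      √2 * √(l : ℝ) * matrixElement z k (l - 1) + √2 * z * matrixElement z k l -
        ∫ x : ℝ, (hermiteFun k x : ℂ) * (x * displacedHermite z l x) := by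
    rw [matrixElement, matrixElement, ← e2]
    refine Eq.trans ?_ e1
    congr 1; ext x
    simp only [Pi.add_apply]; ring
  have hp2 : ∫ x, ((√2 * √(k : ℝ) * hermiteFun (k - 1) x - x * hermiteFun k x : ℝ) : ℂ) *
      displacedHermite z l x = √2 * √(k : ℝ) * matrixElement z (k - 1) l -
        ∫ x : ℝ, (hermiteFun k x : ℂ) * (x * displacedHermite z l x) := by
    rw [matrixElement, ← e3]
    congr 1; ext x
    push_cast; ring
  rw [hp1, hp2] at hp
  linear_combination hp

lemma sqrt_two_ne_zero : ((√2 : ℝ) : ℂ) ≠ 0 := by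
  rw [Complex.ofReal_ne_zero]; positivity

/-- The commutation relation `a D_z = D_z (a + z)` between Hermite functions: the position operator
acting on the left factor, combined with the integration by parts. -/
lemma matrixElement_creation_left (z : ℂ) (k l : ℕ) :
    √((k : ℝ) + 1) * matrixElement z (k + 1) l =
      √(l : ℝ) * matrixElement z k (l - 1) + z * matrixElement z k l := by
  have h1 := integral_hermite_mul_displaced_left z k l
  have h2 := integral_hermite_parts z k l
  have h3 := sqrt_two_mul_sqrt_two
  refine mul_left_cancel₀ sqrt_two_ne_zero ?_
  linear_combination -√2 * h1 + (∫ x : ℝ, (hermiteFun k x : ℂ) * (x * displacedHermite z l x)) * h3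
    - h2

/-- The companion `a† D_z = D_z (a† + z̄)`, from the position operator acting on the displaced
factor. With the vacuum element below, these two recursions determine every matrix element of `D_z`.
-/
lemma matrixElement_annihilation_left (z : ℂ) (k l : ℕ) :
    √(k : ℝ) * matrixElement z (k - 1) l =
      √((l : ℝ) + 1) * matrixElement z k (l + 1) + conj z * matrixElement z k l := by
  have h1 := integral_hermite_mul_displaced_right z k l
  have h2 := integral_hermite_parts z k l
  have h3 := sqrt_two_mul_sqrt_two
  refine mul_left_cancel₀ sqrt_two_ne_zero ?_
  have hz : (2 * z.re : ℂ) = z + conj z := by rw [Complex.add_conj]; push_cast; ring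
  rw [hz] at h1
  linear_combination √2 * h1 - (∫ x : ℝ, (hermiteFun k x : ℂ) * (x * displacedHermite z l x)) * h3
    + h2

lemma matrixElement_zero_zero (z : ℂ) : matrixElement z 0 0 = Complex.exp (-(‖z‖ ^ 2 : ℝ) / 2) := by
  have h0 : ∀ x, hermiteFun 0 x = (√(√Real.pi))⁻¹ * Real.exp (-(x ^ 2) / 2) := fun x => by
    simp [hermiteFun]
  have hpi : ((√(√Real.pi) : ℝ) : ℂ) * (√(√Real.pi) : ℝ) = (√Real.pi : ℝ) := by
    rw [← Complex.ofReal_mul, Real.mul_self_sqrt (Real.sqrt_nonneg _)]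
  have hpi' : ((√Real.pi : ℝ) : ℂ) ≠ 0 := by
    rw [Complex.ofReal_ne_zero]; exact (Real.sqrt_pos.2 Real.pi_pos).ne'
  have h1 : ∀ x : ℝ, (hermiteFun 0 x : ℂ) * displacedHermite z 0 x =
      (√Real.pi : ℂ)⁻¹ * Complex.exp (-1 * (x : ℂ) ^ 2 + √2 * z * x + (-z.re * z)) := fun x => by
    rw [displacedHermite, h0, h0, ← hpi]
    push_cast
    rw [mul_inv]
    have : ∀ a b c d e : ℂ, a * Complex.exp b * (Complex.exp c * (a * Complex.exp d)) =
      a * a * (Complex.exp (b + c + d)) := fun a b c d e => by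
        rw [Complex.exp_add, Complex.exp_add]; ring
    rw [this _ _ _ _ 0]
    congr 2
    have h3 := sqrt_two_mul_sqrt_two
    have hz : z = z.re + z.im * Complex.I := (Complex.re_add_im z).symm
    linear_combination (-1/2 * (z.re : ℂ) ^ 2) * h3 + (z.re - √2 * x) * hz
  rw [matrixElement]
  simp_rw [h1]
  rw [integral_const_mul, integral_cexp_quadratic (by simp)]
  have h4 : ((Real.pi : ℂ) / - -1) ^ (1 / 2 : ℂ) = (√Real.pi : ℝ) := by
    rw [neg_neg, div_one, Real.sqrt_eq_rpow, Complex.ofReal_cpow Real.pi_pos.le]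
    norm_num
  rw [h4, ← mul_assoc, inv_mul_cancel₀ hpi', one_mul]
  congr 1
  have h3 := sqrt_two_mul_sqrt_two
  have h5 : ((‖z‖ ^ 2 : ℝ) : ℂ) = z.re ^ 2 + z.im ^ 2 := by
    rw [← Complex.normSq_eq_norm_sq, Complex.normSq_apply]; push_cast; ring
  rw [h5]
  have hz : z = z.re + z.im * Complex.I := (Complex.re_add_im z).symm
  have hz2 : z ^ 2 = z.re ^ 2 - z.im ^ 2 + 2 * z.re * z.im * Complex.I := by
    conv_lhs => rw [hz]
    linear_combination (z.im : ℂ) ^ 2 * Complex.I_sq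
  linear_combination z ^ 2 / 4 * h3 + 1/2 * hz2 - z.re * hz

/-! ### Matrix elements of displacement operators -/

variable {m : ℕ}

lemma displacement_coeFn (z : Fin m → ℂ) (f : Modes m) :
    displacement z f =ᵐ[volume] displaceFun z f :=
  MemLp.coeFn_toLp (memLp_displaceFun z (Lp.memLp f))

lemma fock_coeFn (k : Fin m → ℕ) : fock k =ᵐ[volume] fockFun k :=
  MemLp.coeFn_toLp (memLp_fockFun k)

lemma displaceFun_fockFun (z : Fin m → ℂ) (l : Fin m → ℕ) (x : Fin m → ℝ) :
    displaceFun z (fockFun l) x = ∏ j, displacedHermite (z j) (l j) (x j) := by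
  simp only [displaceFun, fockFun, displacedHermite]
  rw [Finset.prod_mul_distrib, ← Complex.exp_sum, ← Finset.sum_mul]
  push_cast
  rfl

lemma inner_fock_displacement_fock (z : Fin m → ℂ) (k l : Fin m → ℕ) :
    inner ℂ (fock k) (displacement z (fock l)) = ∏ j, matrixElement (z j) (k j) (l j) := by
  rw [L2.inner_def]
  have h : (fun x => inner ℂ (fock k x) (displacement z (fock l) x)) =ᵐ[volume]
      fun x => ∏ j, ((hermiteFun (k j) (x j) : ℂ) * displacedHermite (z j) (l j) (x j)) := by
    filter_upwards [fock_coeFn k, displacement_coeFn z (fock l),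
      displaceFun_congr z (fock_coeFn l)] with x h1 h2 h3
    rw [h1, h2, h3, displaceFun_fockFun, Finset.prod_mul_distrib]
    simp only [fockFun, RCLike.inner_apply, Complex.conj_ofReal]
    push_cast
    ring
  rw [integral_congr_ae h, integral_fintype_prod_volume_eq_prod
    (fun j x => (hermiteFun (k j) x : ℂ) * displacedHermite (z j) (l j) x)]
  rfl

lemma prod_matrixElement_creation_left (z : Fin m → ℂ) (k l : Fin m → ℕ) (j : Fin m) :
    √((k j : ℝ) + 1) * inner ℂ (fock (k + Pi.single j 1)) (displacement z (fock l)) =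
      √(l j : ℝ) * inner ℂ (fock k) (displacement z (fock (l - Pi.single j 1))) +
        z j * inner ℂ (fock k) (displacement z (fock l)) := by
  simp only [inner_fock_displacement_fock]
  simp only [← Finset.mul_prod_erase Finset.univ _ (Finset.mem_univ j)]
  have e1 : ∏ i ∈ Finset.univ.erase j, matrixElement (z i) ((k + Pi.single j 1 : Fin m → ℕ) i) (l i) =
      ∏ i ∈ Finset.univ.erase j, matrixElement (z i) (k i) (l i) :=
    Finset.prod_congr rfl fun i hi => by simp [Finset.ne_of_mem_erase hi]
  have e2 : ∏ i ∈ Finset.univ.erase j, matrixElement (z i) (k i) ((l - Pi.single j 1 : Fin m → ℕ) i) =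
      ∏ i ∈ Finset.univ.erase j, matrixElement (z i) (k i) (l i) :=
    Finset.prod_congr rfl fun i hi => by simp [Finset.ne_of_mem_erase hi]
  rw [e1, e2]
  simp only [Pi.add_apply, Pi.sub_apply, Pi.single_eq_same]
  linear_combination (∏ i ∈ Finset.univ.erase j, matrixElement (z i) (k i) (l i)) *
    matrixElement_creation_left (z j) (k j) (l j)

lemma prod_matrixElement_annihilation_left (z : Fin m → ℂ) (k l : Fin m → ℕ) (j : Fin m) :
    √(k j : ℝ) * inner ℂ (fock (k - Pi.single j 1)) (displacement z (fock l)) =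
      √((l j : ℝ) + 1) * inner ℂ (fock k) (displacement z (fock (l + Pi.single j 1))) +
        conj (z j) * inner ℂ (fock k) (displacement z (fock l)) := by
  simp only [inner_fock_displacement_fock]
  simp only [← Finset.mul_prod_erase Finset.univ _ (Finset.mem_univ j)]
  have e1 : ∏ i ∈ Finset.univ.erase j, matrixElement (z i) ((k - Pi.single j 1 : Fin m → ℕ) i) (l i) =
      ∏ i ∈ Finset.univ.erase j, matrixElement (z i) (k i) (l i) :=
    Finset.prod_congr rfl fun i hi => by simp [Finset.ne_of_mem_erase hi]
  have e2 : ∏ i ∈ Finset.univ.erase j, matrixElement (z i) (k i) ((l + Pi.single j 1 : Fin m → ℕ) i) =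
      ∏ i ∈ Finset.univ.erase j, matrixElement (z i) (k i) (l i) :=
    Finset.prod_congr rfl fun i hi => by simp [Finset.ne_of_mem_erase hi]
  rw [e1, e2]
  simp only [Pi.add_apply, Pi.sub_apply, Pi.single_eq_same]
  linear_combination (∏ i ∈ Finset.univ.erase j, matrixElement (z i) (k i) (l i)) *
    matrixElement_annihilation_left (z j) (k j) (l j)

lemma inner_vacuum_displacement_vacuum (z : Fin m → ℂ) :
    inner ℂ (fock (0 : Fin m → ℕ)) (displacement z (fock 0)) =
      Complex.exp (-(∑ j, ‖z j‖ ^ 2 : ℝ) / 2) := by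
  rw [inner_fock_displacement_fock]
  simp only [Pi.zero_apply, matrixElement_zero_zero]
  rw [← Complex.exp_sum]
  congr 1
  push_cast
  rw [← Finset.sum_div, Finset.sum_neg_distrib]

end Bosonic
end

noncomputable section

namespace Bosonic

/-! ### Sums over multi-indices -/

/-- Induction on the number of modes, splitting off the first index; nonnegativity makes the product
family summable. -/
lemma hasSum_pi_prod {m : ℕ} {f : Fin m → ℕ → ℝ} {S : Fin m → ℝ} (hf : ∀ j n, 0 ≤ f j n)
    (hS : ∀ j, HasSum (f j) (S j)) :
    HasSum (fun k : Fin m → ℕ => ∏ j, f j (k j)) (∏ j, S j) := by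
  induction m with
  | zero => simp
  | succ m ih =>
    have h1 := ih (f := fun j => f j.succ) (S := fun j => S j.succ) (fun j => hf _) (fun j => hS _)
    have h3 := (hS 0).summable.mul_of_nonneg h1.summable (hf 0)
      (fun k => Finset.prod_nonneg fun j _ => hf _ _)
    have h2 := (hS 0).mul h1 h3
    rw [Fin.prod_univ_succ, ← (Fin.consEquiv fun _ : Fin (m + 1) => ℕ).hasSum_iff]
    convert! h2 using 1
    ext p
    simp [Fin.consEquiv, Fin.prod_univ_succ]

/-! ### Fourier uniqueness -/

/-- The positive and negative parts of `φ` are densities of finite measures with the same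
characteristic functional, hence are equal almost everywhere; as one of them vanishes at each point,
so do both. -/
lemma eq_zero_of_forall_integral_exp_mul_real {m : ℕ} {φ : (Fin m → ℝ) → ℝ} (hφ : Integrable φ)
    (h : ∀ t : Fin m → ℝ, ∫ x, Complex.exp ((∑ j, t j * x j : ℝ) * Complex.I) * φ x = 0) :
    φ =ᵐ[volume] 0 := by
  have hp : Integrable fun x => max (φ x) 0 := hφ.pos_part
  have hn : Integrable fun x => max (-φ x) 0 := hφ.neg_part
  have hfin : ∀ ψ : (Fin m → ℝ) → ℝ, Integrable ψ →
      IsFiniteMeasure (volume.withDensity fun x => ENNReal.ofReal (ψ x)) := fun ψ hψ =>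
    isFiniteMeasure_withDensity_ofReal hψ.2
  have := hfin _ hp
  have := hfin _ hn
  have hint : ∀ ψ : (Fin m → ℝ) → ℝ, (hψ : Integrable ψ) → (∀ x, 0 ≤ ψ x) →
      ∀ L : StrongDual ℝ (Fin m → ℝ),
      charFunDual (volume.withDensity fun x => ENNReal.ofReal (ψ x)) L =
        ∫ x, Complex.exp ((∑ j, L (Pi.single j 1) * x j : ℝ) * Complex.I) * ψ x := by
    intro ψ hψ h0 L
    rw [charFunDual_apply, integral_withDensity_eq_integral_toReal_smul₀
      hψ.aestronglyMeasurable.aemeasurable.ennreal_ofReal (by simp)]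
    congr 1; ext x
    have hL : L x = ∑ j, L (Pi.single j 1) * x j := by
      conv_lhs => rw [← Finset.univ_sum_single x, map_sum]
      refine Finset.sum_congr rfl fun j _ => ?_
      have : (Pi.single j (x j) : Fin m → ℝ) = x j • Pi.single j 1 := by
        rw [← Pi.single_smul]; simp
      rw [this, map_smul, smul_eq_mul, mul_comm]
    rw [ENNReal.toReal_ofReal (h0 x), hL, Complex.real_smul, mul_comm]
  have hcont : ∀ t : Fin m → ℝ, ∀ ψ : (Fin m → ℝ) → ℝ, Integrable ψ →
      Integrable fun x => Complex.exp ((∑ j, t j * x j : ℝ) * Complex.I) * ψ x := fun t ψ hψ => by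
    refine (hψ.ofReal (𝕜 := ℂ)).bdd_mul (c := 1) ?_ (Filter.Eventually.of_forall fun x => ?_)
    · exact Continuous.aestronglyMeasurable (by fun_prop)
    · rw [Complex.norm_exp_ofReal_mul_I]
  have heq : (volume.withDensity fun x => ENNReal.ofReal (max (φ x) 0)) =
      volume.withDensity fun x => ENNReal.ofReal (max (-φ x) 0) := by
    refine Measure.ext_of_charFunDual ?_
    ext L
    rw [hint _ hp (fun _ => le_max_right _ _), hint _ hn (fun _ => le_max_right _ _), ← sub_eq_zero,
      ← integral_sub (hcont _ _ hp) (hcont _ _ hn), ← h fun j => L (Pi.single j 1)]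
    congr 1; ext x
    rw [← mul_sub]
    congr 1
    rw [← Complex.ofReal_sub]
    congr 1
    rcases le_total (φ x) 0 with h | h
    · rw [max_eq_right h, max_eq_left (by linarith)]; ring
    · rw [max_eq_left h, max_eq_right (by linarith)]; ring
  have h2 := (withDensity_eq_iff hp.aestronglyMeasurable.aemeasurable.ennreal_ofReal
    hn.aestronglyMeasurable.aemeasurable.ennreal_ofReal (by
      rw [← ofReal_integral_eq_lintegral_ofReal hp
        (Filter.Eventually.of_forall fun _ => le_max_right _ _)]
      simp)).1 heq
  filter_upwards [h2] with x hx
  have hx' : max (φ x) 0 = max (-φ x) 0 :=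
    (ENNReal.ofReal_eq_ofReal_iff (le_max_right _ _) (le_max_right _ _)).1 hx
  rcases le_total (φ x) 0 with h | h
  · rw [max_eq_right h, max_eq_left (by linarith)] at hx'; simp; linarith
  · rw [max_eq_left h, max_eq_right (by linarith)] at hx'; simpa using hx'

/-- The transform of `φ̄` at `t` is the conjugate of that of `φ` at `-t`, so the real and imaginary
parts also have vanishing transforms. -/
lemma eq_zero_of_forall_integral_exp_mul {m : ℕ} {φ : (Fin m → ℝ) → ℂ} (hφ : Integrable φ)
    (h : ∀ t : Fin m → ℝ, ∫ x, Complex.exp ((∑ j, t j * x j : ℝ) * Complex.I) * φ x = 0) :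
    φ =ᵐ[volume] 0 := by
  have hc : ∀ t : Fin m → ℝ,
      ∫ x, Complex.exp ((∑ j, t j * x j : ℝ) * Complex.I) * conj (φ x) = 0 := fun t => by
    have h1 := congrArg conj (h (-t))
    rw [← integral_conj, map_zero] at h1
    rw [← h1]
    congr 1; ext x
    rw [map_mul, ← Complex.exp_conj]
    congr 2
    simp
  have hi : ∀ t : Fin m → ℝ, ∀ ψ : (Fin m → ℝ) → ℂ, Integrable ψ →
      Integrable fun x => Complex.exp ((∑ j, t j * x j : ℝ) * Complex.I) * ψ x := fun t ψ hψ => by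
    refine hψ.bdd_mul (c := 1) ?_ (Filter.Eventually.of_forall fun x => ?_)
    · exact Continuous.aestronglyMeasurable (by fun_prop)
    · rw [Complex.norm_exp_ofReal_mul_I]
  have hφc : Integrable fun x => conj (φ x) :=
    (Complex.conjLIE.toContinuousLinearEquiv : ℂ →L[ℝ] ℂ).integrable_comp hφ
  have hre := eq_zero_of_forall_integral_exp_mul_real hφ.re fun t => by
    have := integral_add (hi t _ hφ) (hi t _ hφc)
    rw [h t, hc t, add_zero] at this
    rw [← mul_right_inj' (two_ne_zero' ℂ), mul_zero, ← this, ← integral_const_mul]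
    congr 1; ext x
    rw [← mul_add, Complex.add_conj]; simp; ring
  have him := eq_zero_of_forall_integral_exp_mul_real hφ.im fun t => by
    have := integral_sub (hi t _ hφ) (hi t _ hφc)
    rw [h t, hc t, sub_zero] at this
    rw [← mul_right_inj' (mul_ne_zero (two_ne_zero' ℂ) Complex.I_ne_zero), mul_zero, ← this,
      ← integral_const_mul]
    congr 1; ext x
    rw [← mul_sub, Complex.sub_conj]; simp; ring
  filter_upwards [hre, him] with x h1 h2
  exact Complex.ext h1 h2

/-! ### The Weyl relations -/

variable {m : ℕ}

/-- The symplectic form `Im ∑ⱼ zⱼ w̄ⱼ`. -/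
def symp (z w : Fin m → ℂ) : ℝ := ∑ j, ((z j).im * (w j).re - (z j).re * (w j).im)

lemma norm_displacement (z : Fin m → ℂ) (f : Modes m) : ‖displacement z f‖ = ‖f‖ :=
  norm_displaceLinear z f

lemma displacement_displacement (z w : Fin m → ℂ) (f : Modes m) :
    displacement z (displacement w f) =
      Complex.exp ((symp z w : ℝ) * Complex.I) • displacement (z + w) f := by
  apply Lp.ext
  have hq := (measurePreserving_sub_right (volume : Measure (Fin m → ℝ))
    (fun j => √2 * (z j).re)).quasiMeasurePreserving.ae (displacement_coeFn w f)
  filter_upwards [displacement_coeFn z (displacement w f), displaceFun_congr z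
    (displacement_coeFn w f), displacement_coeFn (z + w) f,
    Lp.coeFn_smul (Complex.exp ((symp z w : ℝ) * Complex.I)) (displacement (z + w) f)]
    with x h1 h2 h3 h4
  rw [h1, h2, h4, Pi.smul_apply, h3, smul_eq_mul]
  simp only [displaceFun]
  rw [← mul_assoc, ← mul_assoc, ← Complex.exp_add, ← Complex.exp_add]
  congr 2
  · rw [← add_mul, ← add_mul, ← Complex.ofReal_add, ← Complex.ofReal_add]
    congr 2
    rw [symp, ← Finset.sum_add_distrib, ← Finset.sum_add_distrib]
    refine Finset.sum_congr rfl fun j _ => ?_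
    simp only [Pi.add_apply, Pi.sub_apply, Complex.add_im, Complex.add_re]
    have h := Real.mul_self_sqrt (show (0 : ℝ) ≤ 2 by norm_num)
    linear_combination -(w j).im * (z j).re * h
  · ext j
    simp only [Pi.add_apply, Pi.sub_apply, Complex.add_re]
    ring

lemma displacement_zero (f : Modes m) : displacement 0 f = f := by
  apply Lp.ext
  filter_upwards [displacement_coeFn 0 f] with x h
  rw [h]
  have hx : (x - fun j => √2 * ((0 : Fin m → ℂ) j).re) = x := by ext j; simp
  simp only [displaceFun, hx]
  simp

lemma symp_self_neg (z : Fin m → ℂ) : symp z (-z) = 0 := by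
  rw [symp]
  refine Finset.sum_eq_zero fun j _ => ?_
  simp only [Pi.neg_apply, Complex.neg_re, Complex.neg_im]; ring

lemma displacement_neg_displacement (z : Fin m → ℂ) (f : Modes m) :
    displacement (-z) (displacement z f) = f := by
  have : symp (-z) z = 0 := by simpa using symp_self_neg (-z)
  rw [displacement_displacement, this]
  simp [displacement_zero]

lemma displacement_displacement_neg (z : Fin m → ℂ) (f : Modes m) :
    displacement z (displacement (-z) f) = f := by
  simpa using displacement_neg_displacement (-z) f

lemma inner_displacement_displacement (z : Fin m → ℂ) (f g : Modes m) :
    inner ℂ (displacement z f) (displacement z g) = inner ℂ f g :=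
  (⟨displaceLinear z, norm_displaceLinear z⟩ : Modes m →ₗᵢ[ℂ] Modes m).inner_map_map f g

lemma inner_displacement_left (z : Fin m → ℂ) (f g : Modes m) :
    inner ℂ (displacement z f) g = inner ℂ f (displacement (-z) g) := by
  rw [← inner_displacement_displacement z f, displacement_displacement_neg]

/-! ### The Fock basis -/

/-- At `z = 0` the two commutation relations reduce orthonormality to the vacuum element, with no
further integral to compute. -/
lemma matrixElement_zero (k l : ℕ) : matrixElement 0 k l = if k = l then 1 else 0 := by
  have hpos : ∀ n : ℕ, ((√((n : ℝ) + 1) : ℝ) : ℂ) ≠ 0 := fun n => by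
    rw [Complex.ofReal_ne_zero]; positivity
  induction k generalizing l with
  | zero =>
    cases l with
    | zero => simp [matrixElement_zero_zero]
    | succ l =>
      have h := matrixElement_annihilation_left 0 0 l
      simpa [hpos l] using h
  | succ k ih =>
    have h := matrixElement_creation_left 0 k l
    cases l with
    | zero => simpa [hpos k] using h
    | succ l =>
      rw [Nat.add_sub_cancel, ih, zero_mul, add_zero] at h
      by_cases hkl : k = l
      · subst hkl
        push_cast at h
        simpa [hpos k] using h
      · simpa [hkl, hpos k] using h

lemma inner_fock_fock (k l : Fin m → ℕ) :
    inner ℂ (fock k) (fock l) = if k = l then 1 else 0 := by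
  have h := inner_fock_displacement_fock 0 k l
  rw [displacement_zero] at h
  rw [h]
  simp only [Pi.zero_apply, matrixElement_zero]
  split_ifs with hkl
  · subst hkl; simp
  · obtain ⟨j, hj⟩ := Function.ne_iff.1 hkl
    exact Finset.prod_eq_zero (Finset.mem_univ j) (if_neg hj)

lemma orthonormal_fock : Orthonormal ℂ (fock : (Fin m → ℕ) → Modes m) := by
  classical
  rw [orthonormal_iff_ite]
  intro k l
  rw [inner_fock_fock]

lemma matrixElement_right_zero (z : ℂ) (k : ℕ) :
    matrixElement z k 0 = Complex.exp (-(‖z‖ ^ 2 : ℝ) / 2) * (z ^ k / √(k.factorial : ℝ)) := by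
  induction k with
  | zero => simp [matrixElement_zero_zero]
  | succ k ih =>
    have h := matrixElement_creation_left z k 0
    have h1 : ((√((k : ℝ) + 1) : ℝ) : ℂ) ≠ 0 := by
      rw [Complex.ofReal_ne_zero]; positivity
    have h2 : ((√(k.factorial : ℝ) : ℝ) : ℂ) ≠ 0 := by
      rw [Complex.ofReal_ne_zero]; positivity
    rw [ih] at h
    refine mul_left_cancel₀ h1 ?_
    rw [h, Nat.factorial_succ]
    push_cast
    rw [Real.sqrt_mul (by positivity)]
    push_cast
    field_simp
    simp
    ring

/-- In each mode the occupation number of a coherent state is Poisson with mean `|z_j|²`. That the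
total is one is Parseval's equality for coherent states, the input to completeness of the Fock
states. -/
lemma tsum_norm_sq_coherent (z : Fin m → ℂ) :
    HasSum (fun k : Fin m → ℕ => ‖inner ℂ (fock k) (displacement z (fock 0))‖ ^ 2) 1 := by
  have h1 : ∀ j, HasSum (fun n => ‖matrixElement (z j) n 0‖ ^ 2) 1 := fun j => by
    have := (NormedSpace.expSeries_div_hasSum_exp (‖z j‖ ^ 2 : ℝ)).mul_left (Real.exp (-‖z j‖ ^ 2))
    rw [← Real.exp_eq_exp_ℝ, ← Real.exp_add, neg_add_cancel, Real.exp_zero] at this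
    refine this.congr_fun fun n => ?_
    rw [matrixElement_right_zero, norm_mul, norm_div, norm_pow, Complex.norm_exp, mul_pow, div_pow,
      Complex.norm_real, Real.norm_eq_abs, sq_abs, Real.sq_sqrt (by positivity), ← Real.exp_nat_mul,
      ← pow_mul, ← pow_mul, mul_comm n 2]
    congr 2
    have : (-((‖z j‖ ^ 2 : ℝ) : ℂ) / 2).re = -‖z j‖ ^ 2 / 2 := by
      rw [← Complex.ofReal_neg, ← Complex.ofReal_ofNat, ← Complex.ofReal_div, Complex.ofReal_re]
    rw [this]; push_cast; ring
  have h2 := hasSum_pi_prod (fun j n => sq_nonneg _) h1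
  rw [Finset.prod_const_one] at h2
  refine h2.congr_fun fun k => ?_
  rw [inner_fock_displacement_fock, norm_prod, Finset.prod_pow]
  rfl

lemma norm_fock (k : Fin m → ℕ) : ‖fock k‖ = 1 := orthonormal_fock.1 k

/-- A vector which is orthogonal to all coherent states vanishes. -/
lemma eq_zero_of_forall_inner_coherent {f : Modes m}
    (h : ∀ z : Fin m → ℂ, inner ℂ (displacement z (fock 0)) f = 0) : f = 0 := by
  have h0 : ∀ x : Fin m → ℝ, fockFun (0 : Fin m → ℕ) x ≠ 0 := fun x => by
    simp only [fockFun, Pi.zero_apply, Complex.ofReal_ne_zero]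
    refine Finset.prod_ne_zero_iff.2 fun j _ => ?_
    simp only [hermiteFun, Polynomial.hermite_zero]
    simp [Real.exp_ne_zero, (Real.sqrt_pos.2 Real.pi_pos).ne']
  have hint : Integrable fun x => fockFun (0 : Fin m → ℕ) x * f x :=
    (memLp_fockFun 0).integrable_mul (Lp.memLp f)
  -- For purely imaginary `z` there is no translation, and the overlap with `D_z|0⟩` is the Fourier
  -- transform of the vacuum function times `f`. The vacuum function vanishes nowhere, so `f` itself
  -- must vanish.
  have h1 := eq_zero_of_forall_integral_exp_mul hint fun t => by
    rw [← h fun j => ((-(t j / √2) : ℝ) : ℂ) * Complex.I, L2.inner_def]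
    refine integral_congr_ae ?_
    filter_upwards [displacement_coeFn (fun j => ((-(t j / √2) : ℝ) : ℂ) * Complex.I)
      (fock (0 : Fin m → ℕ)), displaceFun_congr (fun j => ((-(t j / √2) : ℝ) : ℂ) * Complex.I)
        (fock_coeFn (0 : Fin m → ℕ))] with x h1 h2
    rw [h1, h2]
    have hr : conj (fockFun (0 : Fin m → ℕ) x) = fockFun (0 : Fin m → ℕ) x := Complex.conj_ofReal _
    simp only [displaceFun, RCLike.inner_apply, map_mul, ← Complex.exp_conj, Complex.conj_ofReal,
      Complex.conj_I, Complex.re_ofReal_mul, Complex.im_ofReal_mul, Complex.I_re, Complex.I_im]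
    have hx : (x - fun j : Fin m => √2 * (-(t j / √2) * 0)) = x := by ext j; simp
    rw [hx, hr]
    have ht : ∑ j, (√2 * (-(t j / √2) * 1) * x j - -(t j / √2) * 0 * (-(t j / √2) * 1)) =
        -∑ j, t j * x j := by
      rw [← Finset.sum_neg_distrib]
      refine Finset.sum_congr rfl fun j _ => ?_
      field_simp
      ring
    rw [ht]
    push_cast
    ring_nf
  apply Lp.ext
  filter_upwards [h1, Lp.coeFn_zero ℂ 2 (volume : Measure (Fin m → ℝ))] with x hx hx0
  rw [hx0]
  exact (mul_eq_zero.1 hx).resolve_left (h0 x)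

/-- Equality in Bessel's inequality makes `x` the limit of its partial expansions, so `x` is
orthogonal to whatever is orthogonal to all `e k`. -/
lemma inner_eq_zero_of_hasSum_norm_sq {ι H : Type*} [NormedAddCommGroup H] [InnerProductSpace ℂ H]
    {e : ι → H} (he : Orthonormal ℂ e) {x f : H}
    (hx : HasSum (fun k => ‖inner ℂ (e k) x‖ ^ 2) (‖x‖ ^ 2)) (hf : ∀ k, inner ℂ (e k) f = 0) :
    inner ℂ x f = 0 := by
  classical
  have h1 : ∀ s : Finset ι, ‖inner ℂ x f‖ ^ 2 ≤
      (‖x‖ ^ 2 - ∑ k ∈ s, ‖inner ℂ (e k) x‖ ^ 2) * ‖f‖ ^ 2 := fun s => by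
    have h2 : inner ℂ x f = inner ℂ (x - ∑ k ∈ s, inner ℂ (e k) x • e k) f := by
      rw [inner_sub_left, sum_inner]
      simp [inner_smul_left, hf]
    have h3 : ‖x - ∑ k ∈ s, inner ℂ (e k) x • e k‖ ^ 2 =
        ‖x‖ ^ 2 - ∑ k ∈ s, ‖inner ℂ (e k) x‖ ^ 2 := by
      rw [norm_sub_sq (𝕜 := ℂ), ← inner_self_eq_norm_sq (𝕜 := ℂ) (∑ k ∈ s, _), he.inner_sum,
        inner_sum]
      have h4 : ∀ k, inner ℂ x (inner ℂ (e k) x • e k) = ((‖inner ℂ (e k) x‖ ^ 2 : ℝ) : ℂ) :=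
        fun k => by
          rw [inner_smul_right, ← inner_conj_symm x (e k), Complex.mul_conj']; push_cast; rfl
      have h5 : ∀ k, conj (inner ℂ (e k) x) * inner ℂ (e k) x = ((‖inner ℂ (e k) x‖ ^ 2 : ℝ) : ℂ) :=
        fun k => by rw [Complex.conj_mul']; push_cast; rfl
      simp only [h4, h5, ← Complex.ofReal_sum, RCLike.re_to_complex, Complex.ofReal_re]
      ring
    rw [h2, ← h3, ← mul_pow]
    exact pow_le_pow_left₀ (norm_nonneg _) (norm_inner_le_norm _ _) 2
  have h2 : ‖inner ℂ x f‖ ^ 2 ≤ (‖x‖ ^ 2 - ‖x‖ ^ 2) * ‖f‖ ^ 2 :=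
    ge_of_tendsto' ((tendsto_const_nhds.sub hx).mul_const _) h1
  rw [sub_self, zero_mul] at h2
  exact norm_eq_zero.1 (pow_eq_zero_iff (two_ne_zero) |>.1 (le_antisymm h2 (sq_nonneg _)))

/-- The Fock states form an orthonormal basis. -/
def fockBasis (m : ℕ) : HilbertBasis (Fin m → ℕ) ℂ (Modes m) :=
  HilbertBasis.mkOfOrthogonalEqBot orthonormal_fock (by
    rw [Submodule.eq_bot_iff]
    intro f hf
    have hf' : ∀ k, inner ℂ (fock k) f = 0 := fun k =>
      (Submodule.mem_orthogonal _ _).1 hf _ (Submodule.subset_span ⟨k, rfl⟩)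
    refine eq_zero_of_forall_inner_coherent fun z => ?_
    refine inner_eq_zero_of_hasSum_norm_sq orthonormal_fock ?_ hf'
    rw [norm_displacement, norm_fock, one_pow]
    exact tsum_norm_sq_coherent z)

@[simp]
lemma fockBasis_apply (k : Fin m → ℕ) : fockBasis m k = fock k := by
  rw [fockBasis, HilbertBasis.coe_mkOfOrthogonalEqBot]

end Bosonic
end

noncomputable section

namespace Bosonic

variable {m : ℕ}

/-! ### Density of coherent states, strong continuity -/

lemma dense_span_of_inner_eq_zero {ι H : Type*} [NormedAddCommGroup H] [InnerProductSpace ℂ H]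
    [CompleteSpace H] {e : ι → H} (h : ∀ f, (∀ i, inner ℂ (e i) f = 0) → f = 0) :
    Dense (Submodule.span ℂ (Set.range e) : Set H) := by
  rw [Submodule.dense_iff_topologicalClosure_eq_top, Submodule.topologicalClosure_eq_top_iff,
    Submodule.eq_bot_iff]
  exact fun f hf => h f fun i =>
    (Submodule.mem_orthogonal _ _).1 hf _ (Submodule.subset_span ⟨i, rfl⟩)

/-- The coherent state `D_z |0⟩`. -/
def coherent (z : Fin m → ℂ) : Modes m := displacement z (fock 0)

lemma dense_span_coherent :
    Dense (Submodule.span ℂ (Set.range (coherent (m := m))) : Set (Modes m)) :=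
  dense_span_of_inner_eq_zero fun _ h => eq_zero_of_forall_inner_coherent h

lemma norm_coherent (z : Fin m → ℂ) : ‖coherent z‖ = 1 := by
  rw [coherent, norm_displacement, norm_fock]

lemma displacement_coherent (z w : Fin m → ℂ) :
    displacement z (coherent w) =
      Complex.exp ((symp z w : ℝ) * Complex.I) • coherent (z + w) :=
  displacement_displacement z w _

/-- `exp (-∑ⱼ |zⱼ|² / 2)`. -/
def gaussWeight (z : Fin m → ℂ) : ℝ := Real.exp (-(∑ j, ‖z j‖ ^ 2) / 2)

lemma gaussWeight_nonneg (z : Fin m → ℂ) : 0 ≤ gaussWeight z := Real.exp_nonneg _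

lemma gaussWeight_neg (z : Fin m → ℂ) : gaussWeight (-z) = gaussWeight z := by
  simp [gaussWeight]

lemma continuous_gaussWeight : Continuous (gaussWeight (m := m)) := by
  unfold gaussWeight; fun_prop

lemma continuous_symp_left (w : Fin m → ℂ) : Continuous fun z : Fin m → ℂ => symp z w := by
  unfold symp; fun_prop

lemma inner_vacuum_coherent (z : Fin m → ℂ) :
    inner ℂ (fock (0 : Fin m → ℕ)) (coherent z) = gaussWeight z := by
  rw [coherent, inner_vacuum_displacement_vacuum, gaussWeight]; push_cast; rfl

lemma inner_coherent_coherent (z w : Fin m → ℂ) :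
    inner ℂ (coherent z) (coherent w) =
      Complex.exp ((symp (-z) w : ℝ) * Complex.I) * gaussWeight (-z + w) := by
  rw [coherent, inner_displacement_left, displacement_coherent, inner_smul_right,
    inner_vacuum_coherent]

lemma continuous_coherent : Continuous (coherent (m := m)) := by
  rw [continuous_iff_continuousAt]
  intro z
  rw [ContinuousAt, tendsto_iff_norm_sub_tendsto_zero]
  have h1 : Filter.Tendsto (fun w => 2 - 2 * (inner ℂ (coherent z) (coherent w)).re) (nhds z)
      (nhds 0) := by
    have : Continuous fun w => 2 - 2 * (inner ℂ (coherent z) (coherent w)).re := by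
      simp only [inner_coherent_coherent]
      have h1 : Continuous fun w : Fin m → ℂ => symp (-z) w := by unfold symp; fun_prop
      have h2 := continuous_gaussWeight (m := m)
      fun_prop
    have h2 := this.tendsto z
    rw [inner_self_eq_norm_sq_to_K, norm_coherent] at h2
    simpa using h2
  have h2 : ∀ w, ‖coherent w - coherent z‖ = √(2 - 2 * (inner ℂ (coherent z) (coherent w)).re) :=
    fun w => by
    rw [← Real.sqrt_sq (norm_nonneg (coherent w - coherent z)), norm_sub_rev,
      norm_sub_sq (𝕜 := ℂ), norm_coherent, norm_coherent]
    congr 1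
    simp only [RCLike.re_to_complex]
    ring
  simp_rw [h2]
  simpa using h1.sqrt

/-- On a coherent state, `D_z` gives a continuous phase times a continuously moving coherent state.
Since all `D_z` are isometric, continuity passes from the dense span to every vector by uniform
approximation. -/
lemma continuous_displacement (f : Modes m) : Continuous fun z => displacement z f := by
  let K : Submodule ℂ (Modes m) :=
    { carrier := {f | Continuous fun z => displacement z f}
      add_mem' := fun {f g} hf hg => by
        simp only [Set.mem_ofPred_eq, map_add] at *
        exact hf.add hg
      zero_mem' := by simpa using continuous_const
      smul_mem' := fun c f hf => by
        simp only [Set.mem_ofPred_eq, map_smul] at *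
        exact hf.const_smul c }
  have hK : Submodule.span ℂ (Set.range (coherent (m := m))) ≤ K := by
    rw [Submodule.span_le]
    rintro _ ⟨w, rfl⟩
    change Continuous fun z => displacement z (coherent w)
    simp only [displacement_coherent]
    have h1 := continuous_symp_left w
    have h2 : Continuous fun z : Fin m → ℂ => coherent (z + w) :=
      continuous_coherent.comp (by fun_prop)
    fun_prop
  refine continuous_of_uniform_approx_of_continuous fun u hu => ?_
  obtain ⟨ε, hε, hεu⟩ := Metric.mem_uniformity_dist.1 hu
  obtain ⟨g, hg, hgf⟩ := Metric.mem_closure_iff.1 (dense_span_coherent f) ε hε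
  refine ⟨fun z => displacement z g, hK hg, fun z => hεu ?_⟩
  rwa [dist_eq_norm, ← map_sub, norm_displacement, ← dist_eq_norm]

/-! ### Gaussian integrals over `ℂᵐ` -/

lemma integral_cexp_complex (c d : ℂ) :
    ∫ z : ℂ, Complex.exp (-(z * conj z) + c * z + d * conj z) = Real.pi * Complex.exp (c * d) := by
  rw [← Complex.volume_preserving_equiv_real_prod.symm.integral_comp
    (MeasurableEquiv.measurableEmbedding _)]
  have h : ∀ p : ℝ × ℝ, Complex.exp (-(Complex.measurableEquivRealProd.symm p *
      conj (Complex.measurableEquivRealProd.symm p)) + c * Complex.measurableEquivRealProd.symm p +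
      d * conj (Complex.measurableEquivRealProd.symm p)) =
      Complex.exp (-1 * (p.1 : ℂ) ^ 2 + (c + d) * p.1 + 0) *
        Complex.exp (-1 * (p.2 : ℂ) ^ 2 + (Complex.I * (c - d)) * p.2 + 0) := fun p => by
    rw [← Complex.exp_add]
    congr 1
    have : Complex.measurableEquivRealProd.symm p = p.1 + p.2 * Complex.I := by
      rw [Complex.measurableEquivRealProd_symm_apply]; exact Complex.mk_eq_add_mul_I _ _
    rw [this]
    simp only [map_add, map_mul, Complex.conj_ofReal, Complex.conj_I]
    linear_combination (p.2 : ℂ) ^ 2 * Complex.I_sq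
  simp_rw [h]
  rw [Measure.volume_eq_prod, integral_prod_mul (fun x : ℝ => Complex.exp (-1 * (x : ℂ) ^ 2 + (c + d) * x + 0))
    (fun x : ℝ => Complex.exp (-1 * (x : ℂ) ^ 2 + (Complex.I * (c - d)) * x + 0)),
    integral_cexp_quadratic (by simp), integral_cexp_quadratic (by simp)]
  have h4 : ((Real.pi : ℂ) / - -1) ^ (1 / 2 : ℂ) = (√Real.pi : ℝ) := by
    rw [neg_neg, div_one, Real.sqrt_eq_rpow, Complex.ofReal_cpow Real.pi_pos.le]
    norm_num
  rw [h4]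
  have h5 : ((√Real.pi : ℝ) : ℂ) * (√Real.pi : ℝ) = Real.pi := by
    rw [← Complex.ofReal_mul, Real.mul_self_sqrt Real.pi_pos.le]
  rw [mul_mul_mul_comm, h5, ← Complex.exp_add]
  congr 2
  linear_combination (c - d) ^ 2 / 4 * Complex.I_sq

lemma integral_cexp_complex_pi (c d : Fin m → ℂ) :
    ∫ z : Fin m → ℂ, Complex.exp (∑ j, (-(z j * conj (z j)) + c j * z j + d j * conj (z j))) =
      (Real.pi : ℂ) ^ m * Complex.exp (∑ j, c j * d j) := by
  simp_rw [Complex.exp_sum]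
  rw [integral_fintype_prod_volume_eq_prod
    (fun j (z : ℂ) => Complex.exp (-(z * conj z) + c j * z + d j * conj z))]
  simp_rw [integral_cexp_complex]
  rw [Finset.prod_mul_distrib]
  simp

lemma integrable_gaussWeight : Integrable (gaussWeight (m := m)) := by
  have h1 : Integrable fun z : ℂ => Real.exp (-‖z‖ ^ 2 / 2) := by
    have := (GaussianFourier.integrable_cexp_neg_mul_sq_norm_add (V := ℂ) (b := 1 / 2) (by simp)
      0 0).norm
    refine this.congr (Filter.Eventually.of_forall fun z => ?_)
    simp only [Complex.norm_exp]
    congr 1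
    have : (-(1 / 2 : ℂ) * (‖z‖ : ℂ) ^ 2 + 0 * (inner ℝ (0 : ℂ) z : ℝ)) =
      ((-‖z‖ ^ 2 / 2 : ℝ) : ℂ) := by push_cast; ring
    rw [this, Complex.ofReal_re]
  refine (Integrable.fintype_prod (𝕜 := ℝ) (fun _ : Fin m => h1)).congr
    (Filter.Eventually.of_forall fun z => ?_)
  simp only [gaussWeight]
  rw [← Real.exp_sum, neg_div, Finset.sum_div, ← Finset.sum_neg_distrib]
  simp only [neg_div]

lemma symp_eq (z w : Fin m → ℂ) :
    ((symp z w : ℝ) : ℂ) * Complex.I = ∑ j, (z j * conj (w j) - conj (z j) * w j) / 2 := by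
  rw [symp, Complex.ofReal_sum, Finset.sum_mul]
  refine Finset.sum_congr rfl fun j _ => ?_
  have h1 : z j = (z j).re + (z j).im * Complex.I := (Complex.re_add_im _).symm
  have h2 : w j = (w j).re + (w j).im * Complex.I := (Complex.re_add_im _).symm
  have h3 : conj (z j) = (z j).re - (z j).im * Complex.I := by
    apply Complex.ext <;> simp
  have h4 : conj (w j) = (w j).re - (w j).im * Complex.I := by
    apply Complex.ext <;> simp
  rw [h3, h4]
  conv_rhs => rw [h1, h2]
  simp only [Complex.add_re, Complex.ofReal_re, Complex.mul_re, Complex.I_re, Complex.ofReal_im,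
    Complex.I_im, Complex.add_im, Complex.mul_im]
  push_cast
  ring

lemma gaussWeight_eq (z : Fin m → ℂ) :
    (gaussWeight z : ℂ) = Complex.exp (∑ j, -(z j * conj (z j)) / 2) := by
  rw [gaussWeight, Complex.ofReal_exp]
  congr 1
  push_cast
  rw [← Finset.sum_div, Finset.sum_neg_distrib]
  simp only [Complex.mul_conj']

/-- The Gaussian integral behind the composition law of the vacuum projection. -/
lemma integral_gaussWeight_twisted (w s : Fin m → ℂ) :
    ∫ z : Fin m → ℂ, (gaussWeight z : ℂ) * gaussWeight (s - (z + w)) *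
      (Complex.exp ((symp z w : ℝ) * Complex.I) *
        Complex.exp ((symp (z + w) (s - (z + w)) : ℝ) * Complex.I)) =
      (Real.pi : ℂ) ^ m * (gaussWeight w * gaussWeight s) := by
  have h : ∀ z : Fin m → ℂ, (gaussWeight z : ℂ) * gaussWeight (s - (z + w)) *
      (Complex.exp ((symp z w : ℝ) * Complex.I) *
        Complex.exp ((symp (z + w) (s - (z + w)) : ℝ) * Complex.I)) =
      Complex.exp (∑ j, (-(w j * conj (w j)) / 2 - (s j * conj (s j)) / 2 + w j * conj (s j))) *
      Complex.exp (∑ j, (-(z j * conj (z j)) + conj (s j) * z j + -w j * conj (z j))) := fun z => by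
    rw [gaussWeight_eq, gaussWeight_eq, symp_eq, symp_eq]
    simp only [← Complex.exp_add, ← Finset.sum_add_distrib]
    congr 1
    refine Finset.sum_congr rfl fun j _ => ?_
    simp only [Pi.sub_apply, Pi.add_apply, map_sub, map_add]
    ring
  simp_rw [h]
  rw [integral_const_mul, integral_cexp_complex_pi, gaussWeight_eq, gaussWeight_eq, mul_left_comm]
  congr 1
  simp only [← Complex.exp_add, ← Finset.sum_add_distrib]
  congr 1
  refine Finset.sum_congr rfl fun j _ => ?_
  ring

/-! ### The vacuum projection of a Weyl system -/

/-- The Weyl system `z ↦ D_{S z}` has the same composition law as `D` if `S` is symplectic. -/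
structure IsSymplectic (S : (Fin m → ℂ) →ₗ[ℝ] (Fin m → ℂ)) : Prop where
  symp_map : ∀ z w, symp (S z) (S w) = symp z w

lemma isSymplectic_id : IsSymplectic (LinearMap.id : (Fin m → ℂ) →ₗ[ℝ] (Fin m → ℂ)) :=
  ⟨fun _ _ => rfl⟩

/-- Nondegeneracy of the form: pairing `z` with `i z` gives `-∑ |z_j|²`. -/
lemma IsSymplectic.injective {S : (Fin m → ℂ) →ₗ[ℝ] (Fin m → ℂ)} (hS : IsSymplectic S) :
    Function.Injective S := by
  rw [← LinearMap.ker_eq_bot, LinearMap.ker_eq_bot']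
  intro z hz
  have h := hS.symp_map z (Complex.I • z)
  have h1 : symp z (Complex.I • z) = -∑ j, ‖z j‖ ^ 2 := by
    rw [symp, ← Finset.sum_neg_distrib]
    refine Finset.sum_congr rfl fun j _ => ?_
    rw [← Complex.normSq_eq_norm_sq, Complex.normSq_apply]
    simp
    ring
  have h2 : symp (0 : Fin m → ℂ) (S (Complex.I • z)) = 0 := by simp [symp]
  rw [hz, h1, h2] at h
  have h3 : ∑ j, ‖z j‖ ^ 2 = 0 := by linarith
  rw [Finset.sum_eq_zero_iff_of_nonneg fun _ _ => sq_nonneg _] at h3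
  ext j
  simpa using h3 j (Finset.mem_univ j)

lemma IsSymplectic.surjective {S : (Fin m → ℂ) →ₗ[ℝ] (Fin m → ℂ)} (hS : IsSymplectic S) :
    Function.Surjective S :=
  LinearMap.injective_iff_surjective.1 hS.injective

variable (S : (Fin m → ℂ) →ₗ[ℝ] (Fin m → ℂ))

lemma continuous_displacement_map (f : Modes m) : Continuous fun z => displacement (S z) f :=
  (continuous_displacement f).comp S.continuous_of_finiteDimensional

lemma integrable_gaussWeight_smul (f : Modes m) :
    Integrable fun z => (gaussWeight z : ℂ) • displacement (S z) f := by
  have h := continuous_gaussWeight (m := m)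
  have h' := continuous_displacement_map S f
  refine (integrable_gaussWeight.mul_const ‖f‖).mono'
    (Continuous.aestronglyMeasurable (by fun_prop)) (Filter.Eventually.of_forall fun z => ?_)
  rw [norm_smul, norm_displacement, Complex.norm_real, Real.norm_of_nonneg (gaussWeight_nonneg _)]

/-- The operator `π^{-m} ∫ exp (-|z|²/2) D_{S z} dz`. -/
def vacuumProj : Modes m →L[ℂ] Modes m :=
  LinearMap.mkContinuous
    { toFun := fun f => ((Real.pi : ℂ) ^ m)⁻¹ • ∫ z, (gaussWeight z : ℂ) • displacement (S z) f
      map_add' := fun f g => by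
        simp only [map_add, smul_add]
        rw [integral_add (integrable_gaussWeight_smul S f) (integrable_gaussWeight_smul S g),
          smul_add]
      map_smul' := fun c f => by
        simp only [map_smul, RingHom.id_apply]
        rw [smul_comm c, ← integral_smul c]
        simp only [smul_comm c] }
    (‖((Real.pi : ℂ) ^ m)⁻¹‖ * ∫ z : Fin m → ℂ, gaussWeight z) fun f => by
      simp only [LinearMap.coe_mk, AddHom.coe_mk]
      rw [norm_smul, mul_assoc, ← integral_mul_const]
      gcongr
      refine (norm_integral_le_integral_norm _).trans (le_of_eq ?_)
      congr 1; ext z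
      rw [norm_smul, norm_displacement, Complex.norm_real, Real.norm_of_nonneg (gaussWeight_nonneg _)]

lemma inner_vacuumProj (f g : Modes m) :
    inner ℂ f (vacuumProj S g) =
      ((Real.pi : ℂ) ^ m)⁻¹ * ∫ z, (gaussWeight z : ℂ) * inner ℂ f (displacement (S z) g) := by
  change inner ℂ f (((Real.pi : ℂ) ^ m)⁻¹ • ∫ z, (gaussWeight z : ℂ) • displacement (S z) g) = _
  rw [inner_smul_right, ← integral_inner (integrable_gaussWeight_smul S g)]
  simp only [inner_smul_right]

/-- Self-adjointness: the Gaussian weight is even and `D_{-z}` is the adjoint of `D_z`. -/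
lemma inner_vacuumProj_left (f g : Modes m) :
    inner ℂ (vacuumProj S f) g = inner ℂ f (vacuumProj S g) := by
  rw [← inner_conj_symm, inner_vacuumProj, inner_vacuumProj, map_mul, ← integral_conj,
    ← integral_neg_eq_self]
  congr 1
  · simp
  · congr 1; ext z
    rw [map_mul, inner_conj_symm, Complex.conj_ofReal, gaussWeight_neg, map_neg,
      inner_displacement_left, neg_neg]

variable {S}

lemma integrable_gaussWeight_twisted (w : Fin m → ℂ) : Integrable
    (fun p : (Fin m → ℂ) × (Fin m → ℂ) => gaussWeight p.1 * gaussWeight (p.2 - (p.1 + w)))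
    (volume.prod volume) := by
  have hc := continuous_gaussWeight (m := m)
  have hm : Continuous
      fun p : (Fin m → ℂ) × (Fin m → ℂ) => gaussWeight p.1 * gaussWeight (p.2 - (p.1 + w)) := by
    have : Continuous fun p : (Fin m → ℂ) × (Fin m → ℂ) => gaussWeight (p.2 - (p.1 + w)) :=
      hc.comp (by fun_prop)
    have h2 : Continuous fun p : (Fin m → ℂ) × (Fin m → ℂ) => gaussWeight p.1 :=
      hc.comp (by fun_prop)
    exact h2.mul this
  rw [integrable_prod_iff hm.aestronglyMeasurable]
  refine ⟨Filter.Eventually.of_forall fun z =>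
    (integrable_gaussWeight.comp_sub_right (z + w)).const_mul (gaussWeight z), ?_⟩
  have h : ∀ z : Fin m → ℂ, ∫ s, ‖gaussWeight z * gaussWeight (s - (z + w))‖ =
      gaussWeight z * ∫ s : Fin m → ℂ, gaussWeight s := fun z => by
    rw [← integral_sub_right_eq_self (fun s => gaussWeight s) (z + w), ← integral_const_mul]
    congr 1; ext s
    rw [Real.norm_of_nonneg (mul_nonneg (gaussWeight_nonneg _) (gaussWeight_nonneg _))]
  simp only [h]
  exact integrable_gaussWeight.mul_const _

lemma IsSymplectic.displacement_map (hS : IsSymplectic S) (z w : Fin m → ℂ) (f : Modes m) :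
    displacement (S z) (displacement (S w) f) =
      Complex.exp ((symp z w : ℝ) * Complex.I) • displacement (S (z + w)) f := by
  rw [displacement_displacement, hS.symp_map, map_add]

/-- Von Neumann's identity `P D_w P = e^{-|w|²/2} P`. Merging the three displacements into one of
total argument `s` leaves an explicit Gaussian integral over the first variable. Only the Weyl
relations enter, so it holds for every symplectic `S`; at `w = 0` it says that `P` is idempotent. -/
lemma vacuumProj_displacement_vacuumProj (hS : IsSymplectic S) (w : Fin m → ℂ) (f : Modes m) :
    vacuumProj S (displacement (S w) (vacuumProj S f)) = (gaussWeight w : ℂ) • vacuumProj S f := by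
  refine ext_inner_left ℂ fun g => ?_
  have hpi : ((Real.pi : ℂ) ^ m) ≠ 0 := by
    simp [Real.pi_ne_zero]
  -- The integrand once the inner variable has been shifted by `z + w`, so that `s` is the total
  -- displacement and the vector factor no longer depends on `z`.
  let F : (Fin m → ℂ) → (Fin m → ℂ) → ℂ := fun z s =>
    ((gaussWeight z : ℂ) * gaussWeight (s - (z + w)) *
      (Complex.exp ((symp z w : ℝ) * Complex.I) *
        Complex.exp ((symp (z + w) (s - (z + w)) : ℝ) * Complex.I))) *
      inner ℂ g (displacement (S s) f)
  have hF : Integrable (Function.uncurry F) (volume.prod volume) := by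
    have hc := continuous_gaussWeight (m := m)
    have h1 : Continuous fun p : (Fin m → ℂ) × (Fin m → ℂ) => displacement (S p.2) f :=
      (continuous_displacement_map S f).comp continuous_snd
    have h2 : Continuous fun p : (Fin m → ℂ) × (Fin m → ℂ) => gaussWeight (p.2 - (p.1 + w)) :=
      hc.comp (by fun_prop)
    have h3 : Continuous fun p : (Fin m → ℂ) × (Fin m → ℂ) =>
      symp (p.1 + w) (p.2 - (p.1 + w)) := by unfold symp; fun_prop
    have h4 : Continuous fun p : (Fin m → ℂ) × (Fin m → ℂ) => symp p.1 w := by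
      unfold symp; fun_prop
    have h5 : Continuous fun p : (Fin m → ℂ) × (Fin m → ℂ) => gaussWeight p.1 :=
      hc.comp (by fun_prop)
    refine ((integrable_gaussWeight_twisted w).mul_const (‖g‖ * ‖f‖)).mono'
      (Continuous.aestronglyMeasurable ?_) (Filter.Eventually.of_forall fun p => ?_)
    · change Continuous fun p : (Fin m → ℂ) × (Fin m → ℂ) =>
        ((gaussWeight p.1 : ℂ) * gaussWeight (p.2 - (p.1 + w)) *
        (Complex.exp ((symp p.1 w : ℝ) * Complex.I) *
          Complex.exp ((symp (p.1 + w) (p.2 - (p.1 + w)) : ℝ) * Complex.I))) *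
        inner ℂ g (displacement (S p.2) f)
      fun_prop
    · simp only [Function.uncurry, F, norm_mul, Complex.norm_exp_ofReal_mul_I, Complex.norm_real,
        Real.norm_of_nonneg (show 0 ≤ gaussWeight _ from Real.exp_nonneg _), mul_one]
      refine mul_le_mul_of_nonneg_left ?_ (mul_nonneg (Real.exp_nonneg _) (Real.exp_nonneg _))
      refine (norm_inner_le_norm _ _).trans ?_
      rw [norm_displacement]
  have h1 : ∀ z, (gaussWeight z : ℂ) * inner ℂ g (displacement (S z)
      (displacement (S w) (vacuumProj S f))) = ((Real.pi : ℂ) ^ m)⁻¹ * ∫ s, F z s := fun z => by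
    rw [hS.displacement_map, inner_smul_right, ← neg_neg (S (z + w)), ← inner_displacement_left,
      inner_vacuumProj, ← integral_sub_right_eq_self _ (z + w), ← mul_assoc, mul_left_comm,
      ← integral_const_mul]
    congr 2; ext s
    rw [inner_displacement_left, neg_neg, hS.displacement_map, inner_smul_right,
      add_sub_cancel]
    simp only [F]
    ring
  rw [inner_smul_right, inner_vacuumProj, inner_vacuumProj]
  simp_rw [h1]
  rw [integral_const_mul, integral_integral_swap hF]
  have h2 : ∀ s, ∫ z, F z s = (Real.pi : ℂ) ^ m * (gaussWeight w *
      ((gaussWeight s : ℂ) * inner ℂ g (displacement (S s) f))) := fun s => by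
    simp only [F]
    rw [integral_mul_const, integral_gaussWeight_twisted]
    ring
  simp_rw [h2]
  rw [integral_const_mul, integral_const_mul, inv_mul_cancel_left₀ hpi]
  ring

/-- Ensures `P ≠ 0`: its expectation in the Fock vacuum is the integral of a strictly positive
function. -/
lemma inner_vacuum_vacuumProj_vacuum (S : (Fin m → ℂ) →ₗ[ℝ] (Fin m → ℂ)) :
    ∃ r : ℝ, 0 < r ∧ inner ℂ (fock 0) (vacuumProj S (fock 0)) = (r : ℂ) := by
  refine ⟨(Real.pi ^ m)⁻¹ * ∫ z : Fin m → ℂ, gaussWeight z * gaussWeight (S z), ?_, ?_⟩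
  · have h1 : Continuous fun z : Fin m → ℂ => gaussWeight (S z) :=
      continuous_gaussWeight.comp S.continuous_of_finiteDimensional
    have h2 : Continuous fun z : Fin m → ℂ => gaussWeight z * gaussWeight (S z) :=
      continuous_gaussWeight.mul h1
    have hpos : ∀ z : Fin m → ℂ, 0 < gaussWeight z * gaussWeight (S z) := fun z =>
      mul_pos (Real.exp_pos _) (Real.exp_pos _)
    have hi : Integrable fun z : Fin m → ℂ => gaussWeight z * gaussWeight (S z) := by
      refine integrable_gaussWeight.mono' h2.aestronglyMeasurable
        (Filter.Eventually.of_forall fun z => ?_)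
      rw [Real.norm_of_nonneg (hpos z).le]
      refine mul_le_of_le_one_right (Real.exp_nonneg _) (Real.exp_le_one_iff.2 ?_)
      have : 0 ≤ ∑ j, ‖S z j‖ ^ 2 := Finset.sum_nonneg fun _ _ => sq_nonneg _
      linarith
    have := Real.pi_pos
    refine mul_pos (by positivity) ?_
    rw [integral_pos_iff_support_of_nonneg (fun z => (hpos z).le) hi]
    have : Function.support (fun z : Fin m → ℂ => gaussWeight z * gaussWeight (S z)) = Set.univ :=
      Set.eq_univ_of_forall fun z => (hpos z).ne'
    rw [this]
    exact isOpen_univ.measure_pos volume Set.univ_nonempty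
  · rw [inner_vacuumProj]
    push_cast
    rw [← integral_complex_ofReal]
    congr 2; ext z
    rw [← coherent, inner_vacuum_coherent]
    push_cast; rfl

/-- The vacuum vector of the Weyl system `z ↦ D_{S z}`. -/
lemma IsSymplectic.exists_vacuum (hS : IsSymplectic S) :
    ∃ ψ : Modes m, ∀ w, inner ℂ ψ (displacement (S w) ψ) = gaussWeight w := by
  obtain ⟨r, hr, h⟩ := inner_vacuum_vacuumProj_vacuum S
  -- With `r = ⟨0|P|0⟩` and `P` self-adjoint, `⟨P0, D_{Sw} P0⟩ = ⟨0, P D_{Sw} P 0⟩ = e^{-|w|²/2} r`,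
  -- hence the normalization by `√r`.
  refine ⟨((√r : ℝ) : ℂ)⁻¹ • vacuumProj S (fock 0), fun w => ?_⟩
  rw [map_smul, inner_smul_left, inner_smul_right, inner_vacuumProj_left,
    vacuumProj_displacement_vacuumProj hS, inner_smul_right, h, map_inv₀, Complex.conj_ofReal]
  have h1 : ((√r : ℝ) : ℂ) * (√r : ℝ) = r := by
    rw [← Complex.ofReal_mul, Real.mul_self_sqrt hr.le]
  have h2 : ((√r : ℝ) : ℂ) ≠ 0 := by
    rw [Complex.ofReal_ne_zero]; positivity
  rw [← h1]
  field_simp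

/-- For `S = id`, `P|0⟩` is a unit vector whose overlap with `|0⟩` equals one, so it is `|0⟩`. Von
Neumann's identity then gives `P` on coherent states, which span a dense subspace. -/
lemma vacuumProj_id_apply (f : Modes m) :
    vacuumProj LinearMap.id f = inner ℂ (fock 0) f • fock 0 := by
  have hS := isSymplectic_id (m := m)
  have h0 : inner ℂ (fock (0 : Fin m → ℕ)) (vacuumProj LinearMap.id (fock 0)) = 1 := by
    rw [inner_vacuumProj]
    have h1 : ∀ z : Fin m → ℂ, (gaussWeight z : ℂ) * inner ℂ (fock (0 : Fin m → ℕ))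
        (displacement ((LinearMap.id : (Fin m → ℂ) →ₗ[ℝ] (Fin m → ℂ)) z) (fock 0)) =
        Complex.exp (∑ j, (-(z j * conj (z j)) + (0 : Fin m → ℂ) j * z j +
          (0 : Fin m → ℂ) j * conj (z j))) := fun z => by
      rw [LinearMap.id_apply, ← coherent, inner_vacuum_coherent, gaussWeight_eq, ← Complex.exp_add,
        ← Finset.sum_add_distrib]
      congr 1
      refine Finset.sum_congr rfl fun j _ => ?_
      simp only [Pi.zero_apply]
      ring
    simp_rw [h1]
    rw [integral_cexp_complex_pi]
    simp [Real.pi_ne_zero]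
  have hn : ‖vacuumProj LinearMap.id (fock (0 : Fin m → ℕ))‖ = 1 := by
    have h1 := vacuumProj_displacement_vacuumProj hS 0 (fock 0)
    rw [map_zero, displacement_zero] at h1
    have h2 : inner ℂ (vacuumProj LinearMap.id (fock (0 : Fin m → ℕ)))
        (vacuumProj LinearMap.id (fock 0)) = 1 := by
      rw [inner_vacuumProj_left, h1, inner_smul_right, h0]
      simp [gaussWeight]
    rw [inner_self_eq_norm_sq_to_K] at h2
    have h3 : ‖vacuumProj LinearMap.id (fock (0 : Fin m → ℕ))‖ ^ 2 = 1 := by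
      have h4 := congrArg Complex.re h2
      rw [RCLike.ofReal_eq_complex_ofReal, ← Complex.ofReal_pow, Complex.ofReal_re] at h4
      exact h4
    exact (pow_eq_one_iff_of_nonneg (norm_nonneg _) two_ne_zero).1 h3
  have hfix : vacuumProj LinearMap.id (fock (0 : Fin m → ℕ)) = fock 0 :=
    ((inner_eq_one_iff_of_norm_eq_one (norm_fock 0) hn).1 h0).symm
  have hfun : vacuumProj LinearMap.id =
      InnerProductSpace.rankOne ℂ (fock (0 : Fin m → ℕ)) (fock 0) := by
    refine ContinuousLinearMap.ext_on dense_span_coherent ?_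
    rintro _ ⟨w, rfl⟩
    have h := vacuumProj_displacement_vacuumProj hS w (fock 0)
    rw [hfix, LinearMap.id_apply] at h
    rw [coherent, h, InnerProductSpace.rankOne_apply, ← coherent, inner_vacuum_coherent]
  rw [hfun, InnerProductSpace.rankOne_apply]

end Bosonic
end

noncomputable section

namespace Bosonic

variable {m : ℕ}

/-! ### Uniqueness of the characteristic function -/

-- Inversion formula. The matrix element is `tr(T D_u |0⟩⟨0| D_v)`; insert `|0⟩⟨0| = π^{-m} ∫
-- e^{-|z|²/2} D_z dz` and combine the three displacements. The factorization `T = AB` makes the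
-- exchange of trace and integral dominated.
open ContinuousLinearMap in
lemma inner_coherent_eq_integral_charFun {T : Modes m →L[ℂ] Modes m} (hT : IsTraceClass T)
    (u v : Fin m → ℂ) :
    inner ℂ (coherent (-v)) (T (coherent u)) = ((Real.pi : ℂ) ^ m)⁻¹ * ∫ z, (gaussWeight z : ℂ) *
      (Complex.exp ((symp z v : ℝ) * Complex.I) * Complex.exp ((symp u (z + v) : ℝ) * Complex.I) *
        charFun T (u + (z + v))) := by
  obtain ⟨A, B, rfl, hA, hB⟩ := hT.exists_factor
  have hB' : hsNormSq (adjoint B) < ⊤ := by rwa [hsNormSq_adjoint]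
  have hchar : ∀ z, charFun (A ∘L B) z =
      ∑' k, inner ℂ (adjoint B (fockBasis m k)) (displacement z (A (fockBasis m k))) := fun z =>
    trace_comp_comp (fockBasis m) hA hB _
  have hchar' : ∀ z, Summable fun k =>
      inner ℂ (adjoint B (fockBasis m k)) (displacement z (A (fockBasis m k))) := fun z =>
    summable_trace_comp_comp (fockBasis m) hA hB _
  let F : (Fin m → ℕ) → (Fin m → ℂ) → ℂ := fun k z => (gaussWeight z : ℂ) *
    inner ℂ (displacement (-u) (adjoint B (fockBasis m k)))
      (displacement z (displacement v (A (fockBasis m k))))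
  have hF : ∀ k z, F k z = (gaussWeight z : ℂ) *
      (Complex.exp ((symp z v : ℝ) * Complex.I) * Complex.exp ((symp u (z + v) : ℝ) * Complex.I) *
        inner ℂ (adjoint B (fockBasis m k)) (displacement (u + (z + v)) (A (fockBasis m k)))) :=
    fun k z => by
      simp only [F]
      rw [inner_displacement_left, neg_neg, displacement_displacement z v, map_smul,
        displacement_displacement, smul_smul, inner_smul_right]
  have hnorm : ∀ k z, ‖F k z‖ ≤ gaussWeight z *
      (‖adjoint B (fockBasis m k)‖ * ‖A (fockBasis m k)‖) := fun k z => by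
    simp only [F]
    rw [norm_mul, Complex.norm_real, Real.norm_of_nonneg (gaussWeight_nonneg _)]
    refine mul_le_mul_of_nonneg_left ?_ (gaussWeight_nonneg _)
    refine (norm_inner_le_norm _ _).trans ?_
    simp only [norm_displacement, le_refl]
  have hFi : ∀ k, Integrable (F k) := fun k => by
    refine (integrable_gaussWeight.mul_const _).mono' ?_ (Filter.Eventually.of_forall (hnorm k))
    have h1 := continuous_gaussWeight (m := m)
    have h2 := continuous_displacement (displacement v (A (fockBasis m k)))
    exact Continuous.aestronglyMeasurable (by fun_prop)
  have hs : Summable fun k => ‖adjoint B (fockBasis m k)‖ * ‖A (fockBasis m k)‖ := by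
    refine Summable.of_nonneg_of_le (fun _ => by positivity) (fun k => ?_)
      ((summable_sq_of_hsNormSq_lt_top (fockBasis m) hB').add
        (summable_sq_of_hsNormSq_lt_top (fockBasis m) hA))
    nlinarith [sq_nonneg (‖adjoint B (fockBasis m k)‖ - ‖A (fockBasis m k)‖),
      sq_nonneg (‖adjoint B (fockBasis m k)‖), sq_nonneg ‖A (fockBasis m k)‖]
  have hsum : Summable fun k => ∫ z, ‖F k z‖ := by
    refine Summable.of_nonneg_of_le (fun k => integral_nonneg fun _ => norm_nonneg _)
      (fun k => ?_) (hs.mul_left (∫ z : Fin m → ℂ, gaussWeight z))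
    rw [← integral_mul_const]
    exact integral_mono (hFi k).norm (integrable_gaussWeight.mul_const _) (hnorm k)
  have h1 := hasSum_integral_of_summable_integral_norm hFi hsum
  have h2 : ∀ z, ∑' k, F k z = (gaussWeight z : ℂ) *
      (Complex.exp ((symp z v : ℝ) * Complex.I) * Complex.exp ((symp u (z + v) : ℝ) * Complex.I) *
        charFun (A ∘L B) (u + (z + v))) := fun z => by
    simp_rw [hF]
    rw [hchar, tsum_mul_left, tsum_mul_left]
  simp_rw [h2] at h1
  rw [← h1.tsum_eq, ← tsum_mul_left]
  have h3 : ∀ k, ((Real.pi : ℂ) ^ m)⁻¹ * ∫ z, F k z =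
      inner ℂ (adjoint A (coherent (-v))) (fockBasis m k) *
        inner ℂ (fockBasis m k) (B (coherent u)) := fun k => by
    have h := inner_vacuumProj LinearMap.id (displacement (-u) (adjoint B (fockBasis m k)))
      (displacement v (A (fockBasis m k)))
    rw [vacuumProj_id_apply, inner_smul_right] at h
    simp only [LinearMap.id_apply] at h
    rw [← h, adjoint_inner_left, coherent, inner_displacement_left, neg_neg, inner_displacement_left,
      neg_neg, adjoint_inner_left]
    rfl
  simp_rw [h3]
  rw [(fockBasis m).tsum_inner_mul_inner, adjoint_inner_left]
  rfl

lemma ext_inner_coherent {S T : Modes m →L[ℂ] Modes m}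
    (h : ∀ u v, inner ℂ (coherent v) (S (coherent u)) = inner ℂ (coherent v) (T (coherent u))) :
    S = T := by
  refine ContinuousLinearMap.ext_on dense_span_coherent ?_
  rintro _ ⟨u, rfl⟩
  rw [← sub_eq_zero]
  refine eq_zero_of_forall_inner_coherent fun v => ?_
  rw [inner_sub_right, sub_eq_zero]
  exact h u v

/-- Trace-class operators are determined by their characteristic functions. -/
lemma eq_of_charFun_eq {S T : Modes m →L[ℂ] Modes m} (hS : IsTraceClass S) (hT : IsTraceClass T)
    (h : ∀ z, charFun S z = charFun T z) : S = T := by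
  refine ext_inner_coherent fun u v => ?_
  rw [← neg_neg v, inner_coherent_eq_integral_charFun hS, inner_coherent_eq_integral_charFun hT]
  simp_rw [h]

/-! ### The unitary that implements a symplectic map -/

lemma hsNormSq_rankOne_lt_top (x y : Modes m) :
    hsNormSq (InnerProductSpace.rankOne ℂ x y) < ⊤ := by
  rw [hsNormSq]
  simp_rw [InnerProductSpace.rankOne_apply, enorm_smul, mul_pow]
  rw [ENNReal.tsum_mul_right]
  simp_rw [enorm_inner_symm y]
  have h : ∀ i, ‖inner ℂ (someBasis (Modes m) i) y‖ₑ = ‖inner ℂ y (someBasis (Modes m) i)‖ₑ :=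
    fun i => enorm_inner_symm _ _
  rw [← enorm_sq_eq_tsum]
  exact ENNReal.mul_lt_top (by simp) (by simp)

/-- Cyclicity of the new vacuum. The rank-one operator `|ψ⟩⟨ζ|` has characteristic function `⟨ζ,
D_{Sw} ψ⟩` at `S w`. This vanishes and `S` is onto, so the operator is zero by uniqueness. -/
lemma IsSymplectic.eq_zero_of_inner_eq_zero {S : (Fin m → ℂ) →ₗ[ℝ] (Fin m → ℂ)}
    (hS : IsSymplectic S) {ψ : Modes m}
    (hψ : ∀ w, inner ℂ ψ (displacement (S w) ψ) = gaussWeight w) {ζ : Modes m}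
    (h : ∀ w, inner ℂ (displacement (S w) ψ) ζ = 0) : ζ = 0 := by
  have hn : ‖ψ‖ = 1 := by
    have h1 := hψ 0
    rw [map_zero, displacement_zero, inner_self_eq_norm_sq_to_K] at h1
    have h2 := congrArg Complex.re h1
    rw [RCLike.ofReal_eq_complex_ofReal, ← Complex.ofReal_pow, Complex.ofReal_re,
      Complex.ofReal_re] at h2
    refine (pow_eq_one_iff_of_nonneg (norm_nonneg _) two_ne_zero).1 (h2.trans ?_)
    simp [gaussWeight]
  have hfac : InnerProductSpace.rankOne ℂ ψ ζ =
      InnerProductSpace.rankOne ℂ ψ ψ ∘L InnerProductSpace.rankOne ℂ ψ ζ := by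
    ext1 x
    simp only [InnerProductSpace.rankOne_apply, ContinuousLinearMap.comp_apply, inner_smul_right,
      inner_self_eq_norm_sq_to_K, hn]
    simp
  have htc : IsTraceClass (InnerProductSpace.rankOne ℂ ψ ζ) := by
    rw [hfac]
    exact isTraceClass_comp (hsNormSq_rankOne_lt_top _ _) (hsNormSq_rankOne_lt_top _ _)
  have htc0 : IsTraceClass (0 : Modes m →L[ℂ] Modes m) := by
    have h0 : hsNormSq (0 : Modes m →L[ℂ] Modes m) < ⊤ := by simp [hsNormSq]
    simpa using isTraceClass_comp h0 h0
  have hz := eq_of_charFun_eq htc htc0 fun z => by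
    obtain ⟨w, rfl⟩ := hS.surjective z
    have h1 : charFun (0 : Modes m →L[ℂ] Modes m) (S w) = 0 := by simp [charFun, trace]
    have h2 : charFun (InnerProductSpace.rankOne ℂ ψ ζ) (S w) =
        inner ℂ ζ (displacement (S w) ψ) := by
      have h3 : inner ℂ ζ (displacement (S w) ψ) = inner ℂ (displacement (-S w) ζ) ψ := by
        rw [inner_displacement_left, neg_neg]
      rw [h3, charFun, trace, ← (someBasis (Modes m)).tsum_inner_mul_inner]
      congr 1; ext i
      rw [ContinuousLinearMap.comp_apply, InnerProductSpace.rankOne_apply, inner_smul_right,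
        inner_displacement_left, neg_neg]
    rw [h1, h2, ← inner_conj_symm, h, map_zero]
  have h3 := congrArg (fun T : Modes m →L[ℂ] Modes m => T ζ) hz
  simp only [InnerProductSpace.rankOne_apply, zero_apply] at h3
  rcases smul_eq_zero.1 h3 with h4 | h4
  · exact inner_self_eq_zero.1 h4
  · rw [h4, norm_zero] at hn
    norm_num at hn

lemma norm_linearCombination_eq {ι H : Type*} [NormedAddCommGroup H] [InnerProductSpace ℂ H]
    {x y : ι → H} (h : ∀ i j, inner ℂ (x i) (x j) = inner ℂ (y i) (y j)) (c : ι →₀ ℂ) :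
    ‖Finsupp.linearCombination ℂ x c‖ = ‖Finsupp.linearCombination ℂ y c‖ := by
  have h1 : inner ℂ (Finsupp.linearCombination ℂ x c) (Finsupp.linearCombination ℂ x c) =
      inner ℂ (Finsupp.linearCombination ℂ y c) (Finsupp.linearCombination ℂ y c) := by
    simp only [Finsupp.linearCombination_apply, Finsupp.sum, sum_inner, inner_sum, inner_smul_left,
      inner_smul_right, h]
  rw [norm_eq_sqrt_re_inner (𝕜 := ℂ), norm_eq_sqrt_re_inner (𝕜 := ℂ), h1]

/-- Coherent states and the vectors `D_{Sz} ψ` have the same Gram matrix and both have dense span,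
so matching them extends to a unitary. The intertwining relation holds on coherent states by the
Weyl relations, hence everywhere. -/
lemma IsSymplectic.exists_unitary {S : (Fin m → ℂ) →ₗ[ℝ] (Fin m → ℂ)} (hS : IsSymplectic S) :
    ∃ U : Modes m ≃ₗᵢ[ℂ] Modes m, ∀ z f, U (displacement z f) = displacement (S z) (U f) := by
  obtain ⟨ψ, hψ⟩ := hS.exists_vacuum
  have hd : ∀ {e : (Fin m → ℂ) → Modes m}, (∀ f, (∀ i, inner ℂ (e i) f = 0) → f = 0) →
      DenseRange (Finsupp.linearCombination ℂ e) := fun {e} he => by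
    have := dense_span_of_inner_eq_zero he
    rwa [← Finsupp.range_linearCombination] at this
  have hgram : ∀ a b : Fin m → ℂ, inner ℂ (displacement (S a) ψ) (displacement (S b) ψ) =
      inner ℂ (coherent a) (coherent b) := fun a b => by
    rw [inner_displacement_left, ← map_neg, hS.displacement_map, inner_smul_right, hψ,
      inner_coherent_coherent]
  let U := (LinearEquiv.refl ℂ ((Fin m → ℂ) →₀ ℂ)).extendOfIsometry
    (Finsupp.linearCombination ℂ coherent)
    (Finsupp.linearCombination ℂ fun z => displacement (S z) ψ)
    (hd fun f hf => eq_zero_of_forall_inner_coherent hf)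
    (hd fun f hf => hS.eq_zero_of_inner_eq_zero hψ hf) (norm_linearCombination_eq hgram)
  have hU : ∀ z, U (coherent z) = displacement (S z) ψ := fun z => by
    have := (LinearEquiv.refl ℂ ((Fin m → ℂ) →₀ ℂ)).extendOfIsometry_eq
      (Finsupp.linearCombination ℂ coherent)
      (Finsupp.linearCombination ℂ fun z => displacement (S z) ψ)
      (hd fun f hf => eq_zero_of_forall_inner_coherent hf)
      (hd fun f hf => hS.eq_zero_of_inner_eq_zero hψ hf) (norm_linearCombination_eq hgram)
      (Finsupp.single z 1)
    simpa using this
  refine ⟨U, fun z f => ?_⟩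
  have h : (U : Modes m →L[ℂ] Modes m) ∘L displacement z =
      displacement (S z) ∘L (U : Modes m →L[ℂ] Modes m) := by
    refine ContinuousLinearMap.ext_on dense_span_coherent ?_
    rintro _ ⟨w, rfl⟩
    change U (displacement z (coherent w)) = displacement (S z) (U (coherent w))
    rw [displacement_coherent, map_smul, hU, hU, hS.displacement_map]
  exact congrArg (fun T : Modes m →L[ℂ] Modes m => T f) h

end Bosonic
end

noncomputable section

namespace Bosonic

variable {m : ℕ}

/-! ### Creation and annihilation operators -/

/-- The vector in `L²(ℝᵐ)` of a finite linear combination of Fock states. -/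
def fockEmb : FockSpan m →ₗ[ℂ] Modes m := Finsupp.linearCombination ℂ fock

@[simp]
lemma fockEmb_single (k : Fin m → ℕ) (c : ℂ) : fockEmb (Finsupp.single k c) = c • fock k := by
  simp [fockEmb]

@[simp]
lemma annihilation_single (j : Fin m) (k : Fin m → ℕ) (c : ℂ) :
    annihilation j (Finsupp.single k c) =
      Finsupp.single (k - Pi.single j 1) (c * ((√(k j : ℝ) : ℝ) : ℂ)) := by
  simp [annihilation]

@[simp]
lemma creation_single (j : Fin m) (k : Fin m → ℕ) (c : ℂ) :
    creation j (Finsupp.single k c) =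
      Finsupp.single (k + Pi.single j 1) (c * ((√((k j : ℝ) + 1) : ℝ) : ℂ)) := by
  simp [creation]

lemma inner_fock_fockEmb (k : Fin m → ℕ) (v : FockSpan m) : inner ℂ (fock k) (fockEmb v) = v k := by
  classical
  induction v using Finsupp.induction_linear with
  | zero => simp
  | add u v hu hv => rw [map_add, inner_add_right, hu, hv, Finsupp.add_apply]
  | single l c =>
    rw [fockEmb_single, inner_smul_right, inner_fock_fock, Finsupp.single_apply]
    simp [eq_comm]

/-- Weak form of `a_j D_z = D_z (a_j + z_j)`. The unbounded operators act only on finite Fock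
combinations, so no domains are needed. -/
lemma inner_creation_left (z : Fin m → ℂ) (j : Fin m) (u v : FockSpan m) :
    inner ℂ (fockEmb (creation j u)) (displacement z (fockEmb v)) =
      inner ℂ (fockEmb u) (displacement z (fockEmb (annihilation j v))) +
        z j * inner ℂ (fockEmb u) (displacement z (fockEmb v)) := by
  induction u using Finsupp.induction_linear with
  | zero => simp
  | add u u' hu hu' => simp only [map_add, inner_add_left, hu, hu']; ring
  | single k c =>
    induction v using Finsupp.induction_linear with
    | zero => simp
    | add v v' hv hv' => simp only [map_add, inner_add_right, hv, hv']; ring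
    | single l d =>
      have h := prod_matrixElement_creation_left z k l j
      simp only [creation_single, annihilation_single, fockEmb_single, map_smul, inner_smul_left,
        inner_smul_right, map_mul, Complex.conj_ofReal]
      linear_combination conj c * d * h

lemma inner_annihilation_left (z : Fin m → ℂ) (j : Fin m) (u v : FockSpan m) :
    inner ℂ (fockEmb (annihilation j u)) (displacement z (fockEmb v)) =
      inner ℂ (fockEmb u) (displacement z (fockEmb (creation j v))) +
        conj (z j) * inner ℂ (fockEmb u) (displacement z (fockEmb v)) := by
  induction u using Finsupp.induction_linear with
  | zero => simp
  | add u u' hu hu' => simp only [map_add, inner_add_left, hu, hu']; ring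
  | single k c =>
    induction v using Finsupp.induction_linear with
    | zero => simp
    | add v v' hv hv' => simp only [map_add, inner_add_right, hv, hv']; ring
    | single l d =>
      have h := prod_matrixElement_annihilation_left z k l j
      simp only [creation_single, annihilation_single, fockEmb_single, map_smul, inner_smul_left,
        inner_smul_right, map_mul, Complex.conj_ofReal]
      linear_combination conj c * d * h

lemma dense_range_fockEmb : DenseRange (fockEmb (m := m)) := by
  have := dense_span_of_inner_eq_zero (e := (fock : (Fin m → ℕ) → Modes m)) fun f hf => by
    refine (fockBasis m).repr.injective (lp.ext (funext fun k => ?_))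
    rw [(fockBasis m).repr_apply_apply, fockBasis_apply, hf, map_zero]
    rfl
  rwa [← Finsupp.range_linearCombination] at this

lemma annihilation_vacuum (j : Fin m) :
    annihilation j (Finsupp.single (0 : Fin m → ℕ) 1) = 0 := by simp

lemma multiIndex_add_sub (k : Fin m → ℕ) (j : Fin m) :
    k + Pi.single j 1 - Pi.single j 1 = k := by
  ext i; simp

lemma multiIndex_sub_add {k : Fin m → ℕ} {j : Fin m} (h : k j ≠ 0) :
    k - Pi.single j 1 + Pi.single j 1 = k := by
  ext i
  by_cases hij : i = j
  · subst hij; simp; omega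
  · simp [hij]

lemma annihilation_creation_same (j : Fin m) (v : FockSpan m) :
    annihilation j (creation j v) = creation j (annihilation j v) + v := by
  induction v using Finsupp.induction_linear with
  | zero => simp
  | add u v hu hv => simp only [map_add, hu, hv]; abel
  | single k c =>
    have h1 : ((√((k j : ℝ) + 1) : ℝ) : ℂ) * (√((k j : ℝ) + 1) : ℝ) = k j + 1 := by
      rw [← Complex.ofReal_mul, Real.mul_self_sqrt (by positivity)]; simp
    have h2 : ((√(k j : ℝ) : ℝ) : ℂ) * (√(k j : ℝ) : ℝ) = k j := by
      rw [← Complex.ofReal_mul, Real.mul_self_sqrt (by positivity)]; simp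
    simp only [creation_single, annihilation_single, multiIndex_add_sub]
    by_cases hk : k j = 0
    · simp [hk]
    · rw [multiIndex_sub_add hk, ← Finsupp.single_add]
      congr 1
      have e1 : (((k + Pi.single j 1 : Fin m → ℕ) j : ℕ) : ℝ) = (k j : ℝ) + 1 := by simp
      have e2 : (((k - Pi.single j 1 : Fin m → ℕ) j : ℕ) : ℝ) + 1 = (k j : ℝ) := by
        have : k j = (k j - 1) + 1 := by omega
        simp only [Pi.sub_apply, Pi.single_eq_same]
        conv_rhs => rw [this]
        push_cast; rfl
      rw [e1, e2]
      linear_combination c * h1 - c * h2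

lemma annihilation_creation_ne {i j : Fin m} (hij : i ≠ j) (v : FockSpan m) :
    annihilation i (creation j v) = creation j (annihilation i v) := by
  induction v using Finsupp.induction_linear with
  | zero => simp
  | add u v hu hv => simp only [map_add, hu, hv]
  | single k c =>
    simp only [creation_single, annihilation_single]
    have e1 : k + Pi.single j 1 - Pi.single i 1 = k - Pi.single i 1 + Pi.single j 1 := by
      ext l
      by_cases h1 : l = i
      · subst h1; simp [hij]
      · simp [h1]
    rw [e1]
    congr 1
    simp [hij, hij.symm]
    ring

lemma creation_creation (i j : Fin m) (v : FockSpan m) :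
    creation i (creation j v) = creation j (creation i v) := by
  by_cases hij : i = j
  · rw [hij]
  induction v using Finsupp.induction_linear with
  | zero => simp
  | add u v hu hv => simp only [map_add, hu, hv]
  | single k c =>
    simp only [creation_single]
    rw [add_right_comm]
    congr 1
    simp [hij, Ne.symm hij]
    ring

lemma annihilation_annihilation (i j : Fin m) (v : FockSpan m) :
    annihilation i (annihilation j v) = annihilation j (annihilation i v) := by
  by_cases hij : i = j
  · rw [hij]
  induction v using Finsupp.induction_linear with
  | zero => simp
  | add u v hu hv => simp only [map_add, hu, hv]
  | single k c =>
    simp only [annihilation_single]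
    have e1 : k - Pi.single j 1 - Pi.single i 1 = k - Pi.single i 1 - Pi.single j 1 := by
      ext l; simp only [Pi.sub_apply]; omega
    rw [e1]
    congr 1
    simp [hij, Ne.symm hij]
    ring

/-- The generator `∑ⱼ (zⱼ aⱼ† - z̄ⱼ aⱼ)` of the displacements `D_{t z}`. -/
def generator (z : Fin m → ℂ) : FockSpan m →ₗ[ℂ] FockSpan m :=
  ∑ j, (z j • creation j - conj (z j) • annihilation j)

lemma generator_apply (z : Fin m → ℂ) (v : FockSpan m) :
    generator z v = ∑ j, (z j • creation j v - conj (z j) • annihilation j v) := by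
  simp [generator]

lemma annihilation_generator (z : Fin m → ℂ) (j : Fin m) (v : FockSpan m) :
    annihilation j (generator z v) = generator z (annihilation j v) + z j • v := by
  rw [generator_apply, generator_apply, map_sum]
  have h : ∀ i, annihilation j (z i • creation i v - conj (z i) • annihilation i v) =
      (z i • creation i (annihilation j v) - conj (z i) • annihilation i (annihilation j v)) +
        if i = j then z j • v else 0 := fun i => by
    rw [map_sub, map_smul, map_smul, annihilation_annihilation j i]
    by_cases hij : i = j
    · subst hij
      rw [annihilation_creation_same, if_pos rfl, smul_add]; abel
    · rw [annihilation_creation_ne (Ne.symm hij), if_neg hij, add_zero]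
  simp_rw [h]
  rw [Finset.sum_add_distrib]
  simp

lemma creation_generator (z : Fin m → ℂ) (j : Fin m) (v : FockSpan m) :
    creation j (generator z v) = generator z (creation j v) + conj (z j) • v := by
  rw [generator_apply, generator_apply, map_sum]
  have h : ∀ i, creation j (z i • creation i v - conj (z i) • annihilation i v) =
      (z i • creation i (creation j v) - conj (z i) • annihilation i (creation j v)) +
        if i = j then conj (z j) • v else 0 := fun i => by
    rw [map_sub, map_smul, map_smul, creation_creation j i]
    by_cases hij : i = j
    · subst hij
      rw [annihilation_creation_same, if_pos rfl, smul_add]; abel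
    · rw [annihilation_creation_ne hij, if_neg hij, add_zero]
  simp_rw [h]
  rw [Finset.sum_add_distrib]
  simp

/-- Induction on multi-indices. -/
lemma multiIndex_induction {p : (Fin m → ℕ) → Prop} (h0 : p 0)
    (hs : ∀ k j, p k → p (k + Pi.single j 1)) (k : Fin m → ℕ) : p k := by
  induction hn : ∑ j, k j generalizing k with
  | zero =>
    have : k = 0 := by
      ext j
      exact Finset.sum_eq_zero_iff.1 hn j (Finset.mem_univ j)
    rwa [this]
  | succ n ih =>
    obtain ⟨j, hj⟩ : ∃ j, k j ≠ 0 := by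
      by_contra! h
      simp [h] at hn
    rw [← multiIndex_sub_add hj]
    refine hs _ _ (ih _ ?_)
    rw [← multiIndex_sub_add hj] at hn
    simp only [Pi.add_apply, Finset.sum_add_distrib, Finset.sum_pi_single', Finset.mem_univ,
      if_true] at hn
    omega

/-- A subspace of `FockSpan m` that contains the vacuum and is stable under the creation operators
is everything. -/
lemma fockSpan_induction {p : FockSpan m → Prop} (h0 : p (Finsupp.single 0 1))
    (hadd : ∀ u v, p u → p v → p (u + v)) (hsmul : ∀ (c : ℂ) u, p u → p (c • u))
    (hs : ∀ j u, p u → p (creation j u)) (u : FockSpan m) : p u := by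
  have h1 : ∀ k : Fin m → ℕ, p (Finsupp.single k 1) := fun k => by
    induction k using multiIndex_induction with
    | h0 => exact h0
    | hs k j hk =>
      have h := hsmul ((√((k j : ℝ) + 1) : ℝ) : ℂ)⁻¹ _ (hs j _ hk)
      rw [creation_single, one_mul, Finsupp.smul_single, smul_eq_mul, inv_mul_cancel₀] at h
      · exact h
      · rw [Complex.ofReal_ne_zero]; positivity
  induction u using Finsupp.induction_linear with
  | zero => simpa using hsmul 0 _ h0
  | add u v hu hv => exact hadd _ _ hu hv
  | single k c => simpa using hsmul c _ (h1 k)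

lemma inner_vacuum_displacement_smul (z : Fin m → ℂ) (t : ℝ) :
    inner ℂ (fockEmb (Finsupp.single (0 : Fin m → ℕ) 1))
      (displacement (t • z) (fockEmb (Finsupp.single 0 1))) =
      Complex.exp (-(t : ℂ) ^ 2 * (∑ j, z j * conj (z j)) / 2) := by
  rw [fockEmb_single, one_smul, inner_vacuum_displacement_vacuum]
  congr 1
  push_cast
  rw [Finset.mul_sum, ← Finset.sum_neg_distrib]
  congr 1
  refine Finset.sum_congr rfl fun j _ => ?_
  rw [Complex.mul_conj', Pi.smul_apply, norm_smul, Real.norm_eq_abs]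
  have : ((|t| : ℝ) : ℂ) ^ 2 = (t : ℂ) ^ 2 := by rw [← Complex.ofReal_pow, sq_abs]; simp
  push_cast
  rw [mul_pow, this]; ring

/-- Every finite Fock combination arises from the vacuum by creation operators, and moving one
across `D_{tz}` produces the factor `t z_j`. The product rule then matches the commutator of `a_j`
with the generator. The base case differentiates a Gaussian. -/
lemma hasDerivAt_inner_displacement_vacuum (z : Fin m → ℂ) (u : FockSpan m) (t : ℝ) :
    HasDerivAt (fun t : ℝ => inner ℂ (fockEmb u)
        (displacement (t • z) (fockEmb (Finsupp.single 0 1))))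
      (inner ℂ (fockEmb u) (displacement (t • z) (fockEmb (generator z (Finsupp.single 0 1))))) t := by
  induction u using fockSpan_induction with
  | h0 =>
    simp_rw [inner_vacuum_displacement_smul]
    have h1 : HasDerivAt (fun t : ℝ => -(t : ℂ) ^ 2 * (∑ j, z j * conj (z j)) / 2)
        (-t * (∑ j, z j * conj (z j))) t := by
      have := ((((hasDerivAt_id t).ofReal_comp).pow 2).neg.mul_const
        (∑ j, z j * conj (z j))).div_const 2
      convert! this using 1
      simp; ring
    convert! h1.cexp using 1
    rw [generator_apply]
    have h2 : ∀ j, inner ℂ (fockEmb (Finsupp.single (0 : Fin m → ℕ) 1)) (displacement (t • z)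
        (fockEmb (z j • creation j (Finsupp.single (0 : Fin m → ℕ) 1) -
          conj (z j) • annihilation j (Finsupp.single (0 : Fin m → ℕ) 1)))) =
        -t * (z j * conj (z j)) * Complex.exp (-(t : ℂ) ^ 2 * (∑ j, z j * conj (z j)) / 2) :=
      fun j => by
      have h3 := inner_annihilation_left (t • z) j (Finsupp.single (0 : Fin m → ℕ) 1)
        (Finsupp.single (0 : Fin m → ℕ) 1)
      rw [annihilation_vacuum, inner_vacuum_displacement_smul, map_zero, inner_zero_left,
        Pi.smul_apply, Complex.real_smul, map_mul, Complex.conj_ofReal] at h3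
      rw [annihilation_vacuum, smul_zero, sub_zero, map_smul, map_smul, inner_smul_right]
      linear_combination -z j * h3
    rw [map_sum, map_sum, inner_sum]
    simp_rw [h2]
    rw [← Finset.sum_mul, ← Finset.mul_sum]
    ring
  | hadd u v hu hv =>
    simp only [map_add, inner_add_left]
    exact hu.add hv
  | hsmul c u hu =>
    simp only [map_smul, inner_smul_left]
    exact hu.const_mul _
  | hs j u hu =>
    simp only [inner_creation_left, annihilation_vacuum, annihilation_generator, map_zero,
      inner_zero_right, zero_add, Pi.smul_apply, map_smul,
      inner_smul_right, Complex.real_smul]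
    have h1 : HasDerivAt (fun t : ℝ => (t : ℂ) * z j) (z j) t := by
      simpa using ((hasDerivAt_id t).ofReal_comp).mul_const (z j)
    exact h1.mul hu

/-- The same induction on the right-hand vector: a creation operator there is moved to the left as
an annihilation operator. -/
lemma hasDerivAt_inner_displacement (z : Fin m → ℂ) (u v : FockSpan m) (t : ℝ) :
    HasDerivAt (fun t : ℝ => inner ℂ (fockEmb u) (displacement (t • z) (fockEmb v)))
      (inner ℂ (fockEmb u) (displacement (t • z) (fockEmb (generator z v)))) t := by
  induction v using fockSpan_induction generalizing u with
  | h0 => exact hasDerivAt_inner_displacement_vacuum z u t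
  | hadd v v' hv hv' =>
    simp only [map_add, inner_add_right]
    exact (hv u).add (hv' u)
  | hsmul c v hv =>
    simp only [map_smul, inner_smul_right]
    exact (hv u).const_mul _
  | hs j v hv =>
    have h0 : ∀ (t : ℝ) (w : FockSpan m),
        inner ℂ (fockEmb u) (displacement (t • z) (fockEmb (creation j w))) =
        inner ℂ (fockEmb (annihilation j u)) (displacement (t • z) (fockEmb w)) -
          t * conj (z j) * inner ℂ (fockEmb u) (displacement (t • z) (fockEmb w)) := fun t w => by
      rw [inner_annihilation_left, Pi.smul_apply, Complex.real_smul, map_mul, Complex.conj_ofReal]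
      ring
    have h2 : generator z (creation j v) = creation j (generator z v) - conj (z j) • v := by
      rw [creation_generator]; abel
    rw [h2]
    simp only [map_sub, map_smul, inner_sub_right, inner_smul_right, h0]
    have h1 : HasDerivAt (fun t : ℝ => (t : ℂ) * conj (z j)) (conj (z j)) t := by
      simpa using ((hasDerivAt_id t).ofReal_comp).mul_const (conj (z j))
    convert! (hv (annihilation j u)).sub (h1.mul (hv u)) using 1
    ring

/-- Upgrades the weak derivative to a strong one: the identity is tested against the dense set of
Fock combinations, and the right side is the integral of a norm-continuous function, so it can be
differentiated in norm. -/
lemma displacement_smul_sub (z : Fin m → ℂ) (v : FockSpan m) (t : ℝ) :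
    displacement (t • z) (fockEmb v) - fockEmb v =
      ∫ s in (0 : ℝ)..t, displacement (s • z) (fockEmb (generator z v)) := by
  have hc : ∀ f : Modes m, Continuous fun s : ℝ => displacement (s • z) f := fun f =>
    (continuous_displacement f).comp (by fun_prop)
  have h : ∀ u, inner ℂ (fockEmb u) (displacement (t • z) (fockEmb v) - fockEmb v) =
      inner ℂ (fockEmb u) (∫ s in (0 : ℝ)..t, displacement (s • z) (fockEmb (generator z v))) :=
    fun u => by
    have h1 := intervalIntegral.integral_eq_sub_of_hasDerivAt (a := 0) (b := t)
      (fun s _ => hasDerivAt_inner_displacement z u v s)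
      (((continuous_const.inner (hc (fockEmb (generator z v))))).intervalIntegrable _ _)
    rw [zero_smul, displacement_zero, ← inner_sub_right] at h1
    rw [← h1]
    exact (innerSL ℂ (fockEmb u)).intervalIntegral_comp_comm ((hc _).intervalIntegrable _ _)
  refine dense_range_fockEmb.eq_of_inner_right (𝕜 := ℂ) h

lemma hasDerivAt_displacement (z : Fin m → ℂ) (v : FockSpan m) :
    HasDerivAt (fun t : ℝ => displacement (t • z) (fockEmb v)) (fockEmb (generator z v)) 0 := by
  have hc : Continuous fun s : ℝ => displacement (s • z) (fockEmb (generator z v)) :=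
    (continuous_displacement _).comp (by fun_prop)
  have h := (intervalIntegral.integral_hasDerivAt_right (hc.intervalIntegrable 0 0)
    (hc.stronglyMeasurableAtFilter _ _) hc.continuousAt).add_const (fockEmb v)
  rw [zero_smul, displacement_zero] at h
  refine h.congr_of_eventuallyEq (Filter.Eventually.of_forall fun t => ?_)
  simp only
  rw [← displacement_smul_sub, sub_add_cancel]

end Bosonic
end

noncomputable section

namespace Bosonic

variable {m : ℕ}

/-! ### Weighted norms -/

/-- `k₁ + ⋯ + kₘ + 1`. -/
def degreeWeight (k : Fin m → ℕ) : ℝ≥0∞ := ((∑ j, k j + 1 : ℕ) : ℝ≥0∞)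

/-- `∑ₖ (k₁ + ⋯ + kₘ + 1)^d |⟨bₖ, ψ⟩|²`. -/
def basisMoment (b : (Fin m → ℕ) → Modes m) (d : ℕ) (ψ : Modes m) : ℝ≥0∞ :=
  ∑' k, degreeWeight k ^ d * ‖inner ℂ (b k) ψ‖ₑ ^ 2

lemma one_le_degreeWeight (k : Fin m → ℕ) : 1 ≤ degreeWeight k := by
  rw [degreeWeight]; exact_mod_cast Nat.succ_le_succ (Nat.zero_le _)

lemma degreeWeight_ne_top (k : Fin m → ℕ) : degreeWeight k ≠ ⊤ := ENNReal.natCast_ne_top _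

lemma degreeWeight_add_single (k : Fin m → ℕ) (j : Fin m) :
    degreeWeight (k + Pi.single j 1) = degreeWeight k + 1 := by
  simp only [degreeWeight, Pi.add_apply, Finset.sum_add_distrib, Finset.sum_pi_single',
    Finset.mem_univ, if_true]
  push_cast; rfl

lemma degreeWeight_add_single_le (k : Fin m → ℕ) (j : Fin m) :
    degreeWeight (k + Pi.single j 1) ≤ 2 * degreeWeight k := by
  rw [degreeWeight_add_single, two_mul]
  gcongr
  exact one_le_degreeWeight k

lemma le_degreeWeight (k : Fin m → ℕ) (j : Fin m) : (k j : ℝ≥0∞) + 1 ≤ degreeWeight k := by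
  rw [degreeWeight]
  exact_mod_cast Nat.succ_le_succ (Finset.single_le_sum (fun _ _ => Nat.zero_le _)
    (Finset.mem_univ j))

lemma degreeWeight_eq_sum (k : Fin m → ℕ) : degreeWeight k = 1 + ∑ j, (k j : ℝ≥0∞) := by
  rw [degreeWeight]; push_cast; rw [add_comm]

lemma basisMoment_mono (b : (Fin m → ℕ) → Modes m) {d d' : ℕ} (h : d ≤ d') (ψ : Modes m) :
    basisMoment b d ψ ≤ basisMoment b d' ψ := by
  refine ENNReal.tsum_le_tsum fun k => ?_
  gcongr
  exact one_le_degreeWeight k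

lemma basisMoment_smul (b : (Fin m → ℕ) → Modes m) (d : ℕ) (c : ℂ) (ψ : Modes m) :
    basisMoment b d (c • ψ) = ‖c‖ₑ ^ 2 * basisMoment b d ψ := by
  rw [basisMoment, basisMoment, ← ENNReal.tsum_mul_left]
  congr 1; ext k
  rw [inner_smul_right, enorm_mul]; ring

lemma basisMoment_add_le (b : (Fin m → ℕ) → Modes m) (d : ℕ) (φ ψ : Modes m) :
    basisMoment b d (φ + ψ) ≤ 2 * (basisMoment b d φ + basisMoment b d ψ) := by
  rw [basisMoment, basisMoment, basisMoment, ← ENNReal.tsum_add, ← ENNReal.tsum_mul_left]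
  refine ENNReal.tsum_le_tsum fun k => ?_
  rw [inner_add_right, ← mul_add, mul_left_comm]
  gcongr
  exact (pow_le_pow_left' (enorm_add_le _ _) 2).trans (ENNReal_add_sq_le _ _)

lemma tsum_shift_of_eq_zero {M : Type*} [AddCommMonoid M] [TopologicalSpace M] [T2Space M]
    (j : Fin m) (f : (Fin m → ℕ) → M) (hf : ∀ k, k j = 0 → f k = 0) :
    ∑' k, f k = ∑' k, f (k + (Pi.single j 1 : Fin m → ℕ)) := by
  have hi : Function.Injective fun k : Fin m → ℕ => k + (Pi.single j 1 : Fin m → ℕ) := add_left_injective _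
  refine (hi.tsum_eq fun k hk => ?_).symm
  have : k j ≠ 0 := fun h => hk (hf k h)
  exact ⟨k - Pi.single j 1, multiIndex_sub_add this⟩

/-- A linear map on finite combinations of Fock states that loses at most `r` powers of the
weight. -/
def IsLadderBounded (A : FockSpan m →ₗ[ℂ] FockSpan m) (r : ℕ) : Prop :=
  ∀ d : ℕ, ∃ C : ℝ≥0∞, C ≠ ⊤ ∧ ∀ v,
    basisMoment fock d (fockEmb (A v)) ≤ C * basisMoment fock (d + r) (fockEmb v)

lemma IsLadderBounded.mono {A : FockSpan m →ₗ[ℂ] FockSpan m} {r s : ℕ} (hA : IsLadderBounded A r)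
    (h : r ≤ s) : IsLadderBounded A s := fun d => by
  obtain ⟨C, hC, h1⟩ := hA d
  exact ⟨C, hC, fun v => (h1 v).trans (by gcongr; exact basisMoment_mono _ (by omega) _)⟩

lemma IsLadderBounded.add {A B : FockSpan m →ₗ[ℂ] FockSpan m} {r : ℕ} (hA : IsLadderBounded A r)
    (hB : IsLadderBounded B r) : IsLadderBounded (A + B) r := fun d => by
  obtain ⟨C, hC, h1⟩ := hA d
  obtain ⟨C', hC', h2⟩ := hB d
  refine ⟨2 * (C + C'), ENNReal.mul_ne_top (by simp) (ENNReal.add_ne_top.2 ⟨hC, hC'⟩), fun v => ?_⟩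
  rw [LinearMap.add_apply, map_add]
  refine (basisMoment_add_le _ _ _ _).trans ?_
  rw [mul_assoc, add_mul]
  gcongr
  exacts [h1 v, h2 v]

lemma IsLadderBounded.smul {A : FockSpan m →ₗ[ℂ] FockSpan m} {r : ℕ} (hA : IsLadderBounded A r)
    (c : ℂ) : IsLadderBounded (c • A) r := fun d => by
  obtain ⟨C, hC, h1⟩ := hA d
  refine ⟨‖c‖ₑ ^ 2 * C, ENNReal.mul_ne_top (by simp) hC, fun v => ?_⟩
  rw [LinearMap.smul_apply, map_smul, basisMoment_smul, mul_assoc]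
  gcongr
  exact h1 v

lemma IsLadderBounded.comp {A B : FockSpan m →ₗ[ℂ] FockSpan m} {r s : ℕ} (hA : IsLadderBounded A r)
    (hB : IsLadderBounded B s) : IsLadderBounded (A ∘ₗ B) (r + s) := fun d => by
  obtain ⟨C, hC, h1⟩ := hA d
  obtain ⟨C', hC', h2⟩ := hB (d + r)
  refine ⟨C * C', ENNReal.mul_ne_top hC hC', fun v => ?_⟩
  rw [LinearMap.comp_apply, ← add_assoc, mul_assoc]
  refine (h1 _).trans ?_
  gcongr
  exact h2 v

lemma isLadderBounded_zero (r : ℕ) : IsLadderBounded (0 : FockSpan m →ₗ[ℂ] FockSpan m) r :=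
  fun d => ⟨0, by simp, fun v => by simp [basisMoment]⟩

lemma isLadderBounded_id : IsLadderBounded (LinearMap.id : FockSpan m →ₗ[ℂ] FockSpan m) 0 :=
  fun d => ⟨1, by simp, fun v => by simp⟩

lemma isLadderBounded_sum {ι : Type*} (s : Finset ι) (A : ι → FockSpan m →ₗ[ℂ] FockSpan m) {r : ℕ}
    (h : ∀ i, IsLadderBounded (A i) r) : IsLadderBounded (∑ i ∈ s, A i) r := by
  classical
  induction s using Finset.induction_on with
  | empty => simpa using isLadderBounded_zero r
  | insert i s hi ih =>
    rw [Finset.sum_insert hi]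
    exact (h i).add ih

lemma enorm_sqrt_sq (n : ℕ) : ‖((√(n : ℝ) : ℝ) : ℂ)‖ₑ ^ 2 = n := by
  rw [← ofReal_norm, Complex.norm_real, Real.norm_of_nonneg (Real.sqrt_nonneg _),
    ← ENNReal.ofReal_pow (Real.sqrt_nonneg _), Real.sq_sqrt (by positivity)]
  simp

lemma enorm_sqrt_sq' (n : ℕ) : ‖((√((n : ℝ) + 1) : ℝ) : ℂ)‖ₑ ^ 2 = n + 1 := by
  have := enorm_sqrt_sq (n + 1)
  push_cast at this
  exact this

lemma fock_creation_coeff (k : Fin m → ℕ) (j : Fin m) (v : FockSpan m) :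
    creation j v (k + Pi.single j 1) = √((k j : ℝ) + 1) * v k := by
  classical
  induction v using Finsupp.induction_linear with
  | zero => simp
  | add u v hu hv => rw [map_add (creation j), Finsupp.add_apply, hu, hv, Finsupp.add_apply, mul_add]
  | single l c =>
    rw [creation_single, Finsupp.single_apply, Finsupp.single_apply]
    by_cases h : l = k
    · subst h; simp [mul_comm]
    · rw [if_neg h, if_neg, mul_zero]
      exact fun h' => h (add_left_injective _ h')

lemma fock_creation_coeff_zero (k : Fin m → ℕ) (j : Fin m) (hk : k j = 0) (v : FockSpan m) :
    creation j v k = 0 := by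
  classical
  induction v using Finsupp.induction_linear with
  | zero => simp
  | add u v hu hv => rw [map_add, Finsupp.add_apply, hu, hv, add_zero]
  | single l c =>
    rw [creation_single, Finsupp.single_apply, if_neg]
    rintro rfl
    simp at hk

lemma fock_annihilation_coeff (k : Fin m → ℕ) (j : Fin m) (v : FockSpan m) :
    annihilation j v k = √((k j : ℝ) + 1) * v (k + Pi.single j 1) := by
  classical
  induction v using Finsupp.induction_linear with
  | zero => simp
  | add u v hu hv => rw [map_add (annihilation j), Finsupp.add_apply, hu, hv, Finsupp.add_apply, mul_add]
  | single l c =>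
    rw [annihilation_single, Finsupp.single_apply, Finsupp.single_apply]
    by_cases h : l = k + Pi.single j 1
    · subst h
      rw [multiIndex_add_sub, if_pos rfl, if_pos rfl]
      simp [mul_comm]
    · rw [if_neg h, mul_zero]
      split_ifs with h'
      · by_cases hl : l j = 0
        · simp [hl]
        · exact absurd (by rw [← h', multiIndex_sub_add hl]) h
      · rfl

lemma isLadderBounded_annihilation (j : Fin m) : IsLadderBounded (annihilation j) 1 := fun d => by
  refine ⟨1, by simp, fun v => ?_⟩
  rw [one_mul, basisMoment, basisMoment]
  refine le_trans ?_ (ENNReal.tsum_comp_le_tsum_of_injective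
    (add_left_injective (Pi.single j 1 : Fin m → ℕ)) _)
  refine ENNReal.tsum_le_tsum fun k => ?_
  rw [inner_fock_fockEmb, inner_fock_fockEmb, fock_annihilation_coeff, enorm_mul, mul_pow,
    enorm_sqrt_sq', ← mul_assoc, pow_succ (degreeWeight (k + Pi.single j 1))]
  gcongr
  · rw [degreeWeight_add_single]; exact le_self_add (a := degreeWeight k)
  · exact (le_degreeWeight k j).trans
      (by rw [degreeWeight_add_single]; exact le_self_add (a := degreeWeight k))

lemma isLadderBounded_creation (j : Fin m) : IsLadderBounded (creation j) 1 := fun d => by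
  refine ⟨2 ^ d, by simp, fun v => ?_⟩
  rw [basisMoment, basisMoment, tsum_shift_of_eq_zero j, ← ENNReal.tsum_mul_left]
  · refine ENNReal.tsum_le_tsum fun k => ?_
    rw [inner_fock_fockEmb, inner_fock_fockEmb, fock_creation_coeff, enorm_mul, mul_pow,
      enorm_sqrt_sq', ← mul_assoc, pow_succ (degreeWeight k), ← mul_assoc, ← mul_assoc, ← mul_pow]
    gcongr
    · exact degreeWeight_add_single_le k j
    · exact le_degreeWeight k j
  · intro k hk
    rw [inner_fock_fockEmb, fock_creation_coeff_zero k j hk]; simp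

lemma isLadderBounded_generator (z : Fin m → ℂ) : IsLadderBounded (generator z) 1 := by
  refine isLadderBounded_sum _ _ fun j => ?_
  have h : z j • creation j - conj (z j) • annihilation j =
      z j • creation j + (-conj (z j)) • annihilation j := by module
  rw [h]
  exact ((isLadderBounded_creation j).smul _).add ((isLadderBounded_annihilation j).smul _)

/-! ### Comparison of the moments in two Fock bases -/

section Comparison

variable {S : (Fin m → ℂ) →ₗ[ℝ] (Fin m → ℂ)} {U : Modes m ≃ₗᵢ[ℂ] Modes m}

/-- Differentiate at `t = 0` the two expressions `⟨U u, D_{tSz} v⟩ = ⟨U D_{-tz} u, v⟩`. -/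
lemma inner_unitary_generator (hU : ∀ z f, U (displacement z f) = displacement (S z) (U f))
    (z : Fin m → ℂ) (u v : FockSpan m) :
    inner ℂ (U (fockEmb (generator z u))) (fockEmb v) =
      -inner ℂ (U (fockEmb u)) (fockEmb (generator (S z) v)) := by
  have h1 : HasDerivAt (fun t : ℝ => inner ℂ (U (fockEmb u)) (displacement (t • S z) (fockEmb v)))
      (inner ℂ (U (fockEmb u)) (fockEmb (generator (S z) v))) 0 := by
    have := (hasDerivAt_displacement (S z) v)
    simpa using (hasDerivAt_const (0 : ℝ) (U (fockEmb u))).inner ℂ this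
  have h2 : HasDerivAt (fun t : ℝ => inner ℂ (U (displacement (t • -z) (fockEmb u))) (fockEmb v))
      (inner ℂ (U (fockEmb (generator (-z) u))) (fockEmb v)) 0 := by
    have h3 := hasDerivAt_displacement (-z) u
    have h4 : HasDerivAt (fun t : ℝ => U (displacement (t • -z) (fockEmb u)))
        (U (fockEmb (generator (-z) u))) 0 :=
      ((U : Modes m →L[ℂ] Modes m).restrictScalars ℝ).hasFDerivAt.comp_hasDerivAt _ h3
    simpa using h4.inner ℂ (hasDerivAt_const (0 : ℝ) (fockEmb v))
  have h3 : (fun t : ℝ => inner ℂ (U (fockEmb u)) (displacement (t • S z) (fockEmb v))) =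
      fun t : ℝ => inner ℂ (U (displacement (t • -z) (fockEmb u))) (fockEmb v) := by
    ext t
    rw [hU, inner_displacement_left, map_smul, map_neg, smul_neg, neg_neg]
  rw [h3] at h1
  have h4 := h2.unique h1
  have h5 : generator (-z) u = -generator z u := by
    rw [generator_apply, generator_apply, ← Finset.sum_neg_distrib]
    refine Finset.sum_congr rfl fun j _ => ?_
    rw [Pi.neg_apply, map_neg]
    module
  rw [h5, map_neg, map_neg, inner_neg_left] at h4
  rw [← h4, neg_neg]

/-- The annihilation operator `bⱼ` of the Weyl system `z ↦ D_{S z}`. -/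
def transformedAnnihilation (S : (Fin m → ℂ) →ₗ[ℝ] (Fin m → ℂ)) (j : Fin m) :
    FockSpan m →ₗ[ℂ] FockSpan m :=
  (-(1 / 2 : ℂ)) • (generator (S (Pi.single j 1)) +
    Complex.I • generator (S (Pi.single j Complex.I)))

lemma creation_eq_generator (j : Fin m) (u : FockSpan m) :
    creation j u = (1 / 2 : ℂ) • (generator (Pi.single j 1) u -
      Complex.I • generator (Pi.single j Complex.I) u) := by
  have h : ∀ c : ℂ, generator (Pi.single j c) u = c • creation j u - conj c • annihilation j u :=
    fun c => by
    rw [generator_apply, Finset.sum_eq_single j]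
    · simp
    · intro i _ hij; simp [hij]
    · simp
  rw [h, h, Complex.conj_I, map_one]
  match_scalars <;> linear_combination (1 / 2 : ℂ) * Complex.I_sq

/-- `U a_j† U†` has formal adjoint `b_j`. The creation operator is recovered from the generators in
the directions `e_j` and `i e_j`, each of which `U` carries to a generator and hence to an operator
linear in the ladder operators. -/
lemma inner_unitary_creation (hU : ∀ z f, U (displacement z f) = displacement (S z) (U f))
    (j : Fin m) (u v : FockSpan m) :
    inner ℂ (U (fockEmb (creation j u))) (fockEmb v) =
      inner ℂ (U (fockEmb u)) (fockEmb (transformedAnnihilation S j v)) := by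
  rw [creation_eq_generator]
  simp only [map_smul, map_sub, inner_smul_left, inner_sub_left, inner_unitary_generator hU,
    transformedAnnihilation, LinearMap.smul_apply, LinearMap.add_apply, map_add, inner_smul_right,
    inner_add_right, Complex.conj_I]
  simp only [map_div₀, map_one, Complex.conj_ofNat]
  ring

lemma isLadderBounded_transformedAnnihilation (j : Fin m) :
    IsLadderBounded (transformedAnnihilation S j) 1 :=
  ((isLadderBounded_generator _).add ((isLadderBounded_generator _).smul _)).smul _

/-- One factor of the weight is `1 + ∑ k_j`, and `k_j |⟨U k, v⟩|² = |⟨U (k - e_j), b_j v⟩|²`.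
Shifting the index by `e_j` at most doubles the weight, whence `2 ^ d`. -/
lemma basisMoment_unitary_succ_le (hU : ∀ z f, U (displacement z f) = displacement (S z) (U f))
    (d : ℕ) (v : FockSpan m) :
    basisMoment (fun k => U (fock k)) (d + 1) (fockEmb v) ≤
      basisMoment (fun k => U (fock k)) d (fockEmb v) +
        ∑ j, 2 ^ d * basisMoment (fun k => U (fock k)) d
          (fockEmb (transformedAnnihilation S j v)) := by
  have h1 : basisMoment (fun k => U (fock k)) (d + 1) (fockEmb v) =
      basisMoment (fun k => U (fock k)) d (fockEmb v) +
        ∑ j, ∑' k : Fin m → ℕ, degreeWeight k ^ d * k j *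
          ‖inner ℂ (U (fock k)) (fockEmb v)‖ₑ ^ 2 := by
    rw [basisMoment, basisMoment, ← Summable.tsum_finsetSum fun _ _ => ENNReal.summable,
      ← ENNReal.tsum_add]
    congr 1; ext k
    rw [← Finset.sum_mul, ← Finset.mul_sum, ← add_mul, pow_succ]
    congr 1
    conv_lhs => rw [degreeWeight_eq_sum k, ← degreeWeight_eq_sum k]
    nth_rewrite 2 [degreeWeight_eq_sum k]
    rw [mul_add, mul_one]
  rw [h1]
  gcongr with j hj
  rw [tsum_shift_of_eq_zero j _ fun k hk => by simp [hk], basisMoment, ← ENNReal.tsum_mul_left]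
  refine ENNReal.tsum_le_tsum fun k => ?_
  have h2 := inner_unitary_creation hU j (Finsupp.single k 1) v
  rw [creation_single, fockEmb_single, fockEmb_single, one_mul, one_smul, map_smul,
    inner_smul_left, Complex.conj_ofReal] at h2
  rw [← h2, enorm_mul, mul_pow, enorm_sqrt_sq', ← mul_assoc, ← mul_assoc, ← mul_pow]
  gcongr
  · exact degreeWeight_add_single_le k j
  · simp

/-- The Fock basis with respect to `bⱼ`. -/
def unitaryBasis (U : Modes m ≃ₗᵢ[ℂ] Modes m) : HilbertBasis (Fin m → ℕ) ℂ (Modes m) :=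
  HilbertBasis.ofRepr (U.symm.trans (fockBasis m).repr)

@[simp]
lemma unitaryBasis_apply (k : Fin m → ℕ) : unitaryBasis U k = U (fock k) := by
  rw [unitaryBasis, ← fockBasis_apply, ← HilbertBasis.repr_symm_single,
    ← HilbertBasis.repr_symm_single]
  rfl

/-- Induction on `d`. At `d = 0` both sides are `‖v‖²`. Each step trades one power of the new weight
for some `b_j`, which costs one power of the old weight. -/
lemma exists_basisMoment_unitary_fockEmb_le
    (hU : ∀ z f, U (displacement z f) = displacement (S z) (U f)) (d : ℕ) :
    ∃ C : ℝ≥0∞, C ≠ ⊤ ∧ ∀ v : FockSpan m,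
      basisMoment (fun k => U (fock k)) d (fockEmb v) ≤ C * basisMoment fock d (fockEmb v) := by
  induction d with
  | zero =>
    refine ⟨1, by simp, fun v => ?_⟩
    have h1 := enorm_sq_eq_tsum (unitaryBasis U) (fockEmb v)
    have h2 := enorm_sq_eq_tsum (fockBasis m) (fockEmb v)
    simp only [unitaryBasis_apply, fockBasis_apply] at h1 h2
    simp only [basisMoment, pow_zero, one_mul]
    rw [← h1, ← h2]
  | succ d ih =>
    obtain ⟨C, hC, h⟩ := ih
    have hb := fun j => isLadderBounded_transformedAnnihilation (S := S) j d
    choose B hB h' using hb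
    refine ⟨C + ∑ j, 2 ^ d * (C * B j), ?_, fun v => ?_⟩
    · refine ENNReal.add_ne_top.2 ⟨hC, ENNReal.sum_ne_top.2 fun j _ => ?_⟩
      exact ENNReal.mul_ne_top (by simp) (ENNReal.mul_ne_top hC (hB j))
    · refine (basisMoment_unitary_succ_le hU d v).trans ?_
      rw [add_mul, Finset.sum_mul]
      refine add_le_add ?_ (Finset.sum_le_sum fun j _ => ?_)
      · refine (h v).trans ?_
        gcongr
        exact basisMoment_mono _ (Nat.le_succ d) _
      · rw [mul_assoc, mul_assoc]
        exact mul_le_mul_right ((h _).trans (mul_le_mul_right (h' j v) C)) (2 ^ d)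

/-- Truncating the Fock expansion of `ψ` does not increase its Fock moments, and every finite
partial sum on the left is continuous in the vector, so the bound passes to the limit. -/
lemma exists_basisMoment_unitary_le
    (hU : ∀ z f, U (displacement z f) = displacement (S z) (U f)) (d : ℕ) :
    ∃ C : ℝ≥0∞, C ≠ ⊤ ∧ ∀ ψ : Modes m,
      basisMoment (fun k => U (fock k)) d ψ ≤ C * basisMoment fock d ψ := by
  classical
  obtain ⟨C, hC, h⟩ := exists_basisMoment_unitary_fockEmb_le hU d
  refine ⟨C, hC, fun ψ => ?_⟩
  let v : Finset (Fin m → ℕ) → FockSpan m := fun s =>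
    ∑ k ∈ s, Finsupp.single k (inner ℂ (fock k) ψ)
  have hv : ∀ s k, v s k = if k ∈ s then inner ℂ (fock k) ψ else 0 := fun s k => by
    simp only [v, Finsupp.finsetSum_apply, Finsupp.single_apply]
    rw [Finset.sum_ite_eq']
  have hlim : Filter.Tendsto (fun s => fockEmb (v s)) Filter.atTop (nhds ψ) := by
    have h1 := (fockBasis m).hasSum_repr ψ
    refine Filter.Tendsto.congr (fun s => ?_) h1
    simp only [v, map_sum, fockEmb_single, (fockBasis m).repr_apply_apply, fockBasis_apply]
  have hle : ∀ s, basisMoment fock d (fockEmb (v s)) ≤ basisMoment fock d ψ := fun s => by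
    refine ENNReal.tsum_le_tsum fun k => ?_
    rw [inner_fock_fockEmb, hv]
    split_ifs
    · exact le_rfl
    · simp
  rw [basisMoment, ENNReal.tsum_eq_iSup_sum]
  refine iSup_le fun F => ?_
  have hcont : Filter.Tendsto (fun s => ∑ k ∈ F, degreeWeight k ^ d *
      ‖inner ℂ (U (fock k)) (fockEmb (v s))‖ₑ ^ 2) Filter.atTop
      (nhds (∑ k ∈ F, degreeWeight k ^ d * ‖inner ℂ (U (fock k)) ψ‖ₑ ^ 2)) := by
    refine tendsto_finsetSum _ fun k _ => ?_
    refine ENNReal.Tendsto.const_mul ?_ (Or.inr (ENNReal.pow_ne_top (degreeWeight_ne_top k)))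
    exact ENNReal.Tendsto.pow ((tendsto_const_nhds.inner hlim).enorm)
  refine le_of_tendsto' hcont fun s => ?_
  refine (ENNReal.sum_le_tsum F).trans ((h (v s)).trans ?_)
  gcongr
  exact hle s

end Comparison

end Bosonic
end

noncomputable section

namespace Bosonic

variable {m : ℕ}

/-! ### Thermal states -/

lemma isSelfAdjoint_of_diagonal {H ι : Type*} [NormedAddCommGroup H] [InnerProductSpace ℂ H]
    [CompleteSpace H] (b : HilbertBasis ι ℂ H) {A : H →L[ℂ] H} (c : ι → ℝ)
    (h : ∀ k, A (b k) = (c k : ℂ) • b k) : IsSelfAdjoint A := by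
  classical
  rw [ContinuousLinearMap.isSelfAdjoint_iff']
  refine ContinuousLinearMap.ext_on
    (Submodule.dense_iff_topologicalClosure_eq_top.2 b.dense_span) ?_
  rintro _ ⟨k, rfl⟩
  refine b.repr.injective ?_
  ext l
  rw [HilbertBasis.repr_apply_apply, HilbertBasis.repr_apply_apply,
    ContinuousLinearMap.adjoint_inner_right, h, h, inner_smul_left, inner_smul_right,
    Complex.conj_ofReal, orthonormal_iff_ite.1 b.orthonormal]
  split_ifs with hl
  · rw [hl]
  · simp

section Thermal

variable {β : Fin m → ℝ}

lemma exp_neg_mem (hβ : ∀ j, 0 < β j) (j : Fin m) : 0 < Real.exp (-β j) ∧ Real.exp (-β j) < 1 :=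
  ⟨Real.exp_pos _, by rw [← Real.exp_zero]; exact Real.exp_lt_exp.2 (by linarith [hβ j])⟩

lemma thermalWeight_pos (hβ : ∀ j, 0 < β j) (k : Fin m → ℕ) : 0 < thermalWeight β k :=
  Finset.prod_pos fun j _ => mul_pos (by linarith [(exp_neg_mem hβ j).2]) (Real.exp_pos _)

lemma thermalWeight_add_single (k : Fin m → ℕ) (j : Fin m) :
    thermalWeight β (k + Pi.single j 1) = Real.exp (-β j) * thermalWeight β k := by
  have h : ∀ l : Fin m → ℕ, thermalWeight β l =
      (∏ i, (1 - Real.exp (-β i))) * Real.exp (∑ i, -β i * l i) := fun l => by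
    rw [thermalWeight, Finset.prod_mul_distrib, Real.exp_sum]
  rw [h, h, mul_left_comm, ← Real.exp_add]
  congr 2
  simp only [Pi.add_apply, Nat.cast_add, mul_add, Finset.sum_add_distrib]
  rw [add_comm]
  congr 1
  rw [Finset.sum_eq_single j]
  · simp
  · intro i _ hij; simp [hij]
  · simp

lemma hasSum_thermalWeight (hβ : ∀ j, 0 < β j) : HasSum (thermalWeight β) 1 := by
  have h1 : ∀ j, HasSum (fun n : ℕ => (1 - Real.exp (-β j)) * Real.exp (-β j * n)) 1 := fun j => by
    have h := (hasSum_geometric_of_lt_one (exp_neg_mem hβ j).1.le (exp_neg_mem hβ j).2).mul_left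
      (1 - Real.exp (-β j))
    rw [mul_inv_cancel₀ (by linarith [(exp_neg_mem hβ j).2])] at h
    refine h.congr_fun fun n => ?_
    rw [mul_comm (-β j), Real.exp_nat_mul]
  have h2 := hasSum_pi_prod (fun j n => mul_nonneg (by linarith [(exp_neg_mem hβ j).2])
    (Real.exp_pos _).le) h1
  rwa [Finset.prod_const_one] at h2

lemma thermalWeight_le_one (hβ : ∀ j, 0 < β j) (k : Fin m → ℕ) : thermalWeight β k ≤ 1 :=
  le_hasSum (hasSum_thermalWeight hβ) k fun l _ => (thermalWeight_pos hβ l).le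

lemma sum_add_one_le_prod (k : Fin m → ℕ) : ∑ j, k j + 1 ≤ ∏ j, (k j + 1) := by
  have h : ∀ s : Finset (Fin m), ∑ j ∈ s, k j + 1 ≤ ∏ j ∈ s, (k j + 1) := fun s => by
    induction s using Finset.induction_on with
    | empty => simp
    | insert i s hi ih =>
      rw [Finset.sum_insert hi, Finset.prod_insert hi]
      nlinarith [Nat.zero_le (k i), Nat.zero_le (∑ j ∈ s, k j)]
  exact h _

/-- Bounding the degree plus one by `∏ (k_j + 1)` reduces the sum to a product of one-mode series of
polynomial times geometric terms. -/
lemma summable_thermalWeight_mul_pow (hβ : ∀ j, 0 < β j) (n : ℕ) :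
    Summable fun k => thermalWeight β k * (((∑ j, k j : ℕ) : ℝ) + 1) ^ n := by
  have h1 : ∀ j, Summable fun l : ℕ =>
      (1 - Real.exp (-β j)) * Real.exp (-β j * l) * ((l : ℝ) + 1) ^ n := fun j => by
    have h := (summable_nat_add_iff 1).2 (summable_pow_mul_geometric_of_norm_lt_one n
      (r := Real.exp (-β j))
      (by rw [Real.norm_of_nonneg (Real.exp_pos _).le]; exact (exp_neg_mem hβ j).2))
    refine (h.mul_left ((1 - Real.exp (-β j)) * (Real.exp (-β j))⁻¹)).congr fun l => ?_
    have h2 : Real.exp (-β j) ≠ 0 := (Real.exp_pos _).ne'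
    rw [mul_comm (-β j), Real.exp_nat_mul, pow_succ]
    push_cast
    field_simp
  have h2 := (hasSum_pi_prod (fun j l => by
    have := (exp_neg_mem hβ j).2
    have : 0 ≤ 1 - Real.exp (-β j) := by linarith
    positivity) fun j => (h1 j).hasSum).summable
  refine Summable.of_nonneg_of_le (fun k => ?_) (fun k => ?_) h2
  · have := thermalWeight_pos hβ k
    positivity
  · rw [Finset.prod_mul_distrib, ← thermalWeight, Finset.prod_pow]
    have := thermalWeight_pos hβ k
    gcongr
    exact_mod_cast sum_add_one_le_prod k

/-- `tr (τ D_z A)` for the thermal state `τ`, for an operator `A` on Fock combinations. -/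
def thermalTrace (β : Fin m → ℝ) (A : FockSpan m →ₗ[ℂ] FockSpan m) (z : Fin m → ℂ) : ℂ :=
  ∑' k : Fin m → ℕ, thermalWeight β k *
    inner ℂ (fock k) (displacement z (fockEmb (A (Finsupp.single k 1))))

lemma IsLadderBounded.exists_norm_sq_le {A : FockSpan m →ₗ[ℂ] FockSpan m} {r : ℕ}
    (hA : IsLadderBounded A r) : ∃ C : ℝ, 0 ≤ C ∧ ∀ k,
      ‖fockEmb (A (Finsupp.single k 1))‖ ^ 2 ≤ C * (((∑ j, k j : ℕ) : ℝ) + 1) ^ r := by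
  classical
  obtain ⟨C, hC, h⟩ := hA 0
  refine ⟨C.toReal, ENNReal.toReal_nonneg, fun k => ?_⟩
  have h1 := h (Finsupp.single k 1)
  have h2 : basisMoment fock 0 (fockEmb (A (Finsupp.single k 1))) =
      ‖fockEmb (A (Finsupp.single k 1))‖ₑ ^ 2 := by
    rw [enorm_sq_eq_tsum (fockBasis m)]
    simp [basisMoment]
  have h3 : basisMoment fock (0 + r) (fockEmb (Finsupp.single k 1)) = degreeWeight k ^ r := by
    rw [basisMoment, tsum_eq_single k]
    · rw [inner_fock_fockEmb, Finsupp.single_eq_same]; simp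
    · intro l hl
      rw [inner_fock_fockEmb, Finsupp.single_eq_of_ne hl]
      simp
  rw [h2, h3] at h1
  have h4 := ENNReal.toReal_mono (ENNReal.mul_ne_top hC (ENNReal.pow_ne_top (degreeWeight_ne_top k)))
    h1
  rw [ENNReal.toReal_mul, ENNReal.toReal_pow, ENNReal.toReal_pow, toReal_enorm, degreeWeight,
    ENNReal.toReal_natCast] at h4
  exact_mod_cast h4

lemma summable_thermalWeight_mul_norm_sq (hβ : ∀ j, 0 < β j) {A : FockSpan m →ₗ[ℂ] FockSpan m}
    {r : ℕ} (hA : IsLadderBounded A r) :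
    Summable fun k => thermalWeight β k * ‖fockEmb (A (Finsupp.single k 1))‖ ^ 2 := by
  obtain ⟨C, hC, h⟩ := hA.exists_norm_sq_le
  refine Summable.of_nonneg_of_le (fun k => ?_) (fun k => ?_)
    ((summable_thermalWeight_mul_pow hβ r).mul_left C)
  · have := thermalWeight_pos hβ k
    positivity
  · rw [mul_left_comm]
    exact mul_le_mul_of_nonneg_left (h k) (thermalWeight_pos hβ k).le

lemma summable_thermalWeight_mul_norm (hβ : ∀ j, 0 < β j) {A : FockSpan m →ₗ[ℂ] FockSpan m}
    {r : ℕ} (hA : IsLadderBounded A r) :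
    Summable fun k => thermalWeight β k * ‖fockEmb (A (Finsupp.single k 1))‖ := by
  refine Summable.of_nonneg_of_le (fun k => ?_) (fun k => ?_)
    ((summable_thermalWeight_mul_norm_sq hβ hA).add (hasSum_thermalWeight hβ).summable)
  · have := thermalWeight_pos hβ k
    positivity
  · have := thermalWeight_pos hβ k
    nlinarith [sq_nonneg (‖fockEmb (A (Finsupp.single k 1))‖ - 1),
      norm_nonneg (fockEmb (A (Finsupp.single k 1)))]

lemma norm_thermalTrace_term_le (hβ : ∀ j, 0 < β j) (A : FockSpan m →ₗ[ℂ] FockSpan m)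
    (z : Fin m → ℂ) (k : Fin m → ℕ) :
    ‖(thermalWeight β k : ℂ) *
      inner ℂ (fock k) (displacement z (fockEmb (A (Finsupp.single k 1))))‖ ≤
      thermalWeight β k * ‖fockEmb (A (Finsupp.single k 1))‖ := by
  rw [norm_mul, Complex.norm_real, Real.norm_of_nonneg (thermalWeight_pos hβ k).le]
  refine mul_le_mul_of_nonneg_left ?_ (thermalWeight_pos hβ k).le
  refine (norm_inner_le_norm _ _).trans ?_
  rw [norm_fock, one_mul, norm_displacement]

lemma summable_thermalTrace (hβ : ∀ j, 0 < β j) {A : FockSpan m →ₗ[ℂ] FockSpan m}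
    {r : ℕ} (hA : IsLadderBounded A r) (z : Fin m → ℂ) :
    Summable fun k => (thermalWeight β k : ℂ) *
      inner ℂ (fock k) (displacement z (fockEmb (A (Finsupp.single k 1)))) :=
  Summable.of_norm_bounded (summable_thermalWeight_mul_norm hβ hA)
    (norm_thermalTrace_term_le hβ A z)

lemma thermalTrace_add (hβ : ∀ j, 0 < β j) {A B : FockSpan m →ₗ[ℂ] FockSpan m}
    {r s : ℕ} (hA : IsLadderBounded A r) (hB : IsLadderBounded B s) (z : Fin m → ℂ) :
    thermalTrace β (A + B) z = thermalTrace β A z + thermalTrace β B z := by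
  rw [thermalTrace, thermalTrace, thermalTrace,
    ← (summable_thermalTrace hβ hA z).tsum_add (summable_thermalTrace hβ hB z)]
  congr 1; ext k
  rw [LinearMap.add_apply, map_add, map_add, inner_add_right, mul_add]

lemma thermalTrace_smul (A : FockSpan m →ₗ[ℂ] FockSpan m) (c : ℂ) (z : Fin m → ℂ) :
    thermalTrace β (c • A) z = c * thermalTrace β A z := by
  rw [thermalTrace, thermalTrace, ← tsum_mul_left]
  congr 1; ext k
  rw [LinearMap.smul_apply, map_smul, map_smul, inner_smul_right, mul_left_comm]

lemma thermalTrace_sum (hβ : ∀ j, 0 < β j) {ι : Type*} (s : Finset ι)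
    {A : ι → FockSpan m →ₗ[ℂ] FockSpan m} {r : ℕ} (hA : ∀ i, IsLadderBounded (A i) r)
    (z : Fin m → ℂ) : thermalTrace β (∑ i ∈ s, A i) z = ∑ i ∈ s, thermalTrace β (A i) z := by
  classical
  induction s using Finset.induction_on with
  | empty => simp [thermalTrace]
  | insert i s hi ih =>
    rw [Finset.sum_insert hi, Finset.sum_insert hi,
      thermalTrace_add hβ (hA i) (isLadderBounded_sum s A hA), ih]

/-- Cyclicity with `a_j τ = e^{-β_j} τ a_j` (a KMS relation), followed by `a_j D_z = D_z (a_j +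
z_j)`. Concretely, the sum over `k` is shifted by `e_j`. -/
lemma thermalTrace_annihilation (hβ : ∀ j, 0 < β j) {A : FockSpan m →ₗ[ℂ] FockSpan m}
    {r : ℕ} (hA : IsLadderBounded A r) (j : Fin m) (z : Fin m → ℂ) :
    thermalTrace β (A ∘ₗ annihilation j) z = Real.exp (-β j) *
      (thermalTrace β (annihilation j ∘ₗ A) z + z j * thermalTrace β A z) := by
  have h1 := summable_thermalTrace hβ ((isLadderBounded_annihilation j).comp hA) z
  have h2 := summable_thermalTrace hβ hA z
  rw [thermalTrace, thermalTrace, thermalTrace, ← tsum_mul_left, ← h1.tsum_add (h2.mul_left _),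
    ← tsum_mul_left, tsum_shift_of_eq_zero j]
  · congr 1; ext k
    have h3 := inner_creation_left z j (Finsupp.single k 1) (A (Finsupp.single k 1))
    rw [creation_single, fockEmb_single, fockEmb_single, inner_smul_left, one_smul, one_mul,
      Complex.conj_ofReal] at h3
    rw [LinearMap.comp_apply, LinearMap.comp_apply, annihilation_single, multiIndex_add_sub,
      thermalWeight_add_single]
    have h4 : ∀ c : ℂ, Finsupp.single k c = c • Finsupp.single k (1 : ℂ) := fun c => by simp
    rw [h4, map_smul, map_smul, map_smul, inner_smul_right, mul_left_comm (z j), ← mul_add, ← h3]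
    simp only [Pi.add_apply, Pi.single_eq_same, Nat.cast_add, Nat.cast_one, Complex.ofReal_mul]
    ring
  · intro k hk
    simp [hk]

/-- The KMS relation for `a_j†`; here `τ a_j† = e^{-β_j} a_j† τ`, so the exponential stands on the
other side. -/
lemma thermalTrace_creation (hβ : ∀ j, 0 < β j) {A : FockSpan m →ₗ[ℂ] FockSpan m}
    {r : ℕ} (hA : IsLadderBounded A r) (j : Fin m) (z : Fin m → ℂ) :
    Real.exp (-β j) * thermalTrace β (A ∘ₗ creation j) z =
      thermalTrace β (creation j ∘ₗ A) z + conj (z j) * thermalTrace β A z := by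
  have h1 := summable_thermalTrace hβ ((isLadderBounded_creation j).comp hA) z
  have h2 := summable_thermalTrace hβ hA z
  rw [thermalTrace, thermalTrace, thermalTrace, ← tsum_mul_left, ← tsum_mul_left,
    ← h1.tsum_add (h2.mul_left _)]
  have h3 : ∀ k, (thermalWeight β k : ℂ) * inner ℂ (fock k) (displacement z
      (fockEmb ((creation j ∘ₗ A) (Finsupp.single k 1)))) + conj (z j) * (thermalWeight β k *
        inner ℂ (fock k) (displacement z (fockEmb (A (Finsupp.single k 1))))) =
      thermalWeight β k * ((√(k j : ℝ) : ℝ) * inner ℂ (fock (k - Pi.single j 1))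
        (displacement z (fockEmb (A (Finsupp.single k 1))))) := fun k => by
    have h3 := inner_annihilation_left z j (Finsupp.single k 1) (A (Finsupp.single k 1))
    rw [annihilation_single, fockEmb_single, fockEmb_single, inner_smul_left, one_smul, one_mul,
      Complex.conj_ofReal] at h3
    rw [h3, LinearMap.comp_apply]
    ring
  simp_rw [h3]
  symm
  rw [tsum_shift_of_eq_zero j]
  · congr 1; ext k
    rw [LinearMap.comp_apply, creation_single, multiIndex_add_sub, thermalWeight_add_single]
    have h4 : ∀ (l : Fin m → ℕ) (c : ℂ), Finsupp.single l c = c • Finsupp.single l (1 : ℂ) :=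
      fun l c => by simp
    rw [h4 _ (1 * _), map_smul, map_smul, map_smul, inner_smul_right]
    simp only [Pi.add_apply, Pi.single_eq_same, Nat.cast_add, Nat.cast_one, Complex.ofReal_mul]
    ring
  · intro k hk
    simp [hk]

/-- Multiplying the characteristic function of a thermal state by a polynomial amounts to
multiplying the state by a polynomial in the ladder operators. -/
lemma exists_thermalTrace_eq_evalPoly_mul (hβ : ∀ j, 0 < β j)
    (E : MvPolynomial (Fin m ⊕ Fin m) ℂ) :
    ∃ (A : FockSpan m →ₗ[ℂ] FockSpan m) (r : ℕ), IsLadderBounded A r ∧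
      ∀ z, thermalTrace β A z = evalPoly E z * thermalTrace β LinearMap.id z := by
  induction E using MvPolynomial.induction_on with
  | C c =>
    refine ⟨c • LinearMap.id, 0, isLadderBounded_id.smul c, fun z => ?_⟩
    rw [thermalTrace_smul, evalPoly, MvPolynomial.eval_C]
  | add p q hp hq =>
    obtain ⟨A, r, hA, h1⟩ := hp
    obtain ⟨B, s, hB, h2⟩ := hq
    refine ⟨A + B, max r s, (hA.mono (le_max_left _ _)).add (hB.mono (le_max_right _ _)),
      fun z => ?_⟩
    rw [thermalTrace_add hβ hA hB, h1, h2, evalPoly, evalPoly, evalPoly, map_add, add_mul]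
  | mul_X p i hp =>
    obtain ⟨A, r, hA, h1⟩ := hp
    cases i with
    | inl j =>
      have hx : (Real.exp (-β j) : ℂ) ≠ 0 := by exact_mod_cast (Real.exp_pos _).ne'
      -- Solving the KMS relation for `z_j tr(τ D_z A)` gives the operator `e^{β_j} A a_j - a_j A`;
      -- for `z̄_j` it is `e^{-β_j} A a_j† - a_j† A`.
      have hb1 := (hA.comp (isLadderBounded_annihilation j)).smul ((Real.exp (-β j) : ℂ)⁻¹)
      have hb2 := ((isLadderBounded_annihilation j).comp hA).smul (-1)
      refine ⟨(Real.exp (-β j) : ℂ)⁻¹ • (A ∘ₗ annihilation j) + (-1 : ℂ) • (annihilation j ∘ₗ A),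
        r + 1, hb1.add (by rwa [add_comm r]), fun z => ?_⟩
      rw [thermalTrace_add hβ hb1 hb2, thermalTrace_smul, thermalTrace_smul,
        thermalTrace_annihilation hβ hA, inv_mul_cancel_left₀ hx, evalPoly, map_mul,
        ← evalPoly, MvPolynomial.eval_X, Sum.elim_inl, mul_right_comm, ← h1]
      ring
    | inr j =>
      have hb1 := (hA.comp (isLadderBounded_creation j)).smul (Real.exp (-β j) : ℂ)
      have hb2 := ((isLadderBounded_creation j).comp hA).smul (-1)
      refine ⟨(Real.exp (-β j) : ℂ) • (A ∘ₗ creation j) + (-1 : ℂ) • (creation j ∘ₗ A),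
        r + 1, hb1.add (by rwa [add_comm r]), fun z => ?_⟩
      rw [thermalTrace_add hβ hb1 hb2, thermalTrace_smul, thermalTrace_smul,
        thermalTrace_creation hβ hA, evalPoly, map_mul,
        ← evalPoly, MvPolynomial.eval_X, Sum.elim_inr, mul_right_comm, ← h1]
      ring

/-- The square root of the thermal state, needed to factor `A τ` into the Hilbert–Schmidt operators
`A √τ` and `√τ`. -/
lemma exists_sqrt_thermal (hβ : ∀ j, 0 < β j) : ∃ R : Modes m →L[ℂ] Modes m,
    IsSelfAdjoint R ∧ hsNormSq R < ⊤ ∧ ∀ k, R (fock k) = (√(thermalWeight β k) : ℂ) • fock k := by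
  have hs : Summable fun k => ‖(√(thermalWeight β k) : ℂ) • (fock k : Modes m)‖ ^ 2 := by
    refine (hasSum_thermalWeight hβ).summable.congr fun k => ?_
    rw [norm_smul, norm_fock, mul_one, Complex.norm_real, Real.norm_of_nonneg (Real.sqrt_nonneg _),
      Real.sq_sqrt (thermalWeight_pos hβ k).le]
  obtain ⟨R, hR⟩ := exists_clm_of_summable_sq (fockBasis m) _ hs
  simp only [fockBasis_apply] at hR
  refine ⟨R, ?_, ?_, hR⟩
  · exact isSelfAdjoint_of_diagonal (fockBasis m) (fun k => √(thermalWeight β k))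
      (by simpa only [fockBasis_apply] using hR)
  · rw [hsNormSq_eq (fockBasis m)]
    simp only [fockBasis_apply, hR]
    have h1 := hs.tsum_ofReal_lt_top
    convert! h1 using 3 with k
    rw [ENNReal.ofReal_pow (norm_nonneg _), ofReal_norm]

/-- The operator `A τ` for a thermal state `τ`. -/
lemma exists_thermal_operator (hβ : ∀ j, 0 < β j) {A : FockSpan m →ₗ[ℂ] FockSpan m} {r : ℕ}
    (hA : IsLadderBounded A r) : ∃ X : Modes m →L[ℂ] Modes m, IsTraceClass X ∧
      (∀ k, X (fock k) = (thermalWeight β k : ℂ) • fockEmb (A (Finsupp.single k 1))) ∧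
      ∀ z, charFun X z = thermalTrace β A z := by
  obtain ⟨R, hRs, hRhs, hR⟩ := exists_sqrt_thermal hβ
  have hs : Summable fun k => ‖(√(thermalWeight β k) : ℂ) •
      fockEmb (A (Finsupp.single k 1))‖ ^ 2 := by
    refine (summable_thermalWeight_mul_norm_sq hβ hA).congr fun k => ?_
    rw [norm_smul, mul_pow, Complex.norm_real, Real.norm_of_nonneg (Real.sqrt_nonneg _),
      Real.sq_sqrt (thermalWeight_pos hβ k).le]
  obtain ⟨Y, hY⟩ := exists_clm_of_summable_sq (fockBasis m) _ hs
  have hYhs : hsNormSq Y < ⊤ := by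
    rw [hsNormSq_eq (fockBasis m)]
    simp only [hY]
    have h1 := hs.tsum_ofReal_lt_top
    convert! h1 using 3 with k
    rw [ENNReal.ofReal_pow (norm_nonneg _), ofReal_norm]
  simp only [fockBasis_apply] at hY
  have hsq : ∀ k, (√(thermalWeight β k) : ℂ) * √(thermalWeight β k) = thermalWeight β k :=
    fun k => by rw [← Complex.ofReal_mul, Real.mul_self_sqrt (thermalWeight_pos hβ k).le]
  refine ⟨Y ∘L R, isTraceClass_comp hYhs hRhs, fun k => ?_, fun z => ?_⟩
  · rw [ContinuousLinearMap.comp_apply, hR, map_smul, hY, smul_smul, hsq]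
  · rw [charFun, trace_comp_comp (fockBasis m) hYhs hRhs, thermalTrace]
    congr 1; ext k
    rw [ContinuousLinearMap.isSelfAdjoint_iff'.1 hRs, fockBasis_apply, hR, hY, map_smul,
      inner_smul_left, inner_smul_right, Complex.conj_ofReal, ← mul_assoc, hsq]

lemma thermalState_fock (hβ : ∀ j, 0 < β j) (k : Fin m → ℕ) :
    thermalState β (fock k) = (thermalWeight β k : ℂ) • fock k := by
  have hs : Summable fun l : Fin m → ℕ => ((thermalWeight β l : ℝ) : ℂ) •
      InnerProductSpace.rankOne ℂ (fock l : Modes m) (fock l) := by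
    refine Summable.of_norm_bounded (hasSum_thermalWeight hβ).summable fun l => ?_
    rw [norm_smul, InnerProductSpace.norm_rankOne, norm_fock, Complex.norm_real,
      Real.norm_of_nonneg (thermalWeight_pos hβ l).le, mul_one, mul_one]
  have h1 := (ContinuousLinearMap.apply ℂ (Modes m) (fock k : Modes m)).hasSum hs.hasSum
  have h2 : ContinuousLinearMap.apply ℂ (Modes m) (fock k : Modes m) (thermalState β) =
      thermalState β (fock k) := rfl
  rw [← thermalState, h2] at h1
  refine h1.unique ?_
  have h3 := hasSum_single (f := fun l : Fin m → ℕ =>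
    ContinuousLinearMap.apply ℂ (Modes m) (fock k : Modes m) (((thermalWeight β l : ℝ) : ℂ) •
      InnerProductSpace.rankOne ℂ (fock l : Modes m) (fock l))) k ?_
  · convert! h3 using 1
    change _ = (thermalWeight β k : ℂ) • (inner ℂ (fock k) (fock k) • (fock k : Modes m))
    rw [inner_fock_fock, if_pos rfl, one_smul]
  · intro l hl
    simp [inner_fock_fock, hl]

/-- The exponent `∑ⱼ |zⱼ|² coth (βⱼ / 2)`. -/
def thermalForm (β : Fin m → ℝ) (z : Fin m → ℂ) : ℝ :=
  ∑ j, ‖z j‖ ^ 2 * ((1 + Real.exp (-β j)) / (1 - Real.exp (-β j)))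

/-- For `A = id` the KMS relations are closed linear equations for `tr(τ D_z a_j)` and `tr(τ D_z
a_j†)`; solving them produces the factor `(1 + e^{-β_j})/(1 - e^{-β_j})`. -/
lemma thermalTrace_generator (hβ : ∀ j, 0 < β j) (z : Fin m → ℂ) (t : ℝ) :
    thermalTrace β (generator z) (t • z) =
      -(t * thermalForm β z : ℝ) * thermalTrace β LinearMap.id (t • z) := by
  have h1 : ∀ j, IsLadderBounded (z j • creation j - conj (z j) • annihilation j) 1 := fun j => by
    have h : z j • creation j - conj (z j) • annihilation j =
        z j • creation j + (-conj (z j)) • annihilation j := by module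
    rw [h]
    exact ((isLadderBounded_creation j).smul _).add ((isLadderBounded_annihilation j).smul _)
  rw [generator, thermalTrace_sum hβ _ h1, thermalForm, Finset.mul_sum]
  push_cast
  rw [← Finset.sum_neg_distrib, Finset.sum_mul]
  refine Finset.sum_congr rfl fun j _ => ?_
  have h : z j • creation j - conj (z j) • annihilation j =
      z j • creation j + (-conj (z j)) • annihilation j := by module
  have hx : (1 : ℂ) - Real.exp (-β j) ≠ 0 := by
    have := (exp_neg_mem hβ j).2
    exact_mod_cast (by linarith : 1 - Real.exp (-β j) ≠ 0)
  have h2 := thermalTrace_annihilation hβ isLadderBounded_id j (t • z)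
  have h3 := thermalTrace_creation hβ isLadderBounded_id j (t • z)
  rw [LinearMap.id_comp, LinearMap.comp_id] at h2 h3
  rw [h, thermalTrace_add hβ ((isLadderBounded_creation j).smul _)
    ((isLadderBounded_annihilation j).smul _), thermalTrace_smul, thermalTrace_smul]
  have hz : ((‖z j‖ : ℝ) : ℂ) ^ 2 = z j * conj (z j) := by
    rw [Complex.mul_conj, Complex.normSq_eq_norm_sq]; push_cast; rfl
  have h4 : (t • z) j = (t : ℂ) * z j := by simp
  rw [h4] at h2 h3
  rw [map_mul, Complex.conj_ofReal] at h3
  rw [hz]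
  push_cast at h2 h3 hx ⊢
  field_simp
  linear_combination (-conj (z j)) * h2 - z j * h3

/-- Along the ray `t z` the trace solves `f' = -t q f`, `f(0) = 1`, where `q` is the thermal form;
so `f` times `e^{q t²/2}` is constant. -/
lemma thermalTrace_id (hβ : ∀ j, 0 < β j) (z : Fin m → ℂ) :
    thermalTrace β LinearMap.id z = Complex.exp (-(1 / 2) * thermalForm β z) := by
  have hd : ∀ t : ℝ, HasDerivAt (fun t : ℝ => thermalTrace β LinearMap.id (t • z))
      (-(t * thermalForm β z : ℝ) * thermalTrace β LinearMap.id (t • z)) t := fun t => by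
    rw [← thermalTrace_generator hβ]
    refine hasDerivAt_tsum (g' := fun k s => thermalWeight β k * inner ℂ (fock k)
      (displacement (s • z) (fockEmb (generator z (Finsupp.single k 1))))) (summable_thermalWeight_mul_norm hβ (isLadderBounded_generator z))
      (fun k s => ?_) (fun k s => norm_thermalTrace_term_le hβ _ _ k) (y₀ := 0) ?_ t
    · have h := hasDerivAt_inner_displacement z (Finsupp.single k 1) (Finsupp.single k 1) s
      rw [fockEmb_single, one_smul] at h
      simpa using h.const_mul (thermalWeight β k : ℂ)
    · exact summable_thermalTrace hβ isLadderBounded_id _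
  have he : ∀ t : ℝ, HasDerivAt (fun t : ℝ => Complex.exp (((1 / 2) * t ^ 2 * thermalForm β z : ℝ)))
      (Complex.exp (((1 / 2) * t ^ 2 * thermalForm β z : ℝ)) * (t * thermalForm β z : ℝ)) t :=
    fun t => by
    refine HasDerivAt.cexp (HasDerivAt.ofReal_comp ?_)
    have h := ((hasDerivAt_pow 2 t).const_mul (1 / 2 : ℝ)).mul_const (thermalForm β z)
    convert! h using 1
    push_cast; ring
  have hp : ∀ t : ℝ, HasDerivAt (fun t : ℝ => thermalTrace β LinearMap.id (t • z) *
      Complex.exp (((1 / 2) * t ^ 2 * thermalForm β z : ℝ))) 0 t := fun t => by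
    convert! (hd t).mul (he t) using 1
    ring
  have hc := is_const_of_deriv_eq_zero (fun t => (hp t).differentiableAt) (fun t => (hp t).deriv) 1 0
  have h0 : thermalTrace β LinearMap.id ((0 : ℝ) • z) = 1 := by
    rw [zero_smul, thermalTrace]
    have h := Complex.hasSum_ofReal.2 (hasSum_thermalWeight hβ)
    refine (tsum_congr fun k => ?_).trans h.tsum_eq
    rw [displacement_zero, LinearMap.id_apply, fockEmb_single, one_smul,
      inner_fock_fock, if_pos rfl, mul_one]
  simp only [h0, one_smul] at hc
  rw [neg_mul, Complex.exp_neg]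
  refine eq_inv_of_mul_eq_one_left ?_
  simpa using hc

end Thermal

end Bosonic
end

noncomputable section

set_option linter.unusedSectionVars false

namespace Bosonic

/-! ### Symplectic diagonalization of positive matrices -/

section Williamson

open Matrix

open scoped ComplexOrder

variable {n : Type*} [Fintype n] [DecidableEq n]

lemma dotProduct_mulVec_symm {A : Matrix n n ℂ} (hA : Aᵀ = A) (v w : n → ℂ) :
    v ⬝ᵥ (A *ᵥ w) = w ⬝ᵥ (A *ᵥ v) := by
  rw [dotProduct_mulVec, ← mulVec_transpose, hA, dotProduct_comm]

lemma dotProduct_mulVec_antisymm {A : Matrix n n ℂ} (hA : Aᵀ = -A) (v w : n → ℂ) :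
    v ⬝ᵥ (A *ᵥ w) = -(w ⬝ᵥ (A *ᵥ v)) := by
  rw [dotProduct_mulVec, ← mulVec_transpose, hA, dotProduct_comm, neg_mulVec, dotProduct_neg]

/-- Simultaneous diagonalization of a positive definite and a Hermitian matrix. -/
lemma exists_simultaneous_diagonalization {G K : Matrix n n ℂ} (hG : G.PosDef)
    (hK : K.IsHermitian) : ∃ (κ : n → ℝ) (y : n → n → ℂ),
      (∀ j, K *ᵥ y j = (κ j : ℂ) • (G *ᵥ y j)) ∧
      ∀ j k, star (y j) ⬝ᵥ (G *ᵥ y k) = if j = k then 1 else 0 := by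
  obtain ⟨B, hB⟩ : ∃ B : Matrix n n ℂ, G = Bᴴ * B := by
    open scoped MatrixOrder in
    exact CStarAlgebra.nonneg_iff_eq_star_mul_self.mp hG.posSemidef.nonneg
  have hBu : IsUnit B.det := by
    have h := (isUnit_iff_isUnit_det _).1 hG.isUnit
    rw [hB, det_mul] at h
    exact isUnit_of_mul_isUnit_right h
  have hBinv : B * B⁻¹ = 1 := mul_nonsing_inv B hBu
  have hBHinv : Bᴴ * (B⁻¹)ᴴ = 1 := by
    rw [← conjTranspose_mul, nonsing_inv_mul B hBu, conjTranspose_one]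
  have hH : ((B⁻¹)ᴴ * K * B⁻¹).IsHermitian := isHermitian_conjTranspose_mul_mul _ hK
  refine ⟨hH.eigenvalues, fun j => B⁻¹ *ᵥ (hH.eigenvectorBasis j).ofLp, fun j => ?_, fun j k => ?_⟩
  · have h := congrArg (Bᴴ *ᵥ ·) (hH.mulVec_eigenvectorBasis j)
    simp only [mulVec_mulVec, mulVec_smul] at h ⊢
    generalize (hH.eigenvectorBasis j).ofLp = u at h ⊢
    generalize hH.eigenvalues j = c at h ⊢
    rw [hB, Matrix.mul_assoc, hBinv, Matrix.mul_one]
    rw [← Matrix.mul_assoc, ← Matrix.mul_assoc, hBHinv, Matrix.one_mul] at h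
    rw [h]
    rfl
  · have h := hH.eigenvectorBasis.orthonormal
    rw [orthonormal_iff_ite] at h
    have h1 := h j k
    rw [EuclideanSpace.inner_eq_star_dotProduct] at h1
    rw [← h1]
    beta_reduce
    generalize (hH.eigenvectorBasis j).ofLp = u
    generalize (hH.eigenvectorBasis k).ofLp = w
    rw [hB, star_mulVec, mulVec_mulVec, dotProduct_mulVec, vecMul_vecMul, Matrix.mul_assoc,
      hBinv, Matrix.mul_one, ← conjTranspose_mul, hBinv, conjTranspose_one,
      vecMul_one, dotProduct_comm]

/-- With the vectors as columns of `V`, the hypothesis reads `V† G V = 1`, and the rank of the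
identity is bounded by the number of rows of `V`. -/
lemma card_le_of_orthonormal {ι : Type*} [Fintype ι] [DecidableEq ι] {G : Matrix n n ℂ}
    (v : ι → n → ℂ) (hv : ∀ i j, star (v i) ⬝ᵥ (G *ᵥ v j) = if i = j then 1 else 0) :
    Fintype.card ι ≤ Fintype.card n := by
  let V : Matrix n ι ℂ := Matrix.of fun a i => v i a
  have h : Vᴴ * G * V = 1 := by
    ext i j
    rw [Matrix.one_apply, ← hv i j, Matrix.mul_assoc]
    simp [V, Matrix.mul_apply, dotProduct, mulVec]
  have h1 := rank_mul_le_right (Vᴴ * G) V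
  rw [h, rank_one] at h1
  exact h1.trans (rank_le_card_height V)

variable {G Ω : Matrix n n ℂ}

/-- Averaging with the transpose cancels the antisymmetric part and preserves positive definiteness.
-/
lemma posDef_of_posDef_add (hGt : Gᵀ = G) (hΩt : Ωᵀ = -Ω) (hp : (G + Complex.I • Ω).PosDef) :
    G.PosDef := by
  have h1 : G = (1 / 2 : ℝ) • ((G + Complex.I • Ω) + (G + Complex.I • Ω)ᵀ) := by
    rw [transpose_add, transpose_smul, hGt, hΩt]
    module
  rw [h1]
  exact (hp.add hp.transpose).smul (by norm_num)

/-- Williamson's theorem. -/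
lemma exists_symplectic_eigenvectors (hGt : Gᵀ = G) (hΩt : Ωᵀ = -Ω) (hΩh : Ωᴴ = -Ω)
    (hΩ : ∀ v, Ω *ᵥ v = 0 → v = 0) (hp : (G + Complex.I • Ω).PosDef) {m : ℕ}
    (hm : Fintype.card n = 2 * m) :
    ∃ (κ : Fin m → ℝ) (y : Fin m → n → ℂ), (∀ j, 0 < κ j ∧ κ j < 1) ∧
      (∀ j, (Complex.I • Ω) *ᵥ y j = (κ j : ℂ) • (G *ᵥ y j)) ∧
      (∀ j k, star (y j) ⬝ᵥ (G *ᵥ y k) = if j = k then 1 else 0) ∧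
      ∀ j k, y j ⬝ᵥ (G *ᵥ y k) = 0 := by
  have hG := posDef_of_posDef_add hGt hΩt hp
  have hK : (Complex.I • Ω).IsHermitian := by
    rw [IsHermitian, conjTranspose_smul, hΩh, Complex.star_def, Complex.conj_I]
    module
  obtain ⟨κ, y, hy, ho⟩ := exists_simultaneous_diagonalization hG hK
  have hy0 : ∀ j, y j ≠ 0 := fun j h => by
    have := ho j j
    rw [h] at this
    simp at this
  have hκ0 : ∀ j, κ j ≠ 0 := fun j h => by
    have h1 := hy j
    rw [h, Complex.ofReal_zero, zero_smul, smul_mulVec] at h1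
    exact hy0 j (hΩ _ ((smul_eq_zero.1 h1).resolve_left Complex.I_ne_zero))
  -- `G` is symmetric and `iΩ` antisymmetric for the bilinear pairing, so eigenvectors pair to zero
  -- unless their eigenvalues are opposite.
  have hskew : ∀ j k, ((κ j + κ k : ℝ) : ℂ) * (y j ⬝ᵥ (G *ᵥ y k)) = 0 := fun j k => by
    have h1 : y j ⬝ᵥ ((Complex.I • Ω) *ᵥ y k) = κ k * (y j ⬝ᵥ (G *ᵥ y k)) := by
      rw [hy, dotProduct_smul, smul_eq_mul]
    have h2 : y k ⬝ᵥ ((Complex.I • Ω) *ᵥ y j) = κ j * (y k ⬝ᵥ (G *ᵥ y j)) := by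
      rw [hy, dotProduct_smul, smul_eq_mul]
    have h3 : (Complex.I • Ω)ᵀ = -(Complex.I • Ω) := by rw [transpose_smul, hΩt, smul_neg]
    rw [dotProduct_mulVec_antisymm h3, h2, dotProduct_mulVec_symm hGt (y k)] at h1
    push_cast
    linear_combination -h1
  have hcross : ∀ j k, 0 < κ j * κ k → y j ⬝ᵥ (G *ᵥ y k) = 0 := fun j k h => by
    refine (mul_eq_zero.1 (hskew j k)).resolve_left ?_
    have : κ j + κ k ≠ 0 := fun h' => by
      have : κ k = -κ j := by linarith
      rw [this] at h
      nlinarith [sq_nonneg (κ j)]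
    exact_mod_cast this
  have hGstar : ∀ v, G *ᵥ star v = star (G *ᵥ v) := fun v => by
    rw [star_mulVec, hG.1.eq, ← mulVec_transpose, hGt]
  have hΩstar : ∀ v, Ω *ᵥ star v = star (Ω *ᵥ v) := fun v => by
    rw [star_mulVec, hΩh, ← mulVec_transpose, transpose_neg, hΩt, neg_neg]
  -- The eigenvectors with negative eigenvalue, together with their conjugates, are `G`-orthonormal
  -- in dimension `2m`. So at most `m` eigenvalues are negative; as none vanishes, at least `m` are
  -- positive.
  have hneg : 2 * Fintype.card {j // κ j < 0} ≤ 2 * m := by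
    rw [← hm, two_mul, ← Fintype.card_sum]
    refine card_le_of_orthonormal (G := G)
      (Sum.elim (fun j : {j // κ j < 0} => y j) fun j : {j // κ j < 0} => star (y j)) ?_
    rintro (j | j) (k | k)
    · simp only [Sum.elim_inl, ho, Sum.inl.injEq, Subtype.ext_iff]
    · have h := hcross j k (mul_pos_of_neg_of_neg j.2 k.2)
      simp only [Sum.elim_inl, Sum.elim_inr, hGstar, reduceCtorEq, if_false]
      rw [star_dotProduct_star, dotProduct_comm, h, star_zero]
    · have h := hcross j k (mul_pos_of_neg_of_neg j.2 k.2)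
      simp only [Sum.elim_inl, Sum.elim_inr, star_star, reduceCtorEq, if_false, h]
    · simp only [Sum.elim_inr, hGstar, star_star, Sum.inr.injEq, Subtype.ext_iff]
      rw [dotProduct_star, dotProduct_comm, ho]
      split_ifs <;> simp
  have hpos : m ≤ Fintype.card {j // ¬ κ j < 0} := by
    rw [Fintype.card_subtype_compl, hm]
    omega
  obtain ⟨f⟩ := Function.Embedding.nonempty_of_card_le (α := Fin m) (β := {j // ¬ κ j < 0})
    (by rwa [Fintype.card_fin])
  have hκpos : ∀ j, 0 < κ (f j) := fun j => lt_of_le_of_ne (not_lt.1 (f j).2) (hκ0 _).symm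
  refine ⟨fun j => κ (f j), fun j => y (f j), fun j => ⟨hκpos j, ?_⟩, fun j => hy _, fun j k => ?_,
    fun j k => hcross _ _ (mul_pos (hκpos j) (hκpos k))⟩
  · have h1 := hp.dotProduct_mulVec_pos (x := star (y (f j))) (star_ne_zero.2 (hy0 _))
    have h2 := hy (f j)
    have h3 : (Complex.I • Ω) *ᵥ star (y (f j)) = -((κ (f j) : ℂ) • star (G *ᵥ y (f j))) := by
      have h4 := congrArg star h2
      rw [smul_mulVec, star_smul, star_smul, Complex.star_def,
        Complex.conj_I, Complex.conj_ofReal] at h4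
      rw [smul_mulVec, hΩstar, ← h4, neg_smul, neg_neg]
    rw [add_mulVec, h3, hGstar, dotProduct_add, star_star, dotProduct_neg, dotProduct_smul] at h1
    have h5 : y (f j) ⬝ᵥ star (G *ᵥ y (f j)) = 1 := by
      rw [dotProduct_star, dotProduct_comm, ho, if_pos rfl, star_one]
    rw [h5, smul_eq_mul, mul_one, ← sub_eq_add_neg] at h1
    have h6 : (0 : ℝ) < 1 - κ (f j) := by exact_mod_cast h1
    linarith
  · rw [ho]
    simp [Subtype.ext_iff.symm]

end Williamson

end Bosonic
end

noncomputable section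

namespace Bosonic

variable {m : ℕ}

/-! ### Gaussian states are thermal states in a symplectic frame -/

lemma trace_comp_apply_eq {H ι : Type*} [NormedAddCommGroup H] [InnerProductSpace ℂ H]
    [CompleteSpace H] (b : HilbertBasis ι ℂ H) {B : H →L[ℂ] H} (hB : IsSelfAdjoint B)
    (hhs : hsNormSq B < ⊤) (Y : H →L[ℂ] H) :
    HasSum (fun k => inner ℂ (B (b k)) (Y (B (b k)))) (trace ((B ∘L B) ∘L Y)) := by
  have h1 := summable_trace_comp_comp b hhs hhs Y
  rw [trace_comp_comp b hhs hhs Y]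
  rw [ContinuousLinearMap.isSelfAdjoint_iff'.1 hB] at h1 ⊢
  exact h1.hasSum

/-- Bochner positivity of quantum characteristic functions. -/
lemma re_sum_charFun_nonneg {τ : Modes m →L[ℂ] Modes m} (hτ : IsState τ) {ι : Type*} [Fintype ι]
    (c : ι → ℂ) (w : ι → Fin m → ℂ) :
    0 ≤ (∑ i, ∑ j, conj (c i) * c j * (Complex.exp ((symp (-w i) (w j) : ℝ) * Complex.I) *
      charFun τ (w j - w i))).re := by
  obtain ⟨B, hB, rfl, hhs⟩ := hτ.traceClass.exists_sqrt_of_nonneg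
    (ContinuousLinearMap.nonneg_iff_isPositive _ |>.2 hτ.positive)
  have h1 := hasSum_sum (s := Finset.univ) fun i _ => hasSum_sum (s := Finset.univ) fun j _ =>
    ((trace_comp_apply_eq (fockBasis m) hB hhs (displacement (w j - w i))).mul_left
      (Complex.exp ((symp (-w i) (w j) : ℝ) * Complex.I))).mul_left (conj (c i) * c j)
  refine (Complex.hasSum_re h1).nonneg fun k => ?_
  generalize B (fockBasis m k) = x
  have h2 : ∑ i, ∑ j, conj (c i) * c j * (Complex.exp ((symp (-w i) (w j) : ℝ) * Complex.I) *
      inner ℂ x (displacement (w j - w i) x)) =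
      inner ℂ (∑ i, c i • displacement (w i) x) (∑ i, c i • displacement (w i) x) := by
    rw [sum_inner]
    refine Finset.sum_congr rfl fun i _ => ?_
    rw [inner_sum]
    refine Finset.sum_congr rfl fun j _ => ?_
    rw [inner_smul_left, inner_smul_right, inner_displacement_left, displacement_displacement,
      inner_smul_right, neg_add_eq_sub, mul_assoc]
  rw [h2]
  exact inner_self_nonneg (𝕜 := ℂ)

lemma symp_neg_left (z w : Fin m → ℂ) : symp (-z) w = -symp z w := by
  rw [symp, symp, ← Finset.sum_neg_distrib]
  refine Finset.sum_congr rfl fun j _ => ?_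
  simp only [Pi.neg_apply, Complex.neg_re, Complex.neg_im]; ring

lemma symp_swap (z w : Fin m → ℂ) : symp w z = -symp z w := by
  rw [symp, symp, ← Finset.sum_neg_distrib]
  refine Finset.sum_congr rfl fun j _ => ?_
  ring

lemma symp_smul_smul (t : ℝ) (z w : Fin m → ℂ) : symp (t • z) (t • w) = t ^ 2 * symp z w := by
  rw [symp, symp, Finset.mul_sum]
  refine Finset.sum_congr rfl fun j _ => ?_
  simp only [Pi.smul_apply, Complex.real_smul, Complex.re_ofReal_mul, Complex.im_ofReal_mul]; ring

lemma symp_zero_left (z : Fin m → ℂ) : symp 0 z = 0 := by simp [symp]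

lemma symp_zero_right (z : Fin m → ℂ) : symp z 0 = 0 := by simp [symp]

lemma symp_self (z : Fin m → ℂ) : symp z z = 0 := by
  have := symp_swap z z
  linarith

/-- The uncertainty relation for states with a centered Gaussian characteristic function. -/
lemma quadratic_add_symp_nonneg {τ : Modes m →L[ℂ] Modes m} (hτ : IsState τ)
    {q : (Fin m → ℂ) → ℝ} (hq : ∀ (t : ℝ) z, q (t • z) = t ^ 2 * q z)
    (hχ : ∀ z, charFun τ z = (Real.exp (-q z) : ℝ)) (a b : Fin m → ℂ) :
    0 ≤ q a + q b + symp a b := by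
  have hneg : ∀ z, q (-z) = q z := fun z => by
    have := hq (-1) z
    simpa using this
  have hzero : q 0 = 0 := by simpa using hq 0 0
  let F : ℝ → ℝ := fun s => 4 - 2 * Real.exp (-(s * q a)) - 2 * Real.exp (-(s * q b)) +
    2 * (Real.sin (s * symp a b) * Real.exp (-(s * q (b - a))))
  have hF : ∀ s, 0 ≤ s → 0 ≤ F s := fun s hs => by
    -- The coefficients `-(1 + i)`, `1`, `i` sum to zero, so the Bochner sum `F s` vanishes at `s =
    -- 0`. Being nonnegative for `s ≥ 0`, it has a nonnegative right derivative there, which is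
    -- twice the asserted quantity. The points are scaled by `√s` to make the quadratic exponents
    -- linear in `s`.
    have h := re_sum_charFun_nonneg hτ ![-(1 + Complex.I), 1, Complex.I] ![0, √s • a, √s • b]
    have hs2 : √s ^ 2 = s := Real.sq_sqrt hs
    have h1 : ∀ x : ℝ, Complex.exp (x * Complex.I) = Real.cos x + Real.sin x * Complex.I :=
      fun x => by rw [Complex.exp_mul_I, Complex.ofReal_cos, Complex.ofReal_sin]
    have h2 : √s • a - √s • b = √s • (-(b - a)) := by rw [neg_sub, smul_sub]
    have h3 : √s • b - √s • a = √s • (b - a) := by rw [smul_sub]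
    simp only [Fin.sum_univ_three, Matrix.cons_val_zero, Matrix.cons_val_one, Matrix.cons_val,
      symp_neg_left, symp_zero_left, symp_zero_right, symp_self, symp_smul_smul, hs2, sub_zero,
      zero_sub, sub_self, hχ, hneg, hzero, h2, h3, hq, h1, symp_swap a b] at h
    simp [-Complex.ofReal_exp, -Complex.ofReal_sin, -Complex.ofReal_cos] at h
    simp only [F]
    linarith
  have hd : HasDerivAt F (2 * (q a + q b + symp a b)) 0 := by
    have he : ∀ c : ℝ, HasDerivAt (fun s : ℝ => Real.exp (-(s * c))) (-c) 0 := fun c => by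
      have := (((hasDerivAt_id (0 : ℝ)).mul_const c).neg).exp
      simpa using this
    have hsin : HasDerivAt (fun s : ℝ => Real.sin (s * symp a b)) (symp a b) 0 := by
      have := ((hasDerivAt_id (0 : ℝ)).mul_const (symp a b)).sin
      simpa using this
    have h := ((((he (q a)).const_mul 2).const_sub 4).sub ((he (q b)).const_mul 2)).add
      ((hsin.mul (he (q (b - a)))).const_mul 2)
    convert! h using 1
    simp
    ring
  have hd' := (hasDerivWithinAt_iff_tendsto_slope' (s := Set.Ioi (0 : ℝ)) (by simp)).1
    hd.hasDerivWithinAt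
  have h0 : F 0 = 0 := by simp [F]; norm_num
  have h2 : 0 ≤ 2 * (q a + q b + symp a b) := by
    refine ge_of_tendsto hd' ?_
    filter_upwards [self_mem_nhdsWithin] with s hs
    rw [slope_def_field, h0, sub_zero, sub_zero]
    exact div_nonneg (hF s (le_of_lt hs)) (le_of_lt hs)
  linarith

/-- The real vector `Λ ẑ` of phase space coordinates. -/
def phase (m : ℕ) : (Fin m → ℂ) ≃ₗ[ℝ] (Fin 2 × Fin m → ℝ) where
  toFun z r := if r.1 = 0 then √2 * (z r.2).im else -(√2 * (z r.2).re)
  invFun v j := ⟨-(v (1, j) / √2), v (0, j) / √2⟩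
  map_add' z w := by
    ext r
    simp only [Pi.add_apply, Complex.add_re, Complex.add_im]
    split_ifs <;> ring
  map_smul' c z := by
    ext r
    simp only [Pi.smul_apply, Complex.real_smul, Complex.re_ofReal_mul, Complex.im_ofReal_mul,
      RingHom.id_apply, smul_eq_mul]
    split_ifs <;> ring
  left_inv z := by
    ext j
    have : √(2 : ℝ) ≠ 0 := by positivity
    apply Complex.ext <;> simp <;> field_simp
  right_inv v := by
    have : √(2 : ℝ) ≠ 0 := by positivity
    ext ⟨i, j⟩
    fin_cases i <;> (simp; field_simp)

lemma phase_zero (z : Fin m → ℂ) (j : Fin m) : phase m z (0, j) = √2 * (z j).im := rfl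

lemma phase_one (z : Fin m → ℂ) (j : Fin m) : phase m z (1, j) = -(√2 * (z j).re) := rfl

open Matrix in
lemma lambdaMatrix_mulVec (z : Fin m → ℂ) :
    lambdaMatrix m *ᵥ hatVector z = fun r => (phase m z r : ℂ) := by
  have h2 : ((√2 : ℝ) : ℂ) ≠ 0 := by
    have : √(2 : ℝ) ≠ 0 := by positivity
    exact_mod_cast this
  have hs : ((√2 : ℝ) : ℂ) ^ 2 = 2 := by
    rw [← Complex.ofReal_pow, Real.sq_sqrt (by norm_num)]; norm_num
  ext ⟨i, j⟩
  have h1 : (z j) = (z j).re + (z j).im * Complex.I := (Complex.re_add_im _).symm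
  have h1' : conj (z j) = (z j).re - (z j).im * Complex.I := by
    apply Complex.ext <;> simp
  rw [mulVec, dotProduct, Fintype.sum_prod_type, Fin.sum_univ_two]
  fin_cases i
  · simp [lambdaMatrix, blockDiagonal_apply, hatVector, phase_zero]
    rw [h1']
    field_simp
    rw [hs]
    linear_combination (-Complex.I) * h1 - 2 * ((z j).im : ℂ) * Complex.I_sq
  · simp [lambdaMatrix, blockDiagonal_apply, hatVector, phase_one]
    rw [h1']
    field_simp
    rw [hs]
    linear_combination -h1

open Matrix in
lemma dotProduct_symplecticForm_mulVec (u v : Fin 2 × Fin m → ℂ) :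
    u ⬝ᵥ (symplecticForm m *ᵥ v) = ∑ j, (u (0, j) * v (1, j) - u (1, j) * v (0, j)) := by
  have h : ∀ j, (symplecticForm m *ᵥ v) (0, j) = v (1, j) ∧
      (symplecticForm m *ᵥ v) (1, j) = -v (0, j) := fun j => by
    constructor <;>
    · rw [mulVec, dotProduct, Fintype.sum_prod_type, Fin.sum_univ_two]
      simp [symplecticForm, blockDiagonal_apply]
  rw [dotProduct, Fintype.sum_prod_type, Fin.sum_univ_two, ← Finset.sum_add_distrib]
  refine Finset.sum_congr rfl fun j _ => ?_
  rw [(h j).1, (h j).2]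
  ring

-- Fixes the sign and factor between `Ω` on phase-space vectors and the form in the Weyl relations;
-- the `2` is the square of the `√2` in the coordinates.
open Matrix in
lemma symplecticForm_phase (z w : Fin m → ℂ) :
    (fun r => (phase m z r : ℂ)) ⬝ᵥ (symplecticForm m *ᵥ fun r => (phase m w r : ℂ)) =
      ((-2 * symp z w : ℝ) : ℂ) := by
  rw [dotProduct_symplecticForm_mulVec, symp, Finset.mul_sum, Complex.ofReal_sum]
  refine Finset.sum_congr rfl fun j _ => ?_
  rw [phase_zero, phase_zero, phase_one, phase_one]
  have hs : √(2 : ℝ) ^ 2 = 2 := Real.sq_sqrt (by norm_num)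
  rw [← Complex.ofReal_mul, ← Complex.ofReal_mul, ← Complex.ofReal_sub]
  congr 1
  linear_combination ((z j).re * (w j).im - (z j).im * (w j).re) * hs

open Matrix in
lemma symplecticForm_transpose : (symplecticForm m)ᵀ = -symplecticForm m := by
  ext ⟨i, j⟩ ⟨k, l⟩
  fin_cases i <;> fin_cases k <;>
    simp [symplecticForm, blockDiagonal_apply, eq_comm] <;> split_ifs <;> simp

open Matrix in
lemma symplecticForm_conjTranspose : (symplecticForm m)ᴴ = -symplecticForm m := by
  rw [← symplecticForm_transpose]
  ext ⟨i, j⟩ ⟨k, l⟩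
  fin_cases i <;> fin_cases k <;>
    simp [symplecticForm, blockDiagonal_apply] <;> split_ifs <;> simp

open Matrix in
lemma symplecticForm_mulVec_eq_zero (v : Fin 2 × Fin m → ℂ) (h : symplecticForm m *ᵥ v = 0) :
    v = 0 := by
  have h1 : ∀ u : Fin 2 × Fin m → ℂ, ∑ j, (u (0, j) * v (1, j) - u (1, j) * v (0, j)) = 0 := fun u => by
    rw [← dotProduct_symplecticForm_mulVec, h, dotProduct_zero]
  ext ⟨i, j⟩
  fin_cases i
  · have := h1 (Pi.single (1, j) 1)
    rw [Finset.sum_eq_single j] at this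
    · simpa using this
    · intro l _ hl; simp [hl]
    · simp
  · have := h1 (Pi.single (0, j) 1)
    rw [Finset.sum_eq_single j] at this
    · simpa using this
    · intro l _ hl; simp [hl]
    · simp

end Bosonic
end

noncomputable section

namespace Bosonic

variable {m : ℕ}

/-! ### Covariance matrices of Gaussian states and their normal form. -/

section Gaussian

open Matrix

open scoped ComplexOrder

variable {τ : Modes m →L[ℂ] Modes m}

lemma covMatrix_comm (r s : Fin 2 × Fin m) : covMatrix τ r s = covMatrix τ s r := by
  rw [covMatrix, of_apply, of_apply, add_comm]

lemma covMatrix_transpose : (covMatrix τ)ᵀ = covMatrix τ := by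
  ext r s
  rw [transpose_apply, covMatrix_comm]

lemma covMatrix_map_conjTranspose :
    ((covMatrix τ).map Complex.ofReal)ᴴ = (covMatrix τ).map Complex.ofReal := by
  ext r s
  rw [conjTranspose_apply, map_apply, map_apply, Complex.star_def, Complex.conj_ofReal,
    covMatrix_comm]

/-- `¼ zᵀ γ z` in phase space coordinates. -/
def covForm (τ : Modes m →L[ℂ] Modes m) (z : Fin m → ℂ) : ℝ :=
  1 / 4 * (phase m z ⬝ᵥ (covMatrix τ *ᵥ phase m z))

lemma covForm_smul (t : ℝ) (z : Fin m → ℂ) : covForm τ (t • z) = t ^ 2 * covForm τ z := by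
  rw [covForm, covForm, map_smul, mulVec_smul, smul_dotProduct, dotProduct_smul]
  simp only [smul_eq_mul]; ring

lemma ofReal_dotProduct_mulVec {n : Type*} [Fintype n] (A : Matrix n n ℝ) (u v : n → ℝ) :
    (fun r => (u r : ℂ)) ⬝ᵥ (A.map Complex.ofReal *ᵥ fun r => (v r : ℂ)) =
      ((u ⬝ᵥ (A *ᵥ v) : ℝ) : ℂ) := by
  simp [dotProduct, mulVec]

lemma IsGaussianState.charFun_eq_exp_covForm (hτ : IsGaussianState τ) (h0 : meanVector τ = 0)
    (z : Fin m → ℂ) : charFun τ z = (Real.exp (-covForm τ z) : ℝ) := by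
  have hs : star (fun r => (phase m z r : ℂ)) = fun r => (phase m z r : ℂ) := by
    ext r; simp
  rw [hτ.charFun_eq, h0, ← mulVec_mulVec, ← mulVec_mulVec, dotProduct_mulVec, ← star_mulVec,
    lambdaMatrix_mulVec, hs, ofReal_dotProduct_mulVec, covForm, Complex.ofReal_exp]
  congr 1
  simp [dotProduct]

/-- Every complex phase-space vector is `phase u + i phase v`, so this identifies `γ + iΩ ≥ 0` with
the inequality of `quadratic_add_symp_nonneg`. -/
lemma star_dotProduct_covMatrix_add (u v : Fin m → ℂ) :
    star (fun r => (phase m u r : ℂ) + Complex.I * phase m v r) ⬝ᵥ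
      (((covMatrix τ).map Complex.ofReal + Complex.I • symplecticForm m) *ᵥ
        fun r => (phase m u r : ℂ) + Complex.I * phase m v r) =
      ((4 * (covForm τ u + covForm τ v + symp u v) : ℝ) : ℂ) := by
  set G := (covMatrix τ).map Complex.ofReal with hG
  have hGt : Gᵀ = G := by rw [hG, ← transpose_map, covMatrix_transpose]
  have e1 : (fun r => (phase m u r : ℂ) + Complex.I * phase m v r) =
      (fun r => (phase m u r : ℂ)) + Complex.I • fun r => (phase m v r : ℂ) := by ext; simp
  have e2 : star (fun r => (phase m u r : ℂ) + Complex.I * phase m v r) =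
      (fun r => (phase m u r : ℂ)) - Complex.I • fun r => (phase m v r : ℂ) := by
    ext; simp [sub_eq_add_neg]
  have h1 := ofReal_dotProduct_mulVec (covMatrix τ) (phase m u) (phase m u)
  have h2 := ofReal_dotProduct_mulVec (covMatrix τ) (phase m v) (phase m v)
  have h3 := dotProduct_mulVec_symm hGt (fun r => (phase m v r : ℂ)) (fun r => (phase m u r : ℂ))
  have h4 := symplecticForm_phase u u
  have h5 := symplecticForm_phase v v
  have h6 := symplecticForm_phase u v
  have h7 := symplecticForm_phase v u
  rw [symp_self] at h4 h5
  rw [symp_swap u v] at h7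
  rw [← hG] at h1 h2
  rw [e2, e1, covForm, covForm]
  generalize (fun r => (phase m u r : ℂ)) = U at *
  generalize (fun r => (phase m v r : ℂ)) = V at *
  simp only [add_mulVec, mulVec_add, smul_mulVec, mulVec_smul, sub_dotProduct, dotProduct_add,
    smul_dotProduct, dotProduct_smul, smul_eq_mul, h1, h2, h3, h4, h5, h6, h7]
  push_cast
  linear_combination (-4 * ((symp u v : ℝ) : ℂ) -
    (((phase m v) ⬝ᵥ (covMatrix τ *ᵥ (phase m v)) : ℝ) : ℂ)) * Complex.I_sq

/-- The uncertainty relation gives semidefiniteness, and full rank makes the matrix invertible,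
hence definite. -/
lemma IsGaussianState.posDef (hτ : IsGaussianState τ) (h0 : meanVector τ = 0)
    (hr : ((covMatrix τ).map Complex.ofReal + Complex.I • symplecticForm m).rank = 2 * m) :
    ((covMatrix τ).map Complex.ofReal + Complex.I • symplecticForm m).PosDef := by
  set M := (covMatrix τ).map Complex.ofReal + Complex.I • symplecticForm m with hM
  have hherm : M.IsHermitian := by
    rw [IsHermitian, hM, conjTranspose_add, conjTranspose_smul, symplecticForm_conjTranspose,
      Complex.star_def, Complex.conj_I, smul_neg, neg_smul, neg_neg, covMatrix_map_conjTranspose]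
  have hsd : M.PosSemidef := by
    refine .of_dotProduct_mulVec_nonneg hherm fun x => ?_
    have hx : x = fun r => (phase m ((phase m).symm fun r => (x r).re) r : ℂ) +
        Complex.I * phase m ((phase m).symm fun r => (x r).im) r := by
      ext r
      rw [LinearEquiv.apply_symm_apply, LinearEquiv.apply_symm_apply, mul_comm, Complex.re_add_im]
    rw [hx, star_dotProduct_covMatrix_add]
    have := quadratic_add_symp_nonneg hτ.isState covForm_smul
      (fun z => hτ.charFun_eq_exp_covForm h0 z) ((phase m).symm fun r => (x r).re)
      ((phase m).symm fun r => (x r).im)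
    rw [Complex.zero_le_real]
    linarith
  rw [hsd.posDef_iff_isUnit]
  rw [← mulVec_surjective_iff_isUnit]
  have h1 : LinearMap.range M.mulVecLin = ⊤ := by
    refine Submodule.eq_top_of_finrank_eq ?_
    rw [← Matrix.rank, hr, Module.finrank_pi, Fintype.card_prod, Fintype.card_fin, Fintype.card_fin]
  exact LinearMap.range_eq_top.1 h1

/-- A centered Gaussian state is a thermal state in a symplectic frame. -/
lemma IsGaussianState.exists_normal_form (hτ : IsGaussianState τ) (h0 : meanVector τ = 0)
    (hr : ((covMatrix τ).map Complex.ofReal + Complex.I • symplecticForm m).rank = 2 * m) :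
    ∃ (β : Fin m → ℝ) (S : (Fin m → ℂ) →ₗ[ℝ] (Fin m → ℂ)), (∀ j, 0 < β j) ∧ IsSymplectic S ∧
      ∀ z, charFun τ (S z) = Complex.exp (-(1 / 2) * thermalForm β z) := by
  have hGt : ((covMatrix τ).map Complex.ofReal)ᵀ = (covMatrix τ).map Complex.ofReal := by
    rw [← transpose_map, covMatrix_transpose]
  obtain ⟨κ, y, hκ, hK, ho, hs⟩ := exists_symplectic_eigenvectors hGt symplecticForm_transpose
    symplecticForm_conjTranspose symplecticForm_mulVec_eq_zero (hτ.posDef h0 hr) (m := m)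
    (by simp)
  -- `z ↦ 2 Re ∑ κ_j^{-1/2} z_j y_j`. As `Ω y_j = -i κ_j G y_j` and the `y_j` are `G`-orthonormal,
  -- the factor `κ_j^{-1/2}` is the one that makes `S` symplectic.
  let L : (Fin m → ℂ) →ₗ[ℝ] (Fin 2 × Fin m → ℝ) :=
    { toFun := fun z r => ∑ j, 2 * (√(κ j))⁻¹ * (z j * y j r).re
      map_add' := fun z w => by
        ext r
        simp only [Pi.add_apply, add_mul, Complex.add_re, mul_add, Finset.sum_add_distrib]
      map_smul' := fun c z => by
        ext r
        simp only [Pi.smul_apply, Complex.real_smul, mul_assoc, Complex.re_ofReal_mul,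
          RingHom.id_apply, smul_eq_mul, Finset.mul_sum]
        refine Finset.sum_congr rfl fun j _ => ?_
        ring }
  let S : (Fin m → ℂ) →ₗ[ℝ] (Fin m → ℂ) := (phase m).symm.toLinearMap ∘ₗ L
  have hLc : ∀ z, (fun r => (phase m (S z) r : ℂ)) =
      ∑ j, ((((√(κ j))⁻¹ : ℝ) : ℂ) * z j) • y j +
        ∑ j, ((((√(κ j))⁻¹ : ℝ) : ℂ) * conj (z j)) • star (y j) := fun z => by
    ext r
    have : phase m (S z) r = ∑ j, 2 * (√(κ j))⁻¹ * (z j * y j r).re :=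
      congrFun ((phase m).apply_symm_apply (L z)) r
    rw [this, Complex.ofReal_sum, ← Finset.sum_add_distrib, Finset.sum_apply]
    refine Finset.sum_congr rfl fun j _ => ?_
    have h := Complex.add_conj (z j * y j r)
    rw [map_mul] at h
    simp only [Pi.add_apply, Pi.smul_apply, Pi.star_apply, smul_eq_mul, Complex.star_def]
    push_cast at h ⊢
    linear_combination (-((√(κ j) : ℝ) : ℂ)⁻¹) * h
  set G := (covMatrix τ).map Complex.ofReal with hG
  have hGstar : ∀ v, G *ᵥ star v = star (G *ᵥ v) := fun v => by
    have hGh : Gᴴ = G := covMatrix_map_conjTranspose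
    rw [star_mulVec, hGh, ← mulVec_transpose, hGt]
  have h1 : ∀ j k, y j ⬝ᵥ (G *ᵥ star (y k)) = if j = k then 1 else 0 := fun j k => by
    rw [dotProduct_mulVec_symm hGt, ho]
    simp only [eq_comm]
  have h2 : ∀ j k, star (y j) ⬝ᵥ (G *ᵥ star (y k)) = 0 := fun j k => by
    rw [hGstar, star_dotProduct_star, dotProduct_comm, hs, star_zero]
  have hκs : ∀ j, (((√(κ j))⁻¹ : ℝ) : ℂ) * (((√(κ j))⁻¹ : ℝ) : ℂ) = ((κ j : ℝ) : ℂ)⁻¹ := fun j => by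
    rw [← Complex.ofReal_mul, ← mul_inv, Real.mul_self_sqrt (hκ j).1.le, Complex.ofReal_inv]
  have hκ0 : ∀ j, ((κ j : ℝ) : ℂ) ≠ 0 := fun j => by exact_mod_cast (hκ j).1.ne'
  have hΩ : ∀ k, symplecticForm m *ᵥ y k = (-Complex.I * κ k) • (G *ᵥ y k) := fun k => by
    have h := congrArg ((-Complex.I) • ·) (hK k)
    simp only [smul_mulVec, smul_smul, neg_mul, Complex.I_mul_I, neg_neg, one_smul] at h ⊢
    exact h
  have hΩ' : ∀ k, symplecticForm m *ᵥ star (y k) = (Complex.I * κ k) • (G *ᵥ star (y k)) :=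
    fun k => by
    have h := congrArg star (hΩ k)
    rw [star_mulVec, symplecticForm_conjTranspose, ← mulVec_transpose, transpose_neg,
      symplecticForm_transpose, neg_neg, star_smul, ← hGstar] at h
    rw [h]
    congr 1
    simp
  -- Chosen so that `(1 + e^{-β_j})/(1 - e^{-β_j}) = 1/κ_j`; the bounds `0 < κ_j < 1` give `0 < β_j
  -- < ∞`.
  refine ⟨fun j => -Real.log ((1 - κ j) / (1 + κ j)), S, fun j => ?_, ⟨fun z w => ?_⟩, fun z => ?_⟩
  · have := hκ j
    rw [neg_pos]
    refine Real.log_neg (div_pos (by linarith) (by linarith)) ?_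
    rw [div_lt_one (by linarith)]
    linarith
  · have h := symplecticForm_phase (S z) (S w)
    rw [hLc, hLc] at h
    simp only [mulVec_add, mulVec_sum, mulVec_smul, hΩ, hΩ', add_dotProduct, sum_dotProduct,
      smul_dotProduct, dotProduct_add, dotProduct_sum, dotProduct_smul, h1, h2, ho, hs,
      smul_eq_mul, mul_ite, mul_one, mul_zero, Finset.sum_ite_eq', Finset.mem_univ, if_true,
      Finset.sum_const_zero, add_zero, zero_add] at h
    rw [← Finset.sum_add_distrib] at h
    have h3 : ∑ j, (Complex.I * (z j * conj (w j) - conj (z j) * w j)) =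
        ((-2 * symp (S z) (S w) : ℝ) : ℂ) := by
      rw [← h]
      refine Finset.sum_congr rfl fun j _ => ?_
      linear_combination (-Complex.I * (z j * conj (w j) - conj (z j) * w j) * κ j) * hκs j -
        Complex.I * (z j * conj (w j) - conj (z j) * w j) * mul_inv_cancel₀ (hκ0 j)
    have h4 := symp_eq z w
    have h5 : ((-2 * symp z w : ℝ) : ℂ) = ((-2 * symp (S z) (S w) : ℝ) : ℂ) := by
      rw [← h3, ← Finset.mul_sum]
      rw [← Finset.sum_div] at h4
      push_cast
      linear_combination (2 * Complex.I) * h4 - 2 * (symp z w : ℂ) * Complex.I_sq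
    have h6 := Complex.ofReal_injective h5
    linarith
  · have h := ofReal_dotProduct_mulVec (covMatrix τ) (phase m (S z)) (phase m (S z))
    rw [hLc, ← hG] at h
    simp only [mulVec_add, mulVec_sum, mulVec_smul, add_dotProduct, sum_dotProduct,
      smul_dotProduct, dotProduct_add, dotProduct_sum, dotProduct_smul, h1, h2, ho, hs,
      smul_eq_mul, mul_ite, mul_one, mul_zero, Finset.sum_ite_eq', Finset.mem_univ, if_true,
      Finset.sum_const_zero, add_zero, zero_add] at h
    rw [← Finset.sum_add_distrib] at h
    have h3 : phase m (S z) ⬝ᵥ (covMatrix τ *ᵥ phase m (S z)) = ∑ j, 2 * ‖z j‖ ^ 2 / κ j := by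
      apply Complex.ofReal_injective
      rw [← h, Complex.ofReal_sum]
      refine Finset.sum_congr rfl fun j _ => ?_
      have hz : ((‖z j‖ : ℝ) : ℂ) ^ 2 = z j * conj (z j) := by
        rw [Complex.mul_conj, Complex.normSq_eq_norm_sq]; push_cast; rfl
      push_cast at hκs ⊢
      rw [hz]
      linear_combination (2 * z j * conj (z j)) * hκs j
    rw [hτ.charFun_eq_exp_covForm h0, covForm, h3, thermalForm, Complex.ofReal_exp,
      Finset.mul_sum]
    congr 1
    push_cast
    rw [← Finset.sum_neg_distrib, Finset.mul_sum]
    refine Finset.sum_congr rfl fun j _ => ?_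
    have h4 := hκ j
    have h5 : (1 + Real.exp (- -Real.log ((1 - κ j) / (1 + κ j)))) /
        (1 - Real.exp (- -Real.log ((1 - κ j) / (1 + κ j)))) = 1 / κ j := by
      rw [neg_neg, Real.exp_log (div_pos (by linarith) (by linarith))]
      have : 1 + κ j ≠ 0 := by linarith
      have : κ j ≠ 0 := by linarith
      field_simp
      ring_nf
      field_simp
    have h6 := congrArg (fun x : ℝ => (x : ℂ)) h5
    push_cast at h6
    rw [h6]
    field_simp
    ring

end Gaussian

end Bosonic
end

noncomputable section

namespace Bosonic

variable {m : ℕ}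

/-! ### Polynomially perturbed thermal states in a symplectic frame -/

/-- A real-linear function is determined by its values at `e_j` and `i e_j`, and the real and
imaginary parts of `z_j` are linear in `z_j` and `z̄_j`. -/
lemma exists_evalPoly_eq_linear (f : (Fin m → ℂ) →ₗ[ℝ] ℂ) :
    ∃ p : MvPolynomial (Fin m ⊕ Fin m) ℂ, ∀ z, evalPoly p z = f z := by
  refine ⟨∑ j, (MvPolynomial.C (f (Pi.single j 1) / 2) *
    (MvPolynomial.X (Sum.inl j) + MvPolynomial.X (Sum.inr j)) +
    MvPolynomial.C (f (Pi.single j Complex.I) / (2 * Complex.I)) *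
      (MvPolynomial.X (Sum.inl j) - MvPolynomial.X (Sum.inr j))), fun z => ?_⟩
  have hz : z = ∑ j, ((z j).re • (Pi.single j 1 : Fin m → ℂ) +
      (z j).im • (Pi.single j Complex.I : Fin m → ℂ)) := by
    ext i
    rw [Finset.sum_apply, Finset.sum_eq_single i]
    · simp
    · intro j _ hj; simp [hj.symm]
    · simp
  conv_rhs => rw [hz]
  rw [map_sum, evalPoly, map_sum]
  refine Finset.sum_congr rfl fun j _ => ?_
  simp only [map_add, map_mul, map_sub, MvPolynomial.eval_C, MvPolynomial.eval_X, Sum.elim_inl,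
    Sum.elim_inr, map_smul, Complex.real_smul]
  rw [Complex.add_conj, Complex.sub_conj]
  have := Complex.I_ne_zero
  push_cast
  field_simp

/-- `S` is only real-linear and mixes `z` with `z̄`, but polynomials in both sets of variables are
stable under such substitutions. -/
lemma exists_evalPoly_comp (S : (Fin m → ℂ) →ₗ[ℝ] (Fin m → ℂ))
    (E : MvPolynomial (Fin m ⊕ Fin m) ℂ) :
    ∃ E' : MvPolynomial (Fin m ⊕ Fin m) ℂ, ∀ z, evalPoly E' z = evalPoly E (S z) := by
  choose p hp using fun j => exists_evalPoly_eq_linear (LinearMap.proj j ∘ₗ S)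
  choose q hq using fun j => exists_evalPoly_eq_linear
    (Complex.conjAe.toLinearMap ∘ₗ LinearMap.proj j ∘ₗ S)
  refine ⟨MvPolynomial.bind₁ (Sum.elim p q) E, fun z => ?_⟩
  rw [evalPoly, evalPoly, MvPolynomial.eval, MvPolynomial.eval₂Hom_bind₁]
  congr 2
  ext i
  cases i with
  | inl j => exact hp j z
  | inr j => exact hq j z

/-! ### Conjugation by the unitary of a symplectic frame. -/

section Frame

variable {S : (Fin m → ℂ) →ₗ[ℝ] (Fin m → ℂ)} {U : Modes m ≃ₗᵢ[ℂ] Modes m}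

/-- `U X U†`. -/
def conjUnitary (U : Modes m ≃ₗᵢ[ℂ] Modes m) (X : Modes m →L[ℂ] Modes m) :
    Modes m →L[ℂ] Modes m :=
  (U : Modes m →L[ℂ] Modes m) ∘L X ∘L (U.symm : Modes m →L[ℂ] Modes m)

lemma conjUnitary_apply (X : Modes m →L[ℂ] Modes m) (f : Modes m) :
    conjUnitary U X (U f) = U (X f) := by
  change U (X (U.symm (U f))) = U (X f)
  rw [U.symm_apply_apply]

lemma isTraceClass_conjUnitary {X : Modes m →L[ℂ] Modes m} (hX : IsTraceClass X) :
    IsTraceClass (conjUnitary U X) := by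
  obtain ⟨A, B, rfl, hA, hB⟩ := hX.exists_factor
  have h : conjUnitary U (A ∘L B) = ((U : Modes m →L[ℂ] Modes m) ∘L A) ∘L
      (B ∘L (U.symm : Modes m →L[ℂ] Modes m)) := ContinuousLinearMap.ext fun _ => rfl
  rw [h]
  exact isTraceClass_comp (hsNormSq_comp_lt_top (U : Modes m →L[ℂ] Modes m) hA)
    (hsNormSq_comp_right_lt_top (U.symm : Modes m →L[ℂ] Modes m) hB)

lemma charFun_conjUnitary (hU : ∀ z f, U (displacement z f) = displacement (S z) (U f))
    {X : Modes m →L[ℂ] Modes m} (hX : IsTraceClass X) (z : Fin m → ℂ) :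
    charFun (conjUnitary U X) (S z) = charFun X z := by
  obtain ⟨A, B, rfl, hA, hB⟩ := hX.exists_factor
  have h1 := trace_comp_comp (fockBasis m)
    (hsNormSq_comp_lt_top (U : Modes m →L[ℂ] Modes m) hA)
    (hsNormSq_comp_right_lt_top (U.symm : Modes m →L[ℂ] Modes m) hB) (displacement (S z))
  rw [charFun, charFun, trace_comp_comp (fockBasis m) hA hB]
  have h : conjUnitary U (A ∘L B) = ((U : Modes m →L[ℂ] Modes m) ∘L A) ∘L
      (B ∘L (U.symm : Modes m →L[ℂ] Modes m)) := ContinuousLinearMap.ext fun _ => rfl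
  rw [h]
  refine h1.trans (tsum_congr fun k => ?_)
  rw [ContinuousLinearMap.adjoint_inner_left, ContinuousLinearMap.adjoint_inner_left]
  change inner ℂ _ (B (U.symm (displacement (S z) (U (A (fockBasis m k)))))) = _
  rw [← hU, U.symm_apply_apply]

end Frame

/-- A frame in which `τ` is a thermal state. -/
lemma exists_thermal_frame {τ : Modes m →L[ℂ] Modes m}
    (hτ : (∃ β : Fin m → ℝ, (∀ j, 0 < β j) ∧ τ = thermalState β) ∨
      (IsGaussianState τ ∧ meanVector τ = 0 ∧
        ((covMatrix τ).map Complex.ofReal + Complex.I • symplecticForm m).rank = 2 * m)) :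
    ∃ (β : Fin m → ℝ) (S : (Fin m → ℂ) →ₗ[ℝ] (Fin m → ℂ)) (U : Modes m ≃ₗᵢ[ℂ] Modes m),
      (∀ j, 0 < β j) ∧ IsSymplectic S ∧
      (∀ z f, U (displacement z f) = displacement (S z) (U f)) ∧
      (∀ k, τ (U (fock k)) = (thermalWeight β k : ℂ) • U (fock k)) ∧
      ∀ z, charFun τ (S z) = thermalTrace β LinearMap.id z := by
  rcases hτ with ⟨β, hβ, rfl⟩ | ⟨hG, h0, hr⟩
  · obtain ⟨X, hX, hXk, hXc⟩ := exists_thermal_operator hβ isLadderBounded_id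
    have hXτ : thermalState β = X := by
      refine ContinuousLinearMap.ext_on
        (Submodule.dense_iff_topologicalClosure_eq_top.2 (fockBasis m).dense_span) ?_
      rintro _ ⟨k, rfl⟩
      rw [fockBasis_apply, thermalState_fock hβ, hXk, LinearMap.id_apply, fockEmb_single, one_smul]
    refine ⟨β, LinearMap.id, LinearIsometryEquiv.refl ℂ _, hβ, isSymplectic_id, fun z f => rfl,
      fun k => thermalState_fock hβ k, fun z => ?_⟩
    rw [hXτ]
    exact hXc z
  · obtain ⟨β, S, hβ, hS, hχ⟩ := hG.exists_normal_form h0 hr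
    obtain ⟨U, hU⟩ := hS.exists_unitary
    obtain ⟨X, hX, hXk, hXc⟩ := exists_thermal_operator hβ isLadderBounded_id
    -- Both operators are trace class with the same characteristic function: the normal form on one
    -- side, the conjugated thermal state on the other.
    have hXτ : τ = conjUnitary U X := by
      refine eq_of_charFun_eq hG.isState.traceClass (isTraceClass_conjUnitary hX) fun w => ?_
      obtain ⟨z, rfl⟩ := hS.surjective w
      rw [hχ, charFun_conjUnitary hU hX, hXc, thermalTrace_id hβ]
    refine ⟨β, S, U, hβ, hS, hU, fun k => ?_, fun z => ?_⟩
    · rw [hXτ, conjUnitary_apply, hXk, LinearMap.id_apply, fockEmb_single, one_smul, map_smul]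
    · rw [hχ, thermalTrace_id hβ]

/-- The perturbations of `τ` in the eigenbasis of `τ`. -/
lemma exists_perturbation {τ : Modes m →L[ℂ] Modes m}
    {β : Fin m → ℝ} {S : (Fin m → ℂ) →ₗ[ℝ] (Fin m → ℂ)} {U : Modes m ≃ₗᵢ[ℂ] Modes m}
    (hβ : ∀ j, 0 < β j) (hS : IsSymplectic S)
    (hU : ∀ z f, U (displacement z f) = displacement (S z) (U f))
    (hχ : ∀ z, charFun τ (S z) = thermalTrace β LinearMap.id z)
    (E : MvPolynomial (Fin m ⊕ Fin m) ℂ) :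
    ∃ c : (Fin m → ℕ) → Modes m, (Summable fun k => thermalWeight β k * ‖c k‖ ^ 2) ∧
      ∀ α : ℝ, ∃ T, IsPerturbation τ E α T ∧
        ∀ k, T (U (fock k)) = (thermalWeight β k : ℂ) • (U (fock k) + (α : ℂ) • c k) := by
  obtain ⟨E', hE'⟩ := exists_evalPoly_comp S E
  obtain ⟨A, r, hA, hAE⟩ := exists_thermalTrace_eq_evalPoly_mul hβ E'
  -- The perturbation is affine in `α`, so one ladder polynomial `A`, for the polynomial `E ∘ S`,
  -- serves all `α`.
  refine ⟨fun k => U (fockEmb (A (Finsupp.single k 1))), ?_, fun α => ?_⟩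
  · simp only [LinearIsometryEquiv.norm_map]
    exact summable_thermalWeight_mul_norm_sq hβ hA
  · have hB : IsLadderBounded (LinearMap.id + (α : ℂ) • A) r :=
      (isLadderBounded_id.mono (Nat.zero_le r)).add (hA.smul _)
    obtain ⟨X, hX, hXk, hXc⟩ := exists_thermal_operator hβ hB
    refine ⟨conjUnitary U X, ⟨isTraceClass_conjUnitary hX, fun w => ?_⟩, fun k => ?_⟩
    · obtain ⟨z, rfl⟩ := hS.surjective w
      rw [charFun_conjUnitary hU hX, hXc, thermalTrace_add hβ isLadderBounded_id (hA.smul _),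
        thermalTrace_smul, hAE, hχ, hE']
      ring
    · rw [conjUnitary_apply, hXk, map_smul]
      congr 1
      rw [LinearMap.add_apply, LinearMap.smul_apply, LinearMap.id_apply, map_add, map_add,
        fockEmb_single, one_smul, map_smul, map_smul]

lemma IsPerturbation.unique {τ : Modes m →L[ℂ] Modes m} {E : MvPolynomial (Fin m ⊕ Fin m) ℂ}
    {α : ℝ} {T T' : Modes m →L[ℂ] Modes m} (h : IsPerturbation τ E α T)
    (h' : IsPerturbation τ E α T') : T = T' :=
  eq_of_charFun_eq h.1 h'.1 fun z => by rw [h.2, h'.2]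

end Bosonic
end

noncomputable section

set_option linter.unusedSectionVars false

namespace Bosonic

/-! ### Spectral estimates for the relative entropy -/

section Spectral

variable {H ι : Type*} [NormedAddCommGroup H] [InnerProductSpace ℂ H] [CompleteSpace H]

lemma inner_self_eq_ofReal (x : H) : inner ℂ x x = ((‖x‖ ^ 2 : ℝ) : ℂ) := by
  rw [inner_self_eq_norm_sq_to_K]
  simp

lemma mem_ker_sub_smul_iff {A : H →L[ℂ] H} {p : ℝ} {x : H} :
    x ∈ (A - (p : ℂ) • ContinuousLinearMap.id ℂ H).ker ↔ A x = (p : ℂ) • x := by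
  rw [LinearMap.mem_ker]
  change A x - (p : ℂ) • x = 0 ↔ _
  rw [sub_eq_zero]

lemma apply_eigenProj (A : H →L[ℂ] H) (p : ℝ) (x : H) :
    A (eigenProj A p x) = (p : ℂ) • eigenProj A p x :=
  mem_ker_sub_smul_iff.1 (Submodule.starProjection_apply_mem _ x)

lemma inner_eigenProj_left (A : H →L[ℂ] H) (p : ℝ) (x y : H) :
    inner ℂ (eigenProj A p x) y = inner ℂ x (eigenProj A p y) :=
  Submodule.inner_starProjection_left_eq_right _ x y

lemma eigenProj_eq_self {A : H →L[ℂ] H} {p : ℝ} {x : H} (h : A x = (p : ℂ) • x) :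
    eigenProj A p x = x :=
  Submodule.starProjection_eq_self_iff.2 (mem_ker_sub_smul_iff.2 h)

lemma IsSelfAdjoint.inner_apply_left {A : H →L[ℂ] H} (hA : IsSelfAdjoint A) (x y : H) :
    inner ℂ (A x) y = inner ℂ x (A y) := by
  rw [← ContinuousLinearMap.adjoint_inner_right, ContinuousLinearMap.isSelfAdjoint_iff'.1 hA]

lemma eigenProj_apply_apply {A : H →L[ℂ] H} (hA : IsSelfAdjoint A) (p : ℝ) (x : H) :
    eigenProj A p (A x) = (p : ℂ) • eigenProj A p x := by
  refine ext_inner_left ℂ fun y => ?_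
  rw [← inner_eigenProj_left, ← IsSelfAdjoint.inner_apply_left hA, apply_eigenProj, inner_smul_left,
    inner_smul_right, Complex.conj_ofReal, inner_eigenProj_left]

lemma eigenProj_eq_zero {A : H →L[ℂ] H} (hA : IsSelfAdjoint A) {p q : ℝ} {x : H}
    (h : A x = (q : ℂ) • x) (hpq : p ≠ q) : eigenProj A p x = 0 := by
  have h1 := eigenProj_apply_apply hA p x
  rw [h, map_smul, ← sub_eq_zero, ← sub_smul] at h1
  refine (smul_eq_zero.1 h1).resolve_left ?_
  exact sub_ne_zero.2 (by exact_mod_cast hpq.symm)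

lemma eigenProj_idem (A : H →L[ℂ] H) (p : ℝ) (x : H) :
    eigenProj A p (eigenProj A p x) = eigenProj A p x :=
  eigenProj_eq_self (apply_eigenProj A p x)

/-- Bessel's inequality: eigenspaces for distinct eigenvalues are orthogonal. Only this inequality
is needed for the spectral projections of `ρ`, not their completeness. -/
lemma sum_norm_sq_eigenProj_le {A : H →L[ℂ] H} (hA : IsSelfAdjoint A) (F : Finset ℝ) (x : H) :
    ∑ p ∈ F, ‖eigenProj A p x‖ ^ 2 ≤ ‖x‖ ^ 2 := by
  set y := ∑ p ∈ F, eigenProj A p x with hy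
  have h1 : ∀ p, inner ℂ (eigenProj A p x) x = ((‖eigenProj A p x‖ ^ 2 : ℝ) : ℂ) := fun p => by
    rw [← inner_self_eq_ofReal, inner_eigenProj_left, inner_eigenProj_left, eigenProj_idem]
  have h2 : inner ℂ y x = ((∑ p ∈ F, ‖eigenProj A p x‖ ^ 2 : ℝ) : ℂ) := by
    rw [hy, sum_inner, Complex.ofReal_sum]
    exact Finset.sum_congr rfl fun p _ => h1 p
  have h3 : inner ℂ y y = ((∑ p ∈ F, ‖eigenProj A p x‖ ^ 2 : ℝ) : ℂ) := by
    rw [← h2, hy, sum_inner, sum_inner]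
    refine Finset.sum_congr rfl fun p hp => ?_
    rw [inner_sum, Finset.sum_eq_single p]
    · rw [inner_eigenProj_left, eigenProj_idem, inner_eigenProj_left]
    · intro q _ hqp
      rw [inner_eigenProj_left, eigenProj_eq_zero hA (apply_eigenProj A q x) hqp.symm,
        inner_zero_right]
    · exact fun h => absurd hp h
  have h4 : ‖y‖ ^ 2 = ∑ p ∈ F, ‖eigenProj A p x‖ ^ 2 := by
    rw [inner_self_eq_ofReal] at h3
    exact_mod_cast h3
  have h5 : ∑ p ∈ F, ‖eigenProj A p x‖ ^ 2 ≤ ‖y‖ * ‖x‖ := by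
    have := norm_inner_le_norm (𝕜 := ℂ) y x
    rw [h2, Complex.norm_real, Real.norm_of_nonneg (Finset.sum_nonneg fun _ _ => sq_nonneg _)] at this
    exact this
  rw [← h4] at h5 ⊢
  rcases eq_or_lt_of_le (norm_nonneg y) with h | h
  · rw [← h, zero_pow two_ne_zero]; positivity
  · have : ‖y‖ ≤ ‖x‖ := by nlinarith
    gcongr

lemma IsState.isSelfAdjoint {ρ : H →L[ℂ] H} (hρ : IsState ρ) : IsSelfAdjoint ρ :=
  hρ.positive.isSelfAdjoint

/-- Writing `ρ = B²`, one has `p ‖v‖² = ‖B v‖² ≤ tr(B²) ‖v‖² = ‖v‖²`. -/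
lemma IsState.eigenvalue_mem {ρ : H →L[ℂ] H} (hρ : IsState ρ) {p : ℝ} {v : H}
    (h : ρ v = (p : ℂ) • v) (hv : v ≠ 0) : 0 ≤ p ∧ p ≤ 1 := by
  have htr := hρ.trace_one
  obtain ⟨B, hB, rfl, hhs⟩ := hρ.traceClass.exists_sqrt_of_nonneg
    ((ContinuousLinearMap.nonneg_iff_isPositive _).2 hρ.positive)
  have hv' : 0 < ‖v‖ ^ 2 := by positivity
  have h1 : ‖B v‖ ^ 2 = p * ‖v‖ ^ 2 := by
    have h2 := IsSelfAdjoint.inner_apply_left hB v (B v)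
    rw [ContinuousLinearMap.comp_apply] at h
    rw [h, inner_smul_right, inner_self_eq_ofReal, inner_self_eq_ofReal] at h2
    exact_mod_cast h2
  have h2 : HasSum (fun i => ‖B (someBasis H i)‖ ^ 2) 1 := by
    have h3 := trace_comp_apply_eq (someBasis H) hB hhs (ContinuousLinearMap.id ℂ H)
    rw [ContinuousLinearMap.comp_id, htr] at h3
    have h4 := Complex.hasSum_re h3
    rw [Complex.one_re] at h4
    refine h4.congr_fun fun i => ?_
    rw [ContinuousLinearMap.id_apply, inner_self_eq_ofReal]
    rfl
  have h3 : ‖B v‖ ^ 2 ≤ ‖v‖ ^ 2 := by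
    have h4 := enorm_sq_eq_tsum (someBasis H) (B v)
    have h5 : ∑' i, ‖inner ℂ (someBasis H i) (B v)‖ₑ ^ 2 ≤
        ∑' i, ENNReal.ofReal (‖B (someBasis H i)‖ ^ 2) * ‖v‖ₑ ^ 2 := by
      refine ENNReal.tsum_le_tsum fun i => ?_
      rw [← IsSelfAdjoint.inner_apply_left hB, ENNReal.ofReal_pow (norm_nonneg _), ofReal_norm,
        ← mul_pow]
      gcongr
      rw [← ofReal_norm, ← ofReal_norm, ← ofReal_norm, ← ENNReal.ofReal_mul (norm_nonneg _)]
      exact ENNReal.ofReal_le_ofReal (norm_inner_le_norm _ _)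
    rw [ENNReal.tsum_mul_right, ← ENNReal.ofReal_tsum_of_nonneg (fun _ => sq_nonneg _) h2.summable,
      h2.tsum_eq, ENNReal.ofReal_one, one_mul, ← h4] at h5
    have h6 := ENNReal.toReal_mono (by simp) h5
    simpa using h6
  rw [h1] at h3
  constructor
  · by_contra hp
    nlinarith [sq_nonneg ‖B v‖]
  · by_contra hp
    nlinarith

/-- The bound `ln x ≤ x - 1` at `x = p/q`. It is quadratic in `p - q`, as the `α²` term requires. -/
lemma entropy_le_sq_div {p q : ℝ} (hp : 0 ≤ p) (hq : 0 < q) :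
    p * (Real.log p - Real.log q) - p + q ≤ (p - q) ^ 2 / q := by
  rcases eq_or_lt_of_le hp with rfl | hp'
  · simp; field_simp; norm_num
  · have h := Real.log_le_sub_one_of_pos (div_pos hp' hq)
    rw [Real.log_div hp'.ne' hq.ne'] at h
    have h1 : p * (Real.log p - Real.log q) ≤ p * (p / q - 1) := mul_le_mul_of_nonneg_left h hp
    have h2 : p * (p / q - 1) - p + q = (p - q) ^ 2 / q := by field_simp; ring
    linarith

/-- Linear in `|p - q|`, but costing only `ln (1/q)` instead of `1/q`; this keeps the weight on the
error `ρ - T` polynomial. -/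
lemma entropy_le_abs_mul {p q : ℝ} (hp : 0 ≤ p) (hp1 : p ≤ 1) (hq : 0 < q) (hq1 : q ≤ 1) :
    p * (Real.log p - Real.log q) - p + q ≤ |p - q| * (1 - Real.log q) := by
  have hlq : Real.log q ≤ 0 := Real.log_nonpos hq.le hq1
  rcases eq_or_lt_of_le hp with rfl | hp'
  · simp only [zero_mul, zero_sub, abs_neg, abs_of_pos hq]
    nlinarith
  · have hlp : Real.log p ≤ 0 := Real.log_nonpos hp hp1
    have h1 := Real.log_le_sub_one_of_pos (div_pos hp' hq)
    rw [Real.log_div hp'.ne' hq.ne', le_sub_iff_add_le, le_div_iff₀ hq] at h1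
    rcases le_total q p with h | h
    · rw [abs_of_nonneg (sub_nonneg.2 h)]
      nlinarith [mul_nonneg (sub_nonneg.2 h) (neg_nonneg.2 hlp)]
    · rw [abs_of_nonpos (sub_nonpos.2 h)]
      have h2 := Real.log_le_log hp' h
      nlinarith [mul_nonneg hp (sub_nonneg.2 h2), mul_nonneg (sub_nonneg.2 h) (neg_nonneg.2 hlq)]

/-- Here `a` is the contribution of the perturbation and `b` that of the error. If `a` dominates,
the quadratic bound is used; if `b` does, the linear one with a single factor of `b`. -/
lemma entropy_mul_sq_le {p q w a b : ℝ} (hp : 0 ≤ p) (hp1 : p ≤ 1) (hq : 0 < q) (hq1 : q ≤ 1)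
    (hw : 0 ≤ w) (hb : 0 ≤ b) (h : |p - q| * w ≤ a + b) :
    (p * (Real.log p - Real.log q) - p + q) * w ^ 2 ≤
      4 * a ^ 2 / q + 2 * (1 - Real.log q) * (b * w) := by
  have hL : 0 ≤ 1 - Real.log q := by linarith [Real.log_nonpos hq.le hq1]
  rcases le_total b a with hab | hab
  · have h1 : (p * (Real.log p - Real.log q) - p + q) * w ^ 2 ≤ (p - q) ^ 2 / q * w ^ 2 :=
      mul_le_mul_of_nonneg_right (entropy_le_sq_div hp hq) (sq_nonneg w)
    have h2 : (|p - q| * w) ^ 2 ≤ (2 * a) ^ 2 :=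
      pow_le_pow_left₀ (by positivity) (by linarith) 2
    rw [mul_pow, sq_abs] at h2
    have h3 : (p - q) ^ 2 / q * w ^ 2 ≤ 4 * a ^ 2 / q := by
      rw [div_mul_eq_mul_div]
      exact div_le_div_of_nonneg_right (by linarith) hq.le
    have h4 : 0 ≤ 2 * (1 - Real.log q) * (b * w) := by positivity
    linarith
  · have h1 : (p * (Real.log p - Real.log q) - p + q) * w ^ 2 ≤
        |p - q| * (1 - Real.log q) * w ^ 2 :=
      mul_le_mul_of_nonneg_right (entropy_le_abs_mul hp hp1 hq hq1) (sq_nonneg w)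
    have h2 : (|p - q| * w) * ((1 - Real.log q) * w) ≤ (2 * b) * ((1 - Real.log q) * w) :=
      mul_le_mul_of_nonneg_right (by linarith) (by positivity)
    have h4 : 0 ≤ 4 * a ^ 2 / q := by positivity
    nlinarith

variable (ψ : HilbertBasis ι ℂ H)

/-- Each `ψ k` lies in exactly one eigenspace of `τ`, so computing the Hilbert–Schmidt norms in this
basis collapses the sum over the eigenvalues of `τ`. -/
lemma relEntropy_eq_tsum {ρ τ : H →L[ℂ] H} {c : ι → ℝ}
    (hτ : ∀ k, τ (ψ k) = (c k : ℂ) • ψ k) :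
    relEntropy ρ τ = ∑' k, ∑' p : ℝ, relEntropyTerm p (c k) * ‖eigenProj ρ p (ψ k)‖ₑ ^ 2 := by
  have hτs := isSelfAdjoint_of_diagonal ψ c hτ
  rw [relEntropy, ENNReal.tsum_comm]
  simp_rw [hsNormSq_eq ψ, ← ENNReal.tsum_mul_left]
  have h1 : ∀ q p : ℝ, ∑' k, relEntropyTerm p q * ‖(eigenProj ρ p ∘L eigenProj τ q) (ψ k)‖ₑ ^ 2 =
      ∑' k, if c k = q then relEntropyTerm p q * ‖eigenProj ρ p (ψ k)‖ₑ ^ 2 else 0 := fun q p => by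
    refine tsum_congr fun k => ?_
    rw [ContinuousLinearMap.comp_apply]
    split_ifs with h
    · rw [eigenProj_eq_self (A := τ) (by rw [hτ, h])]
    · rw [eigenProj_eq_zero hτs (hτ k) (Ne.symm h)]
      simp
  simp_rw [h1]
  have h2 : ∀ q : ℝ, ∑' p : ℝ, ∑' k, (if c k = q then relEntropyTerm p q *
      ‖eigenProj ρ p (ψ k)‖ₑ ^ 2 else 0) = ∑' k, ∑' p : ℝ, if c k = q then relEntropyTerm p q *
      ‖eigenProj ρ p (ψ k)‖ₑ ^ 2 else 0 := fun q => ENNReal.tsum_comm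
  simp_rw [h2]
  rw [ENNReal.tsum_comm]
  refine tsum_congr fun k => ?_
  rw [tsum_eq_single (c k)]
  · simp
  · intro q hq
    simp [hq.symm]

/-- The entropy relative to a state with eigenbasis `ψ`, for perturbations of that state. -/
lemma relEntropy_le_tsum {ρ τ T : H →L[ℂ] H} {c : ι → ℝ} {v : ι → H} (hρ : IsState ρ)
    (hτ : ∀ k, τ (ψ k) = (c k : ℂ) • ψ k) (hc : ∀ k, 0 < c k ∧ c k ≤ 1) {α : ℝ}
    (hT : ∀ k, T (ψ k) = (c k : ℂ) • (ψ k + (α : ℂ) • v k)) :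
    relEntropy ρ τ ≤ ∑' k, ENNReal.ofReal (4 * α ^ 2 * (c k * ‖v k‖ ^ 2) +
      2 * (1 - Real.log (c k)) * ‖(ρ - T) (ψ k)‖) := by
  rw [relEntropy_eq_tsum ψ hτ]
  refine ENNReal.tsum_le_tsum fun k => ?_
  obtain ⟨hc0, hc1⟩ := hc k
  have hρs := hρ.isSelfAdjoint
  have hL : 0 ≤ 1 - Real.log (c k) := by linarith [Real.log_nonpos hc0.le hc1]
  set δ := (ρ - T) (ψ k) with hδ
  have h1 : ∀ p : ℝ, relEntropyTerm p (c k) * ‖eigenProj ρ p (ψ k)‖ₑ ^ 2 ≤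
      ENNReal.ofReal (4 * α ^ 2 * c k * ‖eigenProj ρ p (v k)‖ ^ 2 +
        2 * (1 - Real.log (c k)) * (‖eigenProj ρ p δ‖ * ‖eigenProj ρ p (ψ k)‖)) := fun p => by
    by_cases hw : eigenProj ρ p (ψ k) = 0
    · simp [hw]
    · obtain ⟨hp0, hp1⟩ := hρ.eigenvalue_mem (apply_eigenProj ρ p (ψ k)) hw
      rw [relEntropyTerm, if_neg hc0.ne', ← ofReal_norm, ← ENNReal.ofReal_pow (norm_nonneg _),
        ← ENNReal.ofReal_mul' (sq_nonneg _)]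
      refine ENNReal.ofReal_le_ofReal ?_
      -- Apply the spectral projection of `ρ` to `ρ ψ_k = T ψ_k + δ`.
      have h2 : ((p - c k : ℝ) : ℂ) • eigenProj ρ p (ψ k) =
          ((α * c k : ℝ) : ℂ) • eigenProj ρ p (v k) + eigenProj ρ p δ := by
        have h3 : δ = ρ (ψ k) - T (ψ k) := rfl
        rw [h3, hT, map_sub, eigenProj_apply_apply hρs, map_smul, map_add, map_smul]
        push_cast
        module
      have h4 : |p - c k| * ‖eigenProj ρ p (ψ k)‖ ≤
          |α| * c k * ‖eigenProj ρ p (v k)‖ + ‖eigenProj ρ p δ‖ := by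
        have h5 := congrArg norm h2
        rw [norm_smul, Complex.norm_real, Real.norm_eq_abs] at h5
        rw [h5]
        refine (norm_add_le _ _).trans ?_
        rw [norm_smul, Complex.norm_real, Real.norm_eq_abs, abs_mul, abs_of_pos hc0]
      refine (entropy_mul_sq_le hp0 hp1 hc0 hc1 (norm_nonneg _) (norm_nonneg _)
        h4).trans (le_of_eq ?_)
      rw [mul_pow, mul_pow, sq_abs]
      field_simp
  refine (ENNReal.tsum_le_tsum h1).trans ?_
  rw [ENNReal.tsum_eq_iSup_sum]
  refine iSup_le fun F => ?_
  rw [← ENNReal.ofReal_sum_of_nonneg fun p _ => by positivity]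
  refine ENNReal.ofReal_le_ofReal ?_
  rw [Finset.sum_add_distrib, ← Finset.mul_sum, ← Finset.mul_sum]
  have h2 := sum_norm_sq_eigenProj_le hρs F (v k)
  -- Cauchy–Schwarz over the spectrum of `ρ`, then Bessel for `δ` and for the unit vector `ψ_k`.
  have h3 : ∑ p ∈ F, ‖eigenProj ρ p δ‖ * ‖eigenProj ρ p (ψ k)‖ ≤ ‖δ‖ := by
    refine (Real.sum_mul_le_sqrt_mul_sqrt _ _ _).trans ?_
    have h4 := Real.sqrt_le_sqrt (sum_norm_sq_eigenProj_le hρs F δ)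
    have h5 := Real.sqrt_le_sqrt (sum_norm_sq_eigenProj_le hρs F (ψ k))
    rw [Real.sqrt_sq (norm_nonneg _)] at h4 h5
    rw [ψ.orthonormal.1 k] at h5
    nlinarith [Real.sqrt_nonneg (∑ p ∈ F, ‖eigenProj ρ p δ‖ ^ 2),
      Real.sqrt_nonneg (∑ p ∈ F, ‖eigenProj ρ p (ψ k)‖ ^ 2)]
  rw [← mul_assoc]
  gcongr

end Spectral

end Bosonic
end

noncomputable section

namespace Bosonic

variable {m : ℕ}

/-! ### Weighted summation -/

lemma tsum_rpow_half_mul_le {ι : Type*} (f g : ι → ℝ≥0∞) :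
    ∑' k, (f k * g k) ^ (1 / 2 : ℝ) ≤ (∑' k, f k) ^ (1 / 2 : ℝ) * (∑' k, g k) ^ (1 / 2 : ℝ) := by
  rw [ENNReal.tsum_eq_iSup_sum]
  refine iSup_le fun F => ?_
  have h := ENNReal.inner_le_Lp_mul_Lq F (fun k => f k ^ (1 / 2 : ℝ)) (fun k => g k ^ (1 / 2 : ℝ))
    Real.HolderConjugate.two_two
  have h2 : ∀ x : ℝ≥0∞, (x ^ (1 / 2 : ℝ)) ^ (2 : ℝ) = x := fun x => by
    rw [← ENNReal.rpow_mul]; norm_num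
  simp only [h2] at h
  simp only [ENNReal.mul_rpow_of_nonneg _ _ (by norm_num : (0 : ℝ) ≤ 1 / 2)]
  refine h.trans ?_
  gcongr
  · exact ENNReal.sum_le_tsum F
  · exact ENNReal.sum_le_tsum F

/-- Since `∏ (k_j + 1) ≤ (deg + 1)^m`, the terms are dominated by a product of one-mode series with
exponent `(m + 1)/m > 1`. -/
lemma summable_inv_degree_pow (m : ℕ) :
    Summable fun k : Fin m → ℕ => ((((∑ j, k j : ℕ) : ℝ) + 1) ^ (m + 1))⁻¹ := by
  rcases Nat.eq_zero_or_pos m with rfl | hm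
  · exact Summable.of_finite
  · have hm' : (0 : ℝ) < m := by exact_mod_cast hm
    have h1 : Summable fun n : ℕ => (((n : ℝ) + 1) ^ (((m : ℝ) + 1) / m))⁻¹ := by
      have h := (summable_nat_add_iff 1).2 (Real.summable_nat_rpow_inv.2
        (show (1 : ℝ) < ((m : ℝ) + 1) / m by rw [lt_div_iff₀ hm']; linarith))
      simpa using h
    have h2 := (hasSum_pi_prod (fun (_ : Fin m) n => by positivity) fun _ => h1.hasSum).summable
    refine Summable.of_nonneg_of_le (fun k => by positivity) (fun k => ?_) h2
    rw [Finset.prod_inv_distrib]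
    refine inv_anti₀ (Finset.prod_pos fun j _ => by positivity) ?_
    rw [Real.finsetProd_rpow _ _ fun j _ => by positivity]
    have h3 : ∏ j, ((k j : ℝ) + 1) ≤ (((∑ j, k j : ℕ) : ℝ) + 1) ^ m := by
      refine (Finset.prod_le_prod (fun j _ => by positivity) fun j _ =>
        (?_ : (k j : ℝ) + 1 ≤ ((∑ j, k j : ℕ) : ℝ) + 1)).trans ?_
      · exact_mod_cast Nat.succ_le_succ (Finset.single_le_sum (fun _ _ => Nat.zero_le _)
          (Finset.mem_univ j))
      · simp
    refine (Real.rpow_le_rpow (Finset.prod_nonneg fun j _ => by positivity) h3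
      (by positivity)).trans (le_of_eq ?_)
    rw [← Real.rpow_natCast, ← Real.rpow_mul (by positivity), mul_div_cancel₀ _ hm'.ne',
      ← Real.rpow_natCast]
    push_cast; rfl

lemma tsum_inv_degreeWeight_pow_lt_top (m : ℕ) :
    ∑' k : Fin m → ℕ, (degreeWeight k ^ (m + 1))⁻¹ < ⊤ := by
  have h := (summable_inv_degree_pow m).tsum_ofReal_lt_top
  convert! h using 3 with k
  rw [ENNReal.ofReal_inv_of_pos (by positivity), ENNReal.ofReal_pow (by positivity), degreeWeight,
    ← ENNReal.ofReal_natCast]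
  push_cast; rfl

/-- The source of the order `m + 3`: Cauchy–Schwarz with `w = w^{-(m+1)/2} w^{(m+3)/2}`, where `m +
1` is the exponent that makes the first factor summable. -/
lemma tsum_degreeWeight_mul_le (x : (Fin m → ℕ) → ℝ≥0∞) :
    ∑' k, degreeWeight k * x k ≤ (∑' k : Fin m → ℕ, (degreeWeight k ^ (m + 1))⁻¹) ^ (1 / 2 : ℝ) *
      (∑' k, degreeWeight k ^ (m + 3) * x k ^ 2) ^ (1 / 2 : ℝ) := by
  refine le_trans (le_of_eq (tsum_congr fun k => ?_)) (tsum_rpow_half_mul_le _ _)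
  have h0 : degreeWeight k ^ (m + 1) ≠ 0 :=
    pow_ne_zero _ (zero_lt_one.trans_le (one_le_degreeWeight k)).ne'
  have h1 : degreeWeight k ^ (m + 1) ≠ ⊤ := ENNReal.pow_ne_top (degreeWeight_ne_top k)
  have h2 : (degreeWeight k ^ (m + 1))⁻¹ * (degreeWeight k ^ (m + 3) * x k ^ 2) =
      (degreeWeight k * x k) ^ 2 := by
    rw [show m + 3 = (m + 1) + 2 by ring, pow_add _ (m + 1) 2, ← mul_assoc, ← mul_assoc,
      ENNReal.inv_mul_cancel h0 h1, one_mul, mul_pow]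
  rw [h2, ← ENNReal.rpow_natCast, ← ENNReal.rpow_mul]
  norm_num

/-- The logarithm of a thermal weight is affine in the occupation numbers. -/
lemma exists_one_sub_log_thermalWeight_le {β : Fin m → ℝ} (hβ : ∀ j, 0 < β j) :
    ∃ C : ℝ, 0 ≤ C ∧ ∀ k,
      1 - Real.log (thermalWeight β k) ≤ C * (((∑ j, k j : ℕ) : ℝ) + 1) := by
  have hl : ∀ j, 0 ≤ -Real.log (1 - Real.exp (-β j)) := fun j => by
    have := exp_neg_mem hβ j
    exact neg_nonneg.2 (Real.log_nonpos (by linarith) (by linarith))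
  refine ⟨1 + ∑ j, (-Real.log (1 - Real.exp (-β j)) + β j), ?_, fun k => ?_⟩
  · have := Finset.sum_nonneg fun j (_ : j ∈ Finset.univ) => add_nonneg (hl j) (hβ j).le
    linarith
  · have h1 : Real.log (thermalWeight β k) =
        ∑ j, (Real.log (1 - Real.exp (-β j)) + -β j * k j) := by
      rw [thermalWeight, Real.log_prod]
      · refine Finset.sum_congr rfl fun j _ => ?_
        rw [Real.log_mul _ (Real.exp_pos _).ne', Real.log_exp]
        linarith [(exp_neg_mem hβ j).2]
      · intro j _
        have := (exp_neg_mem hβ j).2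
        exact mul_ne_zero (by linarith) (Real.exp_pos _).ne'
    have hn : (0 : ℝ) ≤ ((∑ j, k j : ℕ) : ℝ) := Nat.cast_nonneg _
    have h2 : -Real.log (thermalWeight β k) ≤
        (∑ j, (-Real.log (1 - Real.exp (-β j)) + β j)) * (((∑ j, k j : ℕ) : ℝ) + 1) := by
      rw [h1, ← Finset.sum_neg_distrib, Finset.sum_mul]
      refine Finset.sum_le_sum fun j _ => ?_
      have h3 : (k j : ℝ) ≤ ((∑ j, k j : ℕ) : ℝ) := by
        exact_mod_cast Finset.single_le_sum (fun _ _ => Nat.zero_le _) (Finset.mem_univ j)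
      nlinarith [hl j, hβ j, mul_nonneg (hl j) hn, mul_le_mul_of_nonneg_left h3 (hβ j).le]
    nlinarith

/-- By Parseval the weighted sum for `X` is the sum over `l` of the moments of `X† |l⟩`, and the
comparison of moments applies to each of these. -/
lemma exists_tsum_degreeWeight_unitary_le {S : (Fin m → ℂ) →ₗ[ℝ] (Fin m → ℂ)}
    {U : Modes m ≃ₗᵢ[ℂ] Modes m}
    (hU : ∀ z f, U (displacement z f) = displacement (S z) (U f)) (d : ℕ) :
    ∃ C : ℝ≥0∞, C ≠ ⊤ ∧ ∀ X : Modes m →L[ℂ] Modes m,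
      ∑' k, degreeWeight k ^ d * ‖X (U (fock k))‖ₑ ^ 2 ≤
        C * ∑' k, degreeWeight k ^ d * ‖X (fock k)‖ₑ ^ 2 := by
  obtain ⟨C, hC, h⟩ := exists_basisMoment_unitary_le hU d
  refine ⟨C, hC, fun X => ?_⟩
  have h1 : ∀ b : (Fin m → ℕ) → Modes m, ∑' k, degreeWeight k ^ d * ‖X (b k)‖ₑ ^ 2 =
      ∑' l, basisMoment b d (ContinuousLinearMap.adjoint X (fock l)) := fun b => by
    simp only [basisMoment]
    rw [ENNReal.tsum_comm]
    refine tsum_congr fun k => ?_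
    rw [ENNReal.tsum_mul_left, enorm_sq_eq_tsum (fockBasis m)]
    congr 1
    refine tsum_congr fun l => ?_
    rw [fockBasis_apply, ContinuousLinearMap.adjoint_inner_right, enorm_inner_symm]
  rw [h1, h1, ← ENNReal.tsum_mul_left]
  exact ENNReal.tsum_le_tsum fun l => h _

/-- For `m ≥ 1` the degree plus one is at most the degree plus `m`; this is where the absence of
modes has to be excluded. -/
lemma tsum_degreeWeight_le_weightedHSNorm (hm : m ≠ 0) (X : Modes m →L[ℂ] Modes m) :
    (∑' k, degreeWeight k ^ (m + 3) * ‖X (fock k)‖ₑ ^ 2) ^ (1 / 2 : ℝ) ≤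
      weightedHSNorm (((m : ℝ) + 3) / 2) X := by
  rw [weightedHSNorm]
  refine ENNReal.rpow_le_rpow (ENNReal.tsum_le_tsum fun k => ?_) (by norm_num)
  have hn : (0 : ℝ) ≤ ((∑ j, k j : ℕ) : ℝ) := Nat.cast_nonneg _
  have hm1 : (1 : ℝ) ≤ m := by exact_mod_cast Nat.one_le_iff_ne_zero.2 hm
  have hpos : 0 ≤ ((∑ j, k j : ℕ) : ℝ) + m := by linarith
  rw [numberPow, map_smul, enorm_smul, mul_pow]
  refine mul_le_mul' ?_ le_rfl
  rw [← ofReal_norm, Complex.norm_real, Real.norm_of_nonneg (Real.rpow_nonneg hpos _),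
    ← ENNReal.ofReal_pow (Real.rpow_nonneg hpos _), ← Real.rpow_mul_natCast hpos]
  have h1 : ((m : ℝ) + 3) / 2 * (2 : ℕ) = ((m + 3 : ℕ) : ℝ) := by push_cast; ring
  rw [h1, Real.rpow_natCast, ENNReal.ofReal_pow hpos, degreeWeight]
  gcongr
  rw [← ENNReal.ofReal_natCast]
  refine ENNReal.ofReal_le_ofReal ?_
  push_cast
  push_cast at hn
  linarith

/-- The entropy bound in an eigenbasis of `τ`. -/
lemma exists_relEntropy_le {τ : Modes m →L[ℂ] Modes m} {β : Fin m → ℝ}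
    {S : (Fin m → ℂ) →ₗ[ℝ] (Fin m → ℂ)} {U : Modes m ≃ₗᵢ[ℂ] Modes m} (hβ : ∀ j, 0 < β j)
    (hU : ∀ z f, U (displacement z f) = displacement (S z) (U f))
    (hτ : ∀ k, τ (U (fock k)) = (thermalWeight β k : ℂ) • U (fock k))
    {c : (Fin m → ℕ) → Modes m} (hc : Summable fun k => thermalWeight β k * ‖c k‖ ^ 2) :
    ∃ C : ℝ, 0 < C ∧ ∀ (α : ℝ) (T ρ : Modes m →L[ℂ] Modes m), IsState ρ →
      (∀ k, T (U (fock k)) = (thermalWeight β k : ℂ) • (U (fock k) + (α : ℂ) • c k)) →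
      relEntropy ρ τ ≤ ENNReal.ofReal C * (ENNReal.ofReal (α ^ 2) +
        (∑' k, degreeWeight k ^ (m + 3) * ‖(ρ - T) (fock k)‖ₑ ^ 2) ^ (1 / 2 : ℝ)) := by
  obtain ⟨L, hL0, hL⟩ := exists_one_sub_log_thermalWeight_le hβ
  obtain ⟨M, hM, hMb⟩ := exists_tsum_degreeWeight_unitary_le hU (m + 3)
  set K := ∑' k : Fin m → ℕ, (degreeWeight k ^ (m + 1))⁻¹ with hK
  have hKt : K < ⊤ := tsum_inv_degreeWeight_pow_lt_top m
  set A := ENNReal.ofReal (4 * ∑' k, thermalWeight β k * ‖c k‖ ^ 2) with hA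
  set B := ENNReal.ofReal (2 * L) * (K ^ (1 / 2 : ℝ) * M ^ (1 / 2 : ℝ)) with hB
  have hBt : B ≠ ⊤ := ENNReal.mul_ne_top ENNReal.ofReal_ne_top (ENNReal.mul_ne_top
    (ENNReal.rpow_ne_top_of_nonneg (by norm_num) hKt.ne)
    (ENNReal.rpow_ne_top_of_nonneg (by norm_num) hM))
  have hABt : A + B ≠ ⊤ := ENNReal.add_ne_top.2 ⟨ENNReal.ofReal_ne_top, hBt⟩
  -- `A` comes from the perturbation, `B` from the error term; the added `1` only makes the constant
  -- positive.
  refine ⟨(A + B).toReal + 1, by positivity, fun α T ρ hρ hT => ?_⟩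
  set W := (∑' k, degreeWeight k ^ (m + 3) * ‖(ρ - T) (fock k)‖ₑ ^ 2) ^ (1 / 2 : ℝ) with hW
  have hmain := relEntropy_le_tsum (unitaryBasis U) (c := thermalWeight β) (v := c) hρ
    (by simpa only [unitaryBasis_apply] using hτ)
    (fun k => ⟨thermalWeight_pos hβ k, thermalWeight_le_one hβ k⟩) (α := α) (T := T)
    (by simpa only [unitaryBasis_apply] using hT)
  have h1 : ∀ k, ENNReal.ofReal (4 * α ^ 2 * (thermalWeight β k * ‖c k‖ ^ 2) +
      2 * (1 - Real.log (thermalWeight β k)) * ‖(ρ - T) (unitaryBasis U k)‖) ≤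
      ENNReal.ofReal (α ^ 2) * ENNReal.ofReal (4 * (thermalWeight β k * ‖c k‖ ^ 2)) +
        ENNReal.ofReal (2 * L) * (degreeWeight k * ‖(ρ - T) (U (fock k))‖ₑ) := fun k => by
    have h2 : degreeWeight k = ENNReal.ofReal (((∑ j, k j : ℕ) : ℝ) + 1) := by
      rw [degreeWeight, ← ENNReal.ofReal_natCast]; push_cast; rfl
    rw [unitaryBasis_apply, h2, ← ofReal_norm, ← ENNReal.ofReal_mul (sq_nonneg _),
      ← ENNReal.ofReal_mul (by positivity), ← ENNReal.ofReal_mul (by positivity)]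
    refine (ENNReal.ofReal_le_ofReal ?_).trans ENNReal.ofReal_add_le
    have h3 := mul_le_mul_of_nonneg_right (hL k) (norm_nonneg ((ρ - T) (U (fock k))))
    linarith
  refine hmain.trans ((ENNReal.tsum_le_tsum h1).trans ?_)
  rw [ENNReal.tsum_add, ENNReal.tsum_mul_left, ENNReal.tsum_mul_left,
    ← ENNReal.ofReal_tsum_of_nonneg
      (fun k => by have := thermalWeight_pos hβ k; positivity) (hc.mul_left 4), tsum_mul_left]
  have h4 : ∑' k, degreeWeight k * ‖(ρ - T) (U (fock k))‖ₑ ≤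
      (K ^ (1 / 2 : ℝ) * M ^ (1 / 2 : ℝ)) * W := by
    refine (tsum_degreeWeight_mul_le _).trans ?_
    rw [mul_assoc, hW, ← ENNReal.mul_rpow_of_nonneg M _ (by norm_num : (0 : ℝ) ≤ 1 / 2)]
    exact mul_le_mul' le_rfl (ENNReal.rpow_le_rpow (hMb _) (by norm_num))
  have hC : A + B ≤ ENNReal.ofReal ((A + B).toReal + 1) := by
    rw [← ENNReal.ofReal_toReal hABt, ENNReal.toReal_ofReal ENNReal.toReal_nonneg]
    exact ENNReal.ofReal_le_ofReal (by linarith)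
  rw [mul_add, mul_comm (ENNReal.ofReal (α ^ 2))]
  refine add_le_add ?_ ?_
  · exact mul_le_mul' ((le_self_add).trans hC) le_rfl
  · refine (mul_le_mul' le_rfl h4).trans ?_
    rw [← mul_assoc]
    exact mul_le_mul' ((le_add_self).trans hC) le_rfl

end Bosonic
end

/-! ### Assembly of the frame, the perturbation and the entropy bound. -/

theorem theorem4 (m : ℕ) (τ : Bosonic.Modes m →L[ℂ] Bosonic.Modes m)
    (hτ : (∃ β : Fin m → ℝ, (∀ j, 0 < β j) ∧ τ = Bosonic.thermalState β) ∨
      (Bosonic.IsGaussianState τ ∧ Bosonic.meanVector τ = 0 ∧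
        ((Bosonic.covMatrix τ).map Complex.ofReal +
          Complex.I • Bosonic.symplecticForm m).rank = 2 * m))
    (E : MvPolynomial (Fin m ⊕ Fin m) ℂ)
    (hodd : ∀ z : Fin m → ℂ, Bosonic.evalPoly E (-z) = -Bosonic.evalPoly E z)
    (hconj : ∀ z : Fin m → ℂ, -Bosonic.evalPoly E z = conj (Bosonic.evalPoly E z)) :
    ∃ C : ℝ, 0 < C ∧ ∀ α : ℝ,
      (∃! T : Bosonic.Modes m →L[ℂ] Bosonic.Modes m, Bosonic.IsPerturbation τ E α T) ∧
      ∀ T : Bosonic.Modes m →L[ℂ] Bosonic.Modes m, Bosonic.IsPerturbation τ E α T →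
        ∀ ρ : Bosonic.Modes m →L[ℂ] Bosonic.Modes m,
          Bosonic.IsState ρ → Bosonic.moment ((m : ℝ) + 3) ρ < ⊤ →
          Bosonic.relEntropy ρ τ ≤
            ENNReal.ofReal C * (ENNReal.ofReal (α ^ 2) +
              Bosonic.weightedHSNorm (((m : ℝ) + 3) / 2) (ρ - T)) := by
  obtain ⟨β, S, U, hβ, hS, hU, hτk, hχ⟩ := Bosonic.exists_thermal_frame hτ
  obtain ⟨c, hc, hT⟩ := Bosonic.exists_perturbation hβ hS hU hχ E
  obtain ⟨C, hC, hbound⟩ := Bosonic.exists_relEntropy_le hβ hU hτk hc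
  refine ⟨C, hC, fun α => ?_⟩
  obtain ⟨T₀, hT₀, hT₀k⟩ := hT α
  refine ⟨⟨T₀, hT₀, fun T h => h.unique hT₀⟩, fun T hTp ρ hρ _ => ?_⟩
  obtain rfl := hTp.unique hT₀
  refine (hbound α T ρ hρ hT₀k).trans ?_
  gcongr
  -- For `m = 0` the weight `N_m + m` is zero and so is the weighted norm, so `ρ = T` must be shown.
  -- The only argument is `z = 0`, where oddness gives `E(0) = 0` and both characteristic functions
  -- equal one.
  rcases eq_or_ne m 0 with rfl | hm
  · have h0 : Bosonic.evalPoly E 0 = 0 := by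
      have h := hodd 0
      rw [neg_zero] at h
      linear_combination (1 / 2 : ℂ) * h
    have hρT : ρ = T := by
      refine Bosonic.eq_of_charFun_eq hρ.traceClass hTp.1 fun z => ?_
      have hz : z = 0 := Subsingleton.elim _ _
      have hd : Bosonic.displacement (0 : Fin 0 → ℂ) =
          ContinuousLinearMap.id ℂ (Bosonic.Modes 0) :=
        ContinuousLinearMap.ext fun f => Bosonic.displacement_zero f
      have h1 : Bosonic.charFun ρ 0 = 1 := by
        rw [Bosonic.charFun, hd, ContinuousLinearMap.comp_id, hρ.trace_one]
      have h2 : Bosonic.charFun τ 0 = 1 := by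
        have h := hχ 0
        rw [map_zero, Bosonic.thermalTrace_id hβ] at h
        rw [h]
        simp [Bosonic.thermalForm]
      rw [hz, h1, hTp.2, h2, h0]
      simp
    simp [hρT]
  · exact Bosonic.tsum_degreeWeight_le_weightedHSNorm hm _
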